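/- Let $\mathscr P=\mathscr P_n(\mathbb K)$ be the open cone of positive definite self-adjoint $n\times n$ matrices over $\mathbb K$, where $\mathbb K\in\{\mathbb R,\mathbb C,\mathbb H\}$ and $n\ge 1$, or $\mathbb K=\mathbb O$ and $n=3$. It is regarded as an open subset of the real vector space $V=\mathrm{Herm}_n(\mathbb K)$ with inner product $\langle X,Y\rangle=\Re\,\mathrm{Tr}(XY)$. ("Positive definite" means that $x$ is a positive element of the Jordan algebra $V$, i.e. $\langle x,y^2\rangle>0$ for all $0\ne y\in V$; for associative $\mathbb K$ this is the usual condition $\bar v^{T}xv>0$ for all columns $v\neq0$.) Let $e$ be the identity matrix and let $G$ be the identity component of $G(\mathscr P)=\{a\in GL(V): a\mathscr P=\mathscr P\}$. A *potential pre-Frobenius structure* on an open subset $D$ of a real vector space, with its standard flat torsion-free connection $\nabla^0$, consists of a smooth non-degenerate symmetric bilinear form $g$ on tangent vectors with $\nabla^0 g$ symmetric, a smooth potential $\Psi$, the symmetric tensor $A_{abc}=\partial_a\partial_b\partial_c\Psi$ in flat coordinates, and a multiplication $\circ$ of tangent vectors with $A(X,Y,Z)=g(X\circ Y,Z)=g(X,Y\circ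 Z)$. It is a *Frobenius* structure if $\circ$ is associative. A *Frobenius locus* of $D$ is a non-empty subset $F\subseteq D$ that is open in an affine subspace, such that the structure of $D$ (in particular $\circ$) restricts to a Frobenius structure on $F$, and such that $F$ is totally geodesic for the Levi-Civita connection of $g$. Then there are a potential pre-Frobenius structure $(g,A,\Psi,\circ)$ on $\mathscr P$ and an involutive continuous automorphism $\sigma$ of $G$ such that: 1. $(\mathscr P,g)$ is a non-compact Riemannian symmetric space. That is, $\mathscr P$ is not compact, it is connected, $g$ is a Riemannian metric, and every point of $\mathscr P$ is an isolated fixed point of an involutive isometry. Moreover $\mathscr P=G/K$ for a symmetric pair $(G,K)$: $G$ is a connected closed subgroup of $GL(V)$, it acts transitively on $\mathscr P$ by isometries of $g$, the stabilizer $K=G_e$ is compact, and $(K_\sigma)_0\subseteq K\subseteq K_\sigma$, where $K_\sigma$ is the fixed point group of $\sigma$ and $(K_\sigma)_0$ its identity component. 2. The metric of the pre-Frobenius structure is the Hessian of its potential, $g_{ab}=\partial_a\partial_b\Psi$ on $\mathscr P$. 3. Let $\mathfrak g\subseteq\mathrm{End}(V)$ be the Lie algebra of $G$ and $\mathfrak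 t=\{X\in\mathfrak g:(d\sigma)_eX=-X\}$. There is a linear subspace $\mathfrak a\subseteq\mathfrak t$ that is a Lie triple system, $[[\mathfrak a,\mathfrak a],\mathfrak a]\subseteq\mathfrak a$, and that is in fact a maximal abelian subspace of $\mathfrak t$, such that $\mathscr F=\exp\mathfrak a:=\{\exp(X)\cdot e: X\in\mathfrak a\}$ is a (non-empty) Frobenius locus in $\mathscr P$. -/

import Mathlib

open scoped ContDiff Topology Quaternion

/-! ### The scalars `ℝ`, `ℂ`, `ℍ`, `𝕆` -/

/-- A real `*`-algebra (not necessarily associative) with a real part, such that `Re (a b)` is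
symmetric and `Re (ā a)` is positive definite. Used only for `ℝ`, `ℂ`, `ℍ`, `𝕆`, with the
instances below. -/
class HermitianScalars (K : Type) [NonAssocRing K] [StarRing K] [Module ℝ K] : Type
    extends StarModule ℝ K, IsScalarTower ℝ K K where
  re : K →ₗ[ℝ] ℝ
  eq_re_smul_one : ∀ a, star a = a → a = re a • 1
  re_star : ∀ a, re (star a) = re a
  re_mul_comm : ∀ a b, re (a * b) = re (b * a)
  re_star_mul_self_nonneg : ∀ a, 0 ≤ re (star a * a)
  eq_zero_of_re_star_mul_self : ∀ a, re (star a * a) = 0 → a = 0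

noncomputable instance : HermitianScalars ℝ where
  re := LinearMap.id
  eq_re_smul_one a _ := by simp
  re_star a := by simp
  re_mul_comm a b := by simp [mul_comm]
  re_star_mul_self_nonneg a := by simpa using mul_self_nonneg a
  eq_zero_of_re_star_mul_self a h := by simpa using h

noncomputable instance : HermitianScalars ℂ where
  re := Complex.reLm
  eq_re_smul_one a h := by
    have h' := congrArg Complex.im h
    simp only [Complex.star_def, Complex.conj_im] at h'
    apply Complex.ext <;> simp
    linarith
  re_star a := by simp
  re_mul_comm a b := by simp [mul_comm]
  re_star_mul_self_nonneg a := by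
    simp only [Complex.star_def, Complex.reLm_coe, Complex.mul_re, Complex.conj_re,
      Complex.conj_im]
    nlinarith [mul_self_nonneg a.re, mul_self_nonneg a.im]
  eq_zero_of_re_star_mul_self a h := by
    simp only [Complex.star_def, Complex.reLm_coe, Complex.mul_re, Complex.conj_re,
      Complex.conj_im] at h
    apply Complex.ext <;> simp <;> nlinarith [mul_self_nonneg a.re, mul_self_nonneg a.im]

/-- The real part of a quaternion. -/
def quaternionRe : ℍ[ℝ] →ₗ[ℝ] ℝ where
  toFun a := a.re
  map_add' _ _ := rfl
  map_smul' _ _ := rfl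

theorem quaternionRe_apply (a : ℍ[ℝ]) : quaternionRe a = a.re := rfl

theorem quaternionRe_star_mul_self (a : ℍ[ℝ]) :
    quaternionRe (star a * a) = a.re ^ 2 + a.imI ^ 2 + a.imJ ^ 2 + a.imK ^ 2 := by
  simp [quaternionRe_apply]; ring

theorem quaternionRe_mul_comm (a b : ℍ[ℝ]) : quaternionRe (a * b) = quaternionRe (b * a) := by
  simp [quaternionRe_apply]; ring

theorem quaternion_eq_re_smul_one (a : ℍ[ℝ]) (h : star a = a) : a = quaternionRe a • 1 := by
  have h1 := congrArg QuaternionAlgebra.imI h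
  have h2 := congrArg QuaternionAlgebra.imJ h
  have h3 := congrArg QuaternionAlgebra.imK h
  simp only [Quaternion.imI_star, Quaternion.imJ_star, Quaternion.imK_star] at h1 h2 h3
  ext <;> simp [quaternionRe_apply] <;> linarith

theorem quaternion_eq_zero_of_re (a : ℍ[ℝ]) (h : quaternionRe (star a * a) = 0) : a = 0 := by
  rw [quaternionRe_star_mul_self] at h
  have h1 := sq_nonneg a.re
  have h2 := sq_nonneg a.imI
  have h3 := sq_nonneg a.imJ
  have h4 := sq_nonneg a.imK
  ext
  · exact pow_eq_zero_iff (two_ne_zero) |>.1 (by linarith)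
  · exact pow_eq_zero_iff (two_ne_zero) |>.1 (by linarith)
  · exact pow_eq_zero_iff (two_ne_zero) |>.1 (by linarith)
  · exact pow_eq_zero_iff (two_ne_zero) |>.1 (by linarith)

noncomputable instance : HermitianScalars ℍ[ℝ] where
  re := quaternionRe
  eq_re_smul_one := quaternion_eq_re_smul_one
  star_smul r a := by simp
  re_star a := by simp [quaternionRe_apply]
  re_mul_comm := quaternionRe_mul_comm
  re_star_mul_self_nonneg a := by rw [quaternionRe_star_mul_self]; positivity
  eq_zero_of_re_star_mul_self := quaternion_eq_zero_of_re

/-- The octonions `𝕆`, as the Cayley–Dickson double of `ℍ`: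
`(a, b)(c, d) = (a c - d̄ b, d a + b c̄)` and `(a, b)* = (ā, -b)`. -/
@[ext] structure Octonion : Type where
  fst : ℍ[ℝ]
  snd : ℍ[ℝ]

namespace Octonion

noncomputable section

instance : Zero Octonion := ⟨⟨0, 0⟩⟩
instance : One Octonion := ⟨⟨1, 0⟩⟩
instance : Add Octonion := ⟨fun x y => ⟨x.fst + y.fst, x.snd + y.snd⟩⟩
instance : Neg Octonion := ⟨fun x => ⟨-x.fst, -x.snd⟩⟩
instance : Sub Octonion := ⟨fun x y => ⟨x.fst - y.fst, x.snd - y.snd⟩⟩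
instance : SMul ℕ Octonion := ⟨fun r x => ⟨r • x.fst, r • x.snd⟩⟩
instance : SMul ℤ Octonion := ⟨fun r x => ⟨r • x.fst, r • x.snd⟩⟩
instance : SMul ℝ Octonion := ⟨fun r x => ⟨r • x.fst, r • x.snd⟩⟩
instance : Mul Octonion := ⟨fun x y =>
  ⟨x.fst * y.fst - star y.snd * x.snd, y.snd * x.fst + x.snd * star y.fst⟩⟩
instance : Star Octonion := ⟨fun x => ⟨star x.fst, -x.snd⟩⟩

@[simp] theorem fst_zero : (0 : Octonion).fst = 0 := rfl
@[simp] theorem snd_zero : (0 : Octonion).snd = 0 := rfl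
@[simp] theorem fst_one : (1 : Octonion).fst = 1 := rfl
@[simp] theorem snd_one : (1 : Octonion).snd = 0 := rfl
@[simp] theorem fst_add (x y : Octonion) : (x + y).fst = x.fst + y.fst := rfl
@[simp] theorem snd_add (x y : Octonion) : (x + y).snd = x.snd + y.snd := rfl
@[simp] theorem fst_neg (x : Octonion) : (-x).fst = -x.fst := rfl
@[simp] theorem snd_neg (x : Octonion) : (-x).snd = -x.snd := rfl
@[simp] theorem fst_smul (r : ℝ) (x : Octonion) : (r • x).fst = r • x.fst := rfl
@[simp] theorem snd_smul (r : ℝ) (x : Octonion) : (r • x).snd = r • x.snd := rfl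
@[simp] theorem fst_mul (x y : Octonion) :
    (x * y).fst = x.fst * y.fst - star y.snd * x.snd := rfl
@[simp] theorem snd_mul (x y : Octonion) :
    (x * y).snd = y.snd * x.fst + x.snd * star y.fst := rfl
@[simp] theorem fst_star (x : Octonion) : (star x).fst = star x.fst := rfl
@[simp] theorem snd_star (x : Octonion) : (star x).snd = -x.snd := rfl

/-- The underlying pair of quaternions. -/
def toProd (x : Octonion) : ℍ[ℝ] × ℍ[ℝ] := (x.fst, x.snd)

theorem toProd_injective : Function.Injective toProd := by
  intro x y h
  have h' := Prod.ext_iff.1 h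
  exact Octonion.ext h'.1 h'.2

instance : AddCommGroup Octonion :=
  toProd_injective.addCommGroup toProd rfl (fun _ _ => rfl) (fun _ => rfl) (fun _ _ => rfl)
    (fun _ _ => rfl) (fun _ _ => rfl)

instance : Module ℝ Octonion :=
  toProd_injective.module ℝ ⟨⟨toProd, rfl⟩, fun _ _ => rfl⟩ (fun _ _ => rfl)

instance : NonAssocRing Octonion where
  left_distrib x y z := by ext1 <;> simp [mul_add, add_mul] <;> abel
  right_distrib x y z := by ext1 <;> simp [mul_add, add_mul] <;> abel
  zero_mul x := by ext1 <;> simp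
  mul_zero x := by ext1 <;> simp
  one_mul x := by ext1 <;> simp
  mul_one x := by ext1 <;> simp

instance : StarRing Octonion where
  star_involutive x := by ext1 <;> simp
  star_mul x y := by ext1 <;> simp
  star_add x y := by ext1 <;> simp [add_comm]

/-- The real part of an octonion. -/
def reLm : Octonion →ₗ[ℝ] ℝ where
  toFun x := x.fst.re
  map_add' _ _ := rfl
  map_smul' _ _ := rfl

theorem reLm_apply (x : Octonion) : reLm x = x.fst.re := rfl

theorem reLm_star_mul_self (x : Octonion) : reLm (star x * x) =
    quaternionRe (star x.fst * x.fst) + quaternionRe (star x.snd * x.snd) := by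
  simp [reLm_apply, quaternionRe_apply]

theorem quaternionRe_star_mul_self_nonneg (a : ℍ[ℝ]) : 0 ≤ quaternionRe (star a * a) := by
  rw [quaternionRe_star_mul_self]; positivity

instance : HermitianScalars Octonion where
  star_smul r x := by ext1 <;> simp
  smul_assoc r x y := by ext1 <;> simp [smul_sub, smul_add]
  re := reLm
  eq_re_smul_one x h := by
    have h1 := quaternion_eq_re_smul_one x.fst (congrArg Octonion.fst h)
    have h2 : -x.snd = x.snd := congrArg Octonion.snd h
    ext1
    · exact h1
    · have h3 : (2 : ℝ) • x.snd = 0 := by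
        rw [two_smul]; nth_rewrite 1 [← h2]; exact neg_add_cancel _
      simpa using h3
  re_star x := by simp [reLm_apply]
  re_mul_comm x y := by simp [reLm_apply]; ring
  re_star_mul_self_nonneg x := by
    rw [reLm_star_mul_self]
    exact add_nonneg (quaternionRe_star_mul_self_nonneg _) (quaternionRe_star_mul_self_nonneg _)
  eq_zero_of_re_star_mul_self x h := by
    rw [reLm_star_mul_self] at h
    have h1 := quaternionRe_star_mul_self_nonneg x.fst
    have h2 := quaternionRe_star_mul_self_nonneg x.snd
    exact Octonion.ext (quaternion_eq_zero_of_re _ (by linarith))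
      (quaternion_eq_zero_of_re _ (by linarith))

end

end Octonion

/-- The admissible pairs `(K, n)`: `n ≥ 1` for `ℝ`, `ℂ`, `ℍ`, and `n = 3` for `𝕆`. -/
inductive IsConeCase : (K : Type) → [NonAssocRing K] → [StarRing K] → [Module ℝ K] →
    [HermitianScalars K] → ℕ → Prop
  | real (n : ℕ) (hn : 1 ≤ n) : IsConeCase ℝ n
  | complex (n : ℕ) (hn : 1 ≤ n) : IsConeCase ℂ n
  | quaternion (n : ℕ) (hn : 1 ≤ n) : IsConeCase ℍ[ℝ] n
  | octonion : IsConeCase Octonion 3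

/-! ### Self-adjoint matrices and the cone of positive definite ones -/

section HermMat

variable (K : Type) [NonAssocRing K] [StarRing K] [Module ℝ K] [HermitianScalars K] (n : ℕ)

/-- The real vector space of self-adjoint `n × n` matrices over `K`. -/
def HermMat : Type := selfAdjoint.submodule ℝ (Matrix (Fin n) (Fin n) K)

namespace HermMat

noncomputable section

variable {K n}

/-- The underlying matrix. -/
def val (x : HermMat K n) : Matrix (Fin n) (Fin n) K := Subtype.val x

theorem val_injective : Function.Injective (val (K := K) (n := n)) := Subtype.val_injective

theorem star_val (x : HermMat K n) : star x.val = x.val := Subtype.prop x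

/-- The additive group of self-adjoint matrices. -/
@[reducible] def addCommGroup : AddCommGroup (HermMat K n) :=
  inferInstanceAs (AddCommGroup (selfAdjoint.submodule ℝ (Matrix (Fin n) (Fin n) K)))

/-- The real vector space of self-adjoint matrices. -/
@[reducible] def module : @Module ℝ (HermMat K n) _ addCommGroup.toAddCommMonoid :=
  inferInstanceAs (Module ℝ (selfAdjoint.submodule ℝ (Matrix (Fin n) (Fin n) K)))

/-- The identity matrix. -/
instance : One (HermMat K n) := ⟨⟨1, star_one _⟩⟩

/-- The square `x²`; it is the matrix square and also the Jordan square. -/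
def sq (x : HermMat K n) : HermMat K n := ⟨x.val * x.val, by
  change star (x.val * x.val) = x.val * x.val
  rw [star_mul, star_val]⟩

/-- `Re Tr`. -/
def reTr : Matrix (Fin n) (Fin n) K →ₗ[ℝ] ℝ :=
  HermitianScalars.re ∘ₗ Matrix.traceLinearMap (Fin n) ℝ K

theorem reTr_mul (x y : Matrix (Fin n) (Fin n) K) :
    reTr (x * y) = ∑ i, ∑ j, HermitianScalars.re (x i j * y j i) := by
  simp [reTr, Matrix.trace, Matrix.mul_apply]

theorem reTr_mul_comm (x y : Matrix (Fin n) (Fin n) K) : reTr (x * y) = reTr (y * x) := by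
  rw [reTr_mul, reTr_mul, Finset.sum_comm]
  simp only [HermitianScalars.re_mul_comm (x _ _)]

theorem reTr_star_mul_self (x : Matrix (Fin n) (Fin n) K) :
    reTr (star x * x) = ∑ i, ∑ j, HermitianScalars.re (star (x j i) * x j i) := by
  rw [reTr_mul]; rfl

theorem reTr_star_mul_self_nonneg (x : Matrix (Fin n) (Fin n) K) : 0 ≤ reTr (star x * x) := by
  rw [reTr_star_mul_self]
  exact Finset.sum_nonneg fun i _ => Finset.sum_nonneg fun j _ =>
    HermitianScalars.re_star_mul_self_nonneg _

theorem eq_zero_of_reTr_star_mul_self (x : Matrix (Fin n) (Fin n) K)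
    (h : reTr (star x * x) = 0) : x = 0 := by
  rw [reTr_star_mul_self] at h
  ext j i
  have h1 := (Finset.sum_eq_zero_iff_of_nonneg fun i _ => Finset.sum_nonneg fun j _ =>
    HermitianScalars.re_star_mul_self_nonneg (x j i)).1 h i (Finset.mem_univ _)
  have h2 := (Finset.sum_eq_zero_iff_of_nonneg fun j _ =>
    HermitianScalars.re_star_mul_self_nonneg (x j i)).1 h1 j (Finset.mem_univ _)
  exact HermitianScalars.eq_zero_of_re_star_mul_self _ h2

/-- The inner product `⟨X, Y⟩ = Re Tr (X Y)`. -/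
@[reducible] def innerCore : @InnerProductSpace.Core ℝ (HermMat K n) _ addCommGroup module :=
  letI : AddCommGroup (HermMat K n) := addCommGroup
  letI : Module ℝ (HermMat K n) := module
  { inner := fun x y => reTr (x.val * y.val)
    conj_inner_symm := fun x y => by
      change reTr (y.val * x.val) = reTr (x.val * y.val)
      exact reTr_mul_comm _ _
    re_inner_nonneg := fun x => by
      change 0 ≤ reTr (x.val * x.val)
      have h := reTr_star_mul_self_nonneg x.val
      rwa [star_val] at h
    add_left := fun x y z => by
      change reTr ((x.val + y.val) * z.val) = reTr (x.val * z.val) + reTr (y.val * z.val)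
      rw [add_mul, map_add]
    smul_left := fun x y r => by
      change reTr ((r • x.val) * y.val) = r * reTr (x.val * y.val)
      rw [smul_mul_assoc, map_smul, smul_eq_mul]
    definite := fun x h => by
      apply val_injective
      apply eq_zero_of_reTr_star_mul_self
      rw [star_val]; exact h }

instance : NormedAddCommGroup (HermMat K n) :=
  @InnerProductSpace.Core.toNormedAddCommGroup ℝ (HermMat K n) _ addCommGroup module innerCore

instance : InnerProductSpace ℝ (HermMat K n) :=
  @InnerProductSpace.ofCore ℝ (HermMat K n) _ addCommGroup module
    (@InnerProductSpace.Core.toCore ℝ (HermMat K n) _ addCommGroup module innerCore)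

theorem val_add (x y : HermMat K n) : (x + y).val = x.val + y.val := rfl

theorem val_smul (r : ℝ) (x : HermMat K n) : (r • x).val = r • x.val := rfl

theorem val_one : (1 : HermMat K n).val = 1 := rfl

theorem inner_eq (x y : HermMat K n) : inner ℝ x y = reTr (x.val * y.val) := rfl

end

end HermMat

/-- The cone `𝒫_n(K)` of positive definite self-adjoint matrices: the positive elements of the
Jordan algebra of self-adjoint matrices, i.e. those `x` whose Jordan multiplication operator
`y ↦ (x y + y x) / 2` is positive definite for `⟨X, Y⟩ = Re Tr (X Y)`; indeed
`⟨(x y + y x) / 2, y⟩ = ⟨x, y²⟩`. For associative `K` this is the usual positive definiteness,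
`x̄ᵀ A x > 0` for every column `x ≠ 0`, see `mem_posDefCone_iff`. -/
def posDefCone : Set (HermMat K n) := {x | ∀ y : HermMat K n, y ≠ 0 → 0 < inner ℝ x y.sq}

variable {K n} in
/-- For associative scalars, `posDefCone` consists of the positive definite matrices in the usual
sense. -/
theorem mem_posDefCone_iff (hassoc : ∀ a b c : K, a * b * c = a * (b * c)) (x : HermMat K n) :
    x ∈ posDefCone K n ↔
      ∀ v : Fin n → K, v ≠ 0 → 0 < HermitianScalars.re (star v ⬝ᵥ (x.val.mulVec v)) := by
  have key : ∀ y : HermMat K n, inner ℝ x y.sq = ∑ i, HermitianScalars.re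
      (star (fun k => y.val k i) ⬝ᵥ (x.val.mulVec fun k => y.val k i)) := by
    intro y
    have hy : ∀ i j, star (y.val i j) = y.val j i := fun i j => congrFun (congrFun y.star_val j) i
    have h1 : x.val * (y.val * y.val) = (x.val * y.val) * y.val := by
      ext i j
      simp only [Matrix.mul_apply, Finset.mul_sum, Finset.sum_mul]
      rw [Finset.sum_comm]
      simp only [hassoc]
    rw [HermMat.inner_eq]
    change HermMat.reTr (x.val * (y.val * y.val)) = _
    rw [h1, HermMat.reTr_mul_comm, HermMat.reTr_mul]
    simp only [dotProduct, Matrix.mulVec, Matrix.mul_apply, Pi.star_apply, hy, map_sum]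
  constructor
  · intro h v hv
    set y : HermMat K n := ⟨fun i j => v i * star (v j), by
      change star _ = _
      ext i j
      change star (v j * star (v i)) = _
      simp⟩ with hydef
    have hyv : ∀ i j, y.val i j = v i * star (v j) := fun _ _ => rfl
    obtain ⟨k, hk⟩ : ∃ k, v k ≠ 0 := by
      by_contra hcon
      push Not at hcon
      exact hv (funext hcon)
    have hre1 : ∀ a : K, HermitianScalars.re (star a * a) • (1 : K) = star a * a := fun a =>
      (HermitianScalars.eq_re_smul_one _ (by simp)).symm
    have hpos : ∀ a : K, a ≠ 0 → 0 < HermitianScalars.re (star a * a) := fun a ha =>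
      lt_of_le_of_ne (HermitianScalars.re_star_mul_self_nonneg a)
        fun h0 => ha (HermitianScalars.eq_zero_of_re_star_mul_self a h0.symm)
    have hy0 : y ≠ 0 := by
      intro h0
      have h1 : v k * star (v k) = 0 := by rw [← hyv, h0]; rfl
      have h2 := hpos (v k) hk
      rw [HermitianScalars.re_mul_comm, h1, map_zero] at h2
      exact lt_irrefl _ h2
    have h1 := h y hy0
    rw [key] at h1
    have h2 : ∀ i, HermitianScalars.re
        (star (fun k => y.val k i) ⬝ᵥ (x.val.mulVec fun k => y.val k i)) =
        HermitianScalars.re (star (v i) * v i) *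
          HermitianScalars.re (star v ⬝ᵥ (x.val.mulVec v)) := by
      intro i
      have h3 : star (fun k => y.val k i) ⬝ᵥ (x.val.mulVec fun k => y.val k i) =
          v i * ((star v ⬝ᵥ (x.val.mulVec v)) * star (v i)) := by
        simp only [dotProduct, Matrix.mulVec, Pi.star_apply, hyv, star_mul, star_star,
          Finset.mul_sum, Finset.sum_mul, hassoc]
      rw [h3, HermitianScalars.re_mul_comm, hassoc, HermitianScalars.re_mul_comm, ← hre1 (v i),
        smul_mul_assoc, one_mul, map_smul, smul_eq_mul, hre1 (v i)]
    simp only [h2] at h1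
    rw [← Finset.sum_mul] at h1
    exact pos_of_mul_pos_right h1 (Finset.sum_nonneg fun i _ =>
      HermitianScalars.re_star_mul_self_nonneg _)
  · intro h y hy
    rw [key]
    have h0 : ∀ i, 0 ≤ HermitianScalars.re
        (star (fun k => y.val k i) ⬝ᵥ (x.val.mulVec fun k => y.val k i)) := by
      intro i
      by_cases hi : (fun k => y.val k i) = 0
      · rw [hi]; simp
      · exact (h _ hi).le
    refine lt_of_le_of_ne (Finset.sum_nonneg fun i _ => h0 i) fun hs => hy ?_
    have hs' := (Finset.sum_eq_zero_iff_of_nonneg fun i _ => h0 i).1 hs.symm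
    apply HermMat.val_injective
    ext k i
    by_contra hne
    have hi : (fun k => y.val k i) ≠ 0 := fun h' => hne (congrFun h' k)
    exact (h _ hi).ne' (hs' i (Finset.mem_univ _))

end HermMat

/-! ### Potential pre-Frobenius structures

On an open subset `D` of a real vector space `V` the flat torsion-free connection `∇⁰` is the
directional derivative inherited from `V`; the flat vector fields are the constant ones. -/

section PreFrobenius

variable {V : Type*} [NormedAddCommGroup V] [NormedSpace ℝ V]

variable (V) in
/-- The data of a metric `g`, a rank three tensor `A`, a potential `Ψ` and a multiplication `∘` of
tangent vectors. -/
structure PreFrobeniusData where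
  g : V → V →L[ℝ] V →L[ℝ] ℝ
  A : V → V →L[ℝ] V →L[ℝ] V →L[ℝ] ℝ
  pot : V → ℝ
  mul : V → V →L[ℝ] V →L[ℝ] V

/-- `(D, ∇⁰, g, A, Ψ, ∘)` is a potential pre-Frobenius domain. -/
structure IsPotentialPreFrobenius (D : Set V) (S : PreFrobeniusData V) : Prop where
  isOpen : IsOpen D
  smooth_g : ContDiffOn ℝ ∞ S.g D
  g_symm : ∀ x ∈ D, ∀ u v, S.g x u v = S.g x v u
  g_nondegenerate : ∀ x ∈ D, ∀ u, (∀ v, S.g x u v = 0) → u = 0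
  /-- `∇⁰ g` is symmetric. -/
  nabla_g_symm : ∀ x ∈ D, ∀ u v w, fderiv ℝ S.g x u v w = fderiv ℝ S.g x v u w
  smooth_pot : ContDiffOn ℝ ∞ S.pot D
  A_symm : ∀ x ∈ D, ∀ u v w, S.A x u v w = S.A x v u w ∧ S.A x u v w = S.A x u w v
  /-- `A_{abc} = ∂_a ∂_b ∂_c Ψ`. -/
  A_eq : ∀ x ∈ D, ∀ u v w, S.A x u v w = iteratedFDeriv ℝ 3 S.pot x ![u, v, w]
  /-- `∂_a ∘ ∂_b = ∑ A_{abe} g^{ec} ∂_c`, i.e. `A(X, Y, Z) = g(X ∘ Y, Z)`. -/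
  g_mul_left : ∀ x ∈ D, ∀ u v w, S.g x (S.mul x u v) w = S.A x u v w
  /-- `A(X, Y, Z) = g(X, Y ∘ Z)`. -/
  g_mul_right : ∀ x ∈ D, ∀ u v w, S.g x u (S.mul x v w) = S.A x u v w

/-- A Frobenius domain: a potential pre-Frobenius domain with associative multiplication. -/
structure IsFrobenius (D : Set V) (S : PreFrobeniusData V) : Prop
    extends IsPotentialPreFrobenius D S where
  mul_assoc : ∀ x ∈ D, ∀ u v w, S.mul x (S.mul x u v) w = S.mul x u (S.mul x v w)

/-- `F` is a Frobenius locus of `(D, S)`: `F ⊆ D` is a non-empty flat submanifold (open in an affine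
subspace `p + W`), all the structure of `D` restricts to it (in particular its tangent spaces are
closed under `∘`), the restriction is a Frobenius structure, and `F` is totally geodesic for the
Levi-Civita connection of `g`. -/
def IsFrobeniusLocus (D : Set V) (S : PreFrobeniusData V) (F : Set V) : Prop :=
  F.Nonempty ∧ F ⊆ D ∧ ∃ (p : V) (W : Submodule ℝ V) (U : Set W) (S' : PreFrobeniusData W),
    F = (fun w : W => p + (w : V)) '' U ∧
    IsFrobenius U S' ∧
    (∀ w ∈ U, S'.pot w = S.pot (p + w) ∧
      (∀ u v, S'.g w u v = S.g (p + w) u v) ∧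
      (∀ u v z, S'.A w u v z = S.A (p + w) u v z) ∧
      (∀ u v, (S'.mul w u v : V) = S.mul (p + w) u v)) ∧
    -- the Levi-Civita derivative `c` of constant tangent fields of `F`, given by the Koszul
    -- formula, is tangent to `F`
    (∀ w ∈ U, ∀ u v : W, ∀ c : V,
      (∀ z : V, 2 * S.g (p + w) c z = fderiv ℝ S.g (p + w) u v z + fderiv ℝ S.g (p + w) v u z
        - fderiv ℝ S.g (p + w) z u v) → c ∈ W)

end PreFrobenius

/-! ### Symmetric spaces -/

section SymmetricSpace

variable {V : Type*} [NormedAddCommGroup V] [NormedSpace ℝ V]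

/-- `s` is a (smooth) isometry of the Riemannian manifold `(D, g)` onto itself. -/
structure IsIsometryOn (D : Set V) (g : V → V →L[ℝ] V →L[ℝ] ℝ) (s : V → V) : Prop where
  bijOn : Set.BijOn s D D
  smooth : ContDiffOn ℝ ∞ s D
  isometry : ∀ x ∈ D, ∀ u v, g (s x) (fderiv ℝ s x u) (fderiv ℝ s x v) = g x u v

/-- `(D, g)`, `D` open in `V`, is a Riemannian (globally) symmetric space: a connected Riemannian
manifold each of whose points is an isolated fixed point of an involutive isometry. -/
structure IsRiemannianSymmetricSpace (D : Set V) (g : V → V →L[ℝ] V →L[ℝ] ℝ) : Prop where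
  isOpen : IsOpen D
  isConnected : IsConnected D
  smooth : ContDiffOn ℝ ∞ g D
  symm : ∀ x ∈ D, ∀ u v, g x u v = g x v u
  pos : ∀ x ∈ D, ∀ u, u ≠ 0 → 0 < g x u u
  exists_symmetry : ∀ p ∈ D, ∃ s : V → V, IsIsometryOn D g s ∧ (∀ x ∈ D, s (s x) = x) ∧
    s p = p ∧ ∃ U ∈ 𝓝 p, ∀ x ∈ U ∩ D, s x = x → x = p

/-- The automorphism group `G(P) = {g ∈ GL(V) | g P = P}`. -/
noncomputable def coneAut (P : Set V) : Subgroup (V →L[ℝ] V)ˣ where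
  carrier := {a | (fun x => (a : V →L[ℝ] V) x) '' P = P}
  one_mem' := by simp
  mul_mem' {a b} ha hb := by
    simp only [Set.mem_ofPred_eq] at ha hb ⊢
    conv_rhs => rw [← ha, ← hb, Set.image_image]
    rfl
  inv_mem' {a} ha := by
    simp only [Set.mem_ofPred_eq] at ha ⊢
    conv_lhs => rw [← ha, Set.image_image]
    have h : ∀ x : V, ((a⁻¹ : (V →L[ℝ] V)ˣ) : V →L[ℝ] V) ((a : V →L[ℝ] V) x) = x := fun x => by
      rw [← mul_apply_eq_comp, Units.inv_mul, one_apply_eq_self]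
    simp only [h, Set.image_id']

/-- The identity component of `G(P)`. -/
noncomputable def coneAutZero (P : Set V) : Subgroup (V →L[ℝ] V)ˣ :=
  (Subgroup.connectedComponentOfOne (coneAut P)).map (coneAut P).subtype

/-- `(D, g)` is the quotient `G / K` of a symmetric pair: `G` is a connected (closed, linear) Lie
group acting transitively on `D` by isometries of `g`, the stabilizer `K` of the base point `e` is
compact, and `σ` is an involutive automorphism of `G` with `(K_σ)₀ ⊆ K ⊆ K_σ`. -/
structure IsSymmetricPair (G : Subgroup (V →L[ℝ] V)ˣ) (σ : G ≃* G) (D : Set V)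
    (g : V → V →L[ℝ] V →L[ℝ] ℝ) (e : V) : Prop where
  isClosed : IsClosed (G : Set (V →L[ℝ] V)ˣ)
  isConnected : IsConnected (G : Set (V →L[ℝ] V)ˣ)
  base_mem : e ∈ D
  isometry : ∀ a ∈ G, IsIsometryOn D g (a : V →L[ℝ] V)
  transitive : ∀ x ∈ D, ∃ a ∈ G, (a : V →L[ℝ] V) e = x
  isCompact_stabilizer : IsCompact {a : (V →L[ℝ] V)ˣ | a ∈ G ∧ (a : V →L[ℝ] V) e = e}
  continuous_inv : Continuous σ
  involutive : Function.Involutive σ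
  stabilizer_le : ∀ a : G, ((a : (V →L[ℝ] V)ˣ) : V →L[ℝ] V) e = e → σ a = a
  le_stabilizer : connectedComponentIn {a : G | σ a = a} 1 ⊆
    {a : G | ((a : (V →L[ℝ] V)ˣ) : V →L[ℝ] V) e = e}

/-- The space `𝔱 = {X ∈ 𝔤 | (dσ)_e X = -X}` of the decomposition `𝔤 = 𝔨 ⊕ 𝔱` of the Lie algebra of
`G`: the `X ∈ End V` with `exp (t X) ∈ G` and `σ (exp (t X)) = exp (-t X)` for all real `t`. -/
def tangentPart (G : Subgroup (V →L[ℝ] V)ˣ) (σ : G ≃* G) : Set (V →L[ℝ] V) :=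
  {X | ∀ t : ℝ, ∃ a : G, ((a : (V →L[ℝ] V)ˣ) : V →L[ℝ] V) = NormedSpace.exp (t • X) ∧
    ((σ a : (V →L[ℝ] V)ˣ) : V →L[ℝ] V) = NormedSpace.exp (-(t • X))}

end SymmetricSpace

/-! ### Euclidean Jordan algebras -/

/-! The self-adjoint matrices form a Euclidean Jordan algebra with unit `e`. Nearly all of the
argument takes place in such an algebra; the matrices enter only through the Jordan identity, the
trace form and the diagonal idempotents.

The spectral theorem `exists_isFrame` writes each element as a real combination of orthogonal
idempotents with sum `e`. It makes the cone self-dual and shows that every element of the cone is of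
the form `exp (L y) e`. The operators `exp (L y)` preserve the cone: if `c` and `z²` are orthogonal
nonnegative elements, then `c z² = 0` (`mul_eq_zero_of_inner_eq_zero`), so the flow of `L y` does
not cross the boundary. Hence the identity component `G` is transitive.

The potential is `Ψ(a e) = -log |det a|`, well defined because the stabilizer of `e` is bounded.
Cone automorphisms change `Ψ` by a constant, so its derivatives are invariant. If the trace form `tr
L y` equals `κ ⟨e, y⟩`, then `Ψ(exp (L y) e) = -κ ⟨e, y⟩`. It follows that the gradient of `Ψ` is
`-κ x⁻¹` and that its Hessian at `e` is `κ ⟨·, ·⟩`. So the Hessian metric is Riemannian and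
invariant, and `x ↦ x⁻¹` is an isometry whose only fixed point in the cone is `e`. By self-duality
`σ a = (a†)⁻¹` acts on `G`, and its fixed points are exactly the stabilizer of `e`.

The space `𝔱` consists of the operators `L y` (`eq_L_of_mem_tangentPart`). Those with `y` in the
span of a frame commute. On that span the cone is the positive orthant, and the product is `(a ∘
b)_i = -2 a_i b_i / r_i` at the point with coordinates `r_i`, which is associative
(`IsFrame.mul_pot`). For a Hessian metric the Levi-Civita derivative of constant fields is half
their product, so closure under `∘` already makes the locus totally geodesic.

For matrices the frame is the diagonal one. Signs and permutations force the trace form to be a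
multiple of `⟨e, ·⟩`, and a Peirce computation gives maximality. For `𝕆` the Jordan identity comes
from alternativity and a Moufang identity. -/

/-- A real Jordan algebra with unit whose multiplication operators are symmetric for the inner
product. -/
structure EuclideanJordan (V : Type*) [NormedAddCommGroup V] [InnerProductSpace ℝ V] where
  L : V →L[ℝ] V →L[ℝ] V
  one : V
  comm : ∀ x y, L x y = L y x
  one_mul : ∀ x, L one x = x
  inner_mul : ∀ x y z, inner ℝ (L x y) z = inner ℝ y (L x z)
  jordan : ∀ x y, L x (L (L x x) y) = L (L x x) (L x y)

namespace EuclideanJordan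

/-! ### Power associativity, the spectral theorem and the Peirce equation -/

section Spectral

variable {V : Type*} [NormedAddCommGroup V] [InnerProductSpace ℝ V] (J : EuclideanJordan V)

theorem mul_one (x : V) : J.L x J.one = x := by rw [J.comm, J.one_mul]

theorem L_one : J.L J.one = 1 := by ext x; simp [J.one_mul]

/-- The linearised Jordan identity. -/
theorem jordan_linear (a b c y : V) :
    J.L a (J.L (J.L b c) y) - J.L (J.L b c) (J.L a y) +
      (J.L b (J.L (J.L c a) y) - J.L (J.L c a) (J.L b y)) +
      (J.L c (J.L (J.L a b) y) - J.L (J.L a b) (J.L c y)) = 0 := by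
  have h1 := J.jordan (a + b + c) y
  have h2 := J.jordan (a + b) y
  have h3 := J.jordan (b + c) y
  have h4 := J.jordan (a + c) y
  have h5 := J.jordan a y
  have h6 := J.jordan b y
  have h7 := J.jordan c y
  simp only [map_add, add_apply, J.comm b a, J.comm c a, J.comm c b] at *
  -- Inclusion-exclusion extracts the part of the cubic identity that is linear in each of `a`, `b`,
  -- `c`; the factor `1/2` undoes the doubling of the cross terms of a square.
  linear_combination (norm := module) (1 / 2 : ℝ) • (h1 - h2 - h3 - h4 + h5 + h6 + h7)

/-- This is the linearised identity for `x, y, z` applied to `w`, read as an identity between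
operators in `z`. It reduces `L` of a triple product to `L` of products of two factors. -/
theorem L_mul_mul (x y w : V) : J.L (J.L (J.L x y) w) =
    J.L (J.L x w) * J.L y + J.L (J.L y w) * J.L x + J.L (J.L x y) * J.L w
      - J.L x * J.L w * J.L y - J.L y * J.L w * J.L x := by
  ext z
  have h := J.jordan_linear x y z w
  simp only [add_apply, sub_apply,
    mul_apply_eq_comp]
  rw [J.comm z x, J.comm (J.L y z) w, J.comm (J.L y z) (J.L x w), J.comm (J.L x z) w,
    J.comm (J.L x z) (J.L y w), J.comm z (J.L (J.L x y) w), J.comm z w] at h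
  linear_combination (norm := module) h

/-- Since `x^(k+2) = (x x^k) x`, the operator `L` of it is a polynomial in those of `x`, `x²`, `x^k`
and `x^(k+1)`. A two-step induction therefore works, provided commutation with `L x` and with `L
(x²)` is carried along together. -/
theorem commute_L_pow (x : V) (k : ℕ) : Commute (J.L x) (J.L ((J.L x ^ k) J.one)) ∧
    Commute (J.L (J.L x x)) (J.L ((J.L x ^ k) J.one)) := by
  have hx : Commute (J.L x) (J.L (J.L x x)) := by
    ext y
    exact J.jordan x y
  induction k using Nat.twoStepInduction with
  | zero => simp [J.L_one]
  | one => simpa [J.mul_one] using hx.symm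
  | more k h0 h1 =>
    have h2 : (J.L x ^ (k + 2)) J.one = J.L (J.L x ((J.L x ^ k) J.one)) x := by
      rw [J.comm _ x, pow_succ', pow_succ']
      simp
    have h3 : (J.L x ^ (k + 1)) J.one = J.L x ((J.L x ^ k) J.one) := by
      rw [pow_succ']; simp
    rw [h3] at h1
    rw [h2, J.L_mul_mul, J.comm ((J.L x ^ k) J.one) x]
    constructor
    · exact ((((hx.mul_right h0.1).add_right (h1.1.mul_right (.refl _))).add_right
        (h1.1.mul_right (.refl _))).sub_right (((Commute.refl _).mul_right (.refl _)).mul_right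
          h0.1)).sub_right ((h0.1.mul_right (.refl _)).mul_right (.refl _))
    · exact (((((Commute.refl _).mul_right h0.2).add_right (h1.2.mul_right hx.symm)).add_right
        (h1.2.mul_right hx.symm)).sub_right ((hx.symm.mul_right hx.symm).mul_right
          h0.2)).sub_right ((h0.2.mul_right hx.symm).mul_right hx.symm)

theorem commute_L_aeval (x : V) (p : Polynomial ℝ) :
    Commute (J.L x) (J.L (Polynomial.aeval (J.L x) p J.one)) := by
  induction p using Polynomial.induction_on' with
  | add p q hp hq => simpa using hp.add_right hq
  | monomial k r =>
    have := ((J.commute_L_pow x k).1).smul_right r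
    simpa [Polynomial.aeval_monomial, Algebra.algebraMap_eq_smul_one] using this

/-- Power associativity. -/
theorem aeval_mul_aeval (x : V) (p q : Polynomial ℝ) :
    J.L (Polynomial.aeval (J.L x) p J.one) (Polynomial.aeval (J.L x) q J.one) =
      Polynomial.aeval (J.L x) (p * q) J.one := by
  -- As `L (p(x))` commutes with `L x`, it commutes with `q(L x)`; evaluating this at the unit gives
  -- the product rule.
  have h : Commute (Polynomial.aeval (J.L x) q) (J.L (Polynomial.aeval (J.L x) p J.one)) := by
    induction q using Polynomial.induction_on' with
    | add q r hq hr => simpa using hq.add_left hr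
    | monomial k r =>
      have := (((J.commute_L_aeval x p).pow_left k)).smul_left r
      simpa [Polynomial.aeval_monomial, Algebra.algebraMap_eq_smul_one] using this
  have h2 := congrArg (fun T : V →L[ℝ] V => T J.one) h.eq
  simp only [mul_apply_eq_comp, J.mul_one] at h2
  rw [← h2, mul_comm, map_mul]
  rfl

/-- `(c i)` for `i ∈ s` is a complete system of orthogonal idempotents. -/
structure IsFrame {ι : Type*} (s : Finset ι) (c : ι → V) : Prop where
  mul_self : ∀ i ∈ s, J.L (c i) (c i) = c i
  mul_of_ne : ∀ i ∈ s, ∀ j ∈ s, i ≠ j → J.L (c i) (c j) = 0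
  sum_one : ∑ i ∈ s, c i = J.one

/-- The spectral theorem. -/
theorem exists_isFrame [FiniteDimensional ℝ V] (x : V) :
    ∃ (s : Finset ℝ) (c : ℝ → V), J.IsFrame s c ∧ ∑ r ∈ s, r • c r = x := by
  classical
  have hT : (J.L x : V →ₗ[ℝ] V).IsSymmetric := fun y z => J.inner_mul x y z
  set b := hT.eigenvectorBasis rfl with hb
  set μ := hT.eigenvalues rfl with hμ
  have hTb : ∀ i, J.L x (b i) = μ i • b i := fun i => hT.apply_eigenvectorBasis rfl i
  have hpb : ∀ (p : Polynomial ℝ) i, Polynomial.aeval (J.L x) p (b i) = p.eval (μ i) • b i := by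
    intro p i
    induction p using Polynomial.induction_on' with
    | add p q hp hq => simp [hp, hq, add_smul]
    | monomial k r =>
      have : ∀ k : ℕ, (J.L x ^ k) (b i) = μ i ^ k • b i := by
        intro k
        induction k with
        | zero => simp
        | succ k ih => rw [pow_succ']; simp [ih, hTb, smul_smul, pow_succ]
      simp [Polynomial.aeval_monomial, Algebra.algebraMap_eq_smul_one, this, smul_smul]
  -- `L x` is diagonalizable, so a polynomial in it depends only on the values at the eigenvalues.
  have hp1 : ∀ p q : Polynomial ℝ, (∀ i, p.eval (μ i) = q.eval (μ i)) →
      Polynomial.aeval (J.L x) p J.one = Polynomial.aeval (J.L x) q J.one := by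
    intro p q h
    rw [← b.sum_repr J.one]
    simp only [map_sum, map_smul, hpb, h]
  set s : Finset ℝ := Finset.univ.image μ with hs
  have hmem : ∀ i, μ i ∈ s := fun i => Finset.mem_image_of_mem _ (Finset.mem_univ i)
  have hinj : Set.InjOn (id : ℝ → ℝ) s := Function.injective_id.injOn
  have h : ∀ p : Polynomial ℝ, ∑ r ∈ s, p.eval r • Polynomial.aeval (J.L x)
      (Lagrange.basis s id r) J.one = Polynomial.aeval (J.L x) p J.one := by
    intro p
    have : ∑ r ∈ s, p.eval r • Polynomial.aeval (J.L x) (Lagrange.basis s id r) J.one =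
        Polynomial.aeval (J.L x) (∑ r ∈ s, p.eval r • Lagrange.basis s id r) J.one := by
      simp [map_sum]
    rw [this]
    refine hp1 _ _ fun i => ?_
    simp only [Polynomial.eval_finsetSum, Polynomial.eval_smul, smul_eq_mul]
    rw [Finset.sum_eq_single (μ i)]
    · have := Lagrange.eval_basis_self hinj (hmem i)
      simp only [id] at this
      rw [this, _root_.mul_one]
    · intro r _ hr
      have := Lagrange.eval_basis_of_ne (v := id) hr (hmem i)
      simp only [id] at this
      rw [this, mul_zero]
    · exact fun h' => absurd (hmem i) h'
  -- The idempotents are the Lagrange polynomials of the eigenvalues of `L x`, evaluated at `x`.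
  -- Some may vanish: `L x` also has eigenvalues such as the half-sums of spectral values of `x`.
  -- This is why later statements carry the condition `c i ≠ 0`.
  refine ⟨s, fun r => Polynomial.aeval (J.L x) (Lagrange.basis s id r) J.one, ⟨?_, ?_, ?_⟩, ?_⟩
  · intro r hr
    rw [J.aeval_mul_aeval]
    refine hp1 _ _ fun i => ?_
    rw [Polynomial.eval_mul]
    by_cases h : μ i = r
    · have := Lagrange.eval_basis_self hinj hr
      simp only [id] at this
      rw [h, this, _root_.mul_one]
    · have := Lagrange.eval_basis_of_ne (v := id) (Ne.symm h) (hmem i)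
      simp only [id] at this
      rw [this, mul_zero]
  · intro r hr t ht hrt
    rw [J.aeval_mul_aeval, hp1 _ 0, map_zero]
    · rfl
    intro i
    rw [Polynomial.eval_mul]
    by_cases h : μ i = r
    · have := Lagrange.eval_basis_of_ne (v := id) (i := t) (j := μ i) (h ▸ hrt.symm) (hmem i)
      simp only [id] at this
      rw [this, mul_zero, Polynomial.eval_zero]
    · have := Lagrange.eval_basis_of_ne (v := id) (Ne.symm h) (hmem i)
      simp only [id] at this
      rw [this, zero_mul, Polynomial.eval_zero]
  · simpa using h 1
  · simpa [J.mul_one] using h Polynomial.X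

variable {J} in
/-- `L c = (L c)² + 4 (L c - (L c)²)²` for an idempotent `c`. -/
theorem L_eq_of_idempotent {c : V} (hc : J.L c c = c) (y : V) :
    J.L c y = J.L c (J.L c y) + (4 : ℝ) • (J.L c (J.L c y) - J.L c (J.L c (J.L c y))
      - J.L c (J.L c (J.L c y) - J.L c (J.L c (J.L c y)))) := by
  -- `L_mul_mul` with all arguments equal to `c` is the Peirce equation `2T³ - 3T² + T = 0`. Its
  -- roots `0, 1/2, 1` all satisfy `t = t² + 4 (t - t²)²`.
  have h : ∀ y, J.L c y = (3 : ℝ) • J.L c (J.L c y) - (2 : ℝ) • J.L c (J.L c (J.L c y)) := by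
    intro y
    have := congrArg (fun T : V →L[ℝ] V => T y) (J.L_mul_mul c c c)
    simp only [hc, add_apply, sub_apply, mul_apply_eq_comp] at this
    linear_combination (norm := module) this
  have h1 := h y
  have h2 := congrArg (J.L c) h1
  simp only [map_sub, map_smul] at *
  linear_combination (norm := module) h1 + (-2 : ℝ) • h2

variable {J} in
-- By self-adjointness, the polynomial identity for `L c` becomes a sum of squares. So `L c` is
-- positive semidefinite, and `⟨c y, y⟩ = 0` forces `c y = 0`.
theorem inner_L_of_idempotent {c : V} (hc : J.L c c = c) (y : V) :
    inner ℝ (J.L c y) y = ‖J.L c y‖ ^ 2 + 4 * ‖J.L c y - J.L c (J.L c y)‖ ^ 2 := by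
  conv_lhs => rw [L_eq_of_idempotent hc y]
  simp only [map_sub, inner_add_left, real_inner_smul_left, inner_sub_left, J.inner_mul c _ y]
  rw [← real_inner_self_eq_norm_sq, ← real_inner_self_eq_norm_sq]
  simp only [inner_sub_left, inner_sub_right]
  have h1 : inner ℝ (J.L c (J.L c y)) (J.L c y) = inner ℝ (J.L c y) (J.L c (J.L c y)) :=
    real_inner_comm _ _
  have h2 : inner ℝ (J.L c (J.L c (J.L c y))) (J.L c y) =
    inner ℝ (J.L c (J.L c y)) (J.L c (J.L c y)) := J.inner_mul _ _ _
  linear_combination -4 * h1 + 4 * h2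

variable {J} in
theorem inner_idempotent_sq_nonneg {c : V} (hc : J.L c c = c) (y : V) :
    0 ≤ inner ℝ c (J.L y y) := by
  rw [J.comm, ← J.inner_mul, J.comm y c, inner_L_of_idempotent hc]
  positivity

namespace IsFrame

variable {J} {ι : Type*} {s : Finset ι} {c : ι → V}

theorem mul_sum (h : J.IsFrame s c) (f g : ι → ℝ) :
    J.L (∑ i ∈ s, f i • c i) (∑ i ∈ s, g i • c i) = ∑ i ∈ s, (f i * g i) • c i := by
  classical
  rw [map_sum]
  refine Finset.sum_congr rfl fun r hr => ?_
  rw [J.comm, map_sum, Finset.sum_eq_single r]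
  · simp [h.mul_self r hr, smul_smul]
  · intro t ht htr
    simp [h.mul_of_ne r hr t ht htr.symm]
  · exact fun h' => absurd hr h'

theorem inner_eq_zero (h : J.IsFrame s c) {i j : ι} (hi : i ∈ s) (hj : j ∈ s)
    (hij : i ≠ j) : inner ℝ (c i) (c j) = 0 := by
  rw [← h.mul_self i hi, J.inner_mul, h.mul_of_ne i hi j hj hij, inner_zero_right]

theorem inner_sum (h : J.IsFrame s c) (f : ι → ℝ) {i : ι} (hi : i ∈ s) :
    inner ℝ (∑ j ∈ s, f j • c j) (c i) = f i * ‖c i‖ ^ 2 := by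
  classical
  rw [sum_inner, Finset.sum_eq_single i]
  · rw [real_inner_smul_left, real_inner_self_eq_norm_sq]
  · intro j hj hji
    rw [real_inner_smul_left, h.inner_eq_zero hj hi hji, mul_zero]
  · exact fun h' => absurd hi h'

theorem exp_apply [FiniteDimensional ℝ V] (h : J.IsFrame s c) (f : ι → ℝ) :
    NormedSpace.exp (J.L (∑ i ∈ s, f i • c i)) J.one = ∑ i ∈ s, Real.exp (f i) • c i := by
  have hp : ∀ k : ℕ, (J.L (∑ i ∈ s, f i • c i) ^ k) J.one = ∑ i ∈ s, f i ^ k • c i := by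
    intro k
    induction k with
    | zero => simp [h.sum_one]
    | succ k ih =>
      rw [pow_succ', mul_apply_eq_comp, ih, h.mul_sum]
      simp only [pow_succ']
  have h1 := (NormedSpace.exp_series_hasSum_exp' (𝕂 := ℝ) (J.L (∑ i ∈ s, f i • c i))).mapL
    (ContinuousLinearMap.apply ℝ V J.one)
  refine h1.unique ?_
  simp only [ContinuousLinearMap.apply_apply, smul_apply, hp, Finset.smul_sum]
  refine hasSum_sum fun i _ => ?_
  have h2 := (NormedSpace.exp_series_hasSum_exp' (𝕂 := ℝ) (f i)).smul_const (c i)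
  rw [← Real.exp_eq_exp_ℝ] at h2
  simpa [smul_smul] using h2

theorem inner_sq_nonneg (h : J.IsFrame s c) {i : ι} (hi : i ∈ s) (y : V) :
    0 ≤ inner ℝ (c i) (J.L y y) := inner_idempotent_sq_nonneg (h.mul_self i hi) y

end IsFrame

/-! ### The cone of positive elements and its self-duality -/

theorem inner_one_sq (y : V) : inner ℝ J.one (J.L y y) = ‖y‖ ^ 2 := by
  rw [real_inner_comm, J.inner_mul, J.mul_one, real_inner_self_eq_norm_sq]

/-- The cone of positive elements. -/
def cone : Set V := {x | ∀ y, y ≠ 0 → 0 < inner ℝ x (J.L y y)}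

/-- The cone of elements which are nonnegative against squares. -/
def nonnegCone : Set V := {x | ∀ y, 0 ≤ inner ℝ x (J.L y y)}

theorem cone_subset_nonnegCone : J.cone ⊆ J.nonnegCone := by
  intro x hx y
  by_cases hy : y = 0
  · simp [hy]
  · exact (hx y hy).le

variable {J} in
-- Testing against `c i = (c i)²` isolates one coefficient. Conversely the numbers `⟨c i, y²⟩` are
-- nonnegative with sum `‖y‖²`, so one of them is positive when `y ≠ 0`.
theorem IsFrame.sum_mem_cone_iff {ι : Type*} {s : Finset ι} {c : ι → V} (h : J.IsFrame s c)
    (f : ι → ℝ) : ∑ i ∈ s, f i • c i ∈ J.cone ↔ ∀ i ∈ s, c i ≠ 0 → 0 < f i := by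
  constructor
  · intro hx i hi hci
    have h1 := hx (c i) hci
    rw [h.mul_self i hi, h.inner_sum f hi] at h1
    exact pos_of_mul_pos_left h1 (by positivity)
  · intro hf y hy
    have h1 : 0 < ∑ i ∈ s, inner ℝ (c i) (J.L y y) := by
      rw [← sum_inner, h.sum_one, J.inner_one_sq]
      positivity
    obtain ⟨i, hi, hpos⟩ := Finset.exists_lt_of_sum_lt (by simpa using h1 :
      ∑ i ∈ s, (0 : ℝ) < ∑ i ∈ s, inner ℝ (c i) (J.L y y))
    simp only [sum_inner, real_inner_smul_left]
    refine Finset.sum_pos' (fun j hj => ?_) ⟨i, hi, ?_⟩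
    · by_cases hcj : c j = 0
      · simp [hcj]
      · exact mul_nonneg (hf j hj hcj).le (h.inner_sq_nonneg hj y)
    · refine mul_pos (hf i hi ?_) hpos
      rintro h0
      simp [h0] at hpos

variable {J} in
theorem IsFrame.sum_mem_nonnegCone_iff {ι : Type*} {s : Finset ι} {c : ι → V}
    (h : J.IsFrame s c) (f : ι → ℝ) :
    ∑ i ∈ s, f i • c i ∈ J.nonnegCone ↔ ∀ i ∈ s, c i ≠ 0 → 0 ≤ f i := by
  constructor
  · intro hx i hi hci
    have h1 := hx (c i)
    rw [h.mul_self i hi, h.inner_sum f hi] at h1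
    exact nonneg_of_mul_nonneg_left h1 (by positivity)
  · intro hf y
    simp only [sum_inner, real_inner_smul_left]
    refine Finset.sum_nonneg fun j hj => ?_
    by_cases hcj : c j = 0
    · simp [hcj]
    · exact mul_nonneg (hf j hj hcj) (h.inner_sq_nonneg hj y)

theorem sq_ne_zero {y : V} (hy : y ≠ 0) : J.L y y ≠ 0 := by
  intro h
  have := J.inner_one_sq y
  rw [h, inner_zero_right] at this
  exact hy (by simpa using this.symm)

theorem one_mem_cone : J.one ∈ J.cone := fun y hy => by
  rw [J.inner_one_sq]; positivity

theorem convex_cone : Convex ℝ J.cone := by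
  intro x hx y hy a b ha hb hab z hz
  rw [inner_add_left, real_inner_smul_left, real_inner_smul_left]
  have h1 := hx z hz
  have h2 := hy z hz
  rcases ha.eq_or_lt with rfl | ha
  · simp only [zero_add] at hab
    simpa [hab] using h2
  · positivity

theorem add_mem_cone {x y : V} (hx : x ∈ J.nonnegCone) (hy : y ∈ J.cone) : x + y ∈ J.cone := by
  intro z hz
  rw [inner_add_left]
  exact add_pos_of_nonneg_of_pos (hx z) (hy z hz)

theorem smul_mem_cone {r : ℝ} (hr : 0 < r) {x : V} (hx : x ∈ J.cone) : r • x ∈ J.cone := by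
  intro z hz
  rw [real_inner_smul_left]
  exact mul_pos hr (hx z hz)

theorem isClosed_nonnegCone : IsClosed J.nonnegCone := by
  simp only [nonnegCone, Set.ofPred_forall]
  exact isClosed_iInter fun y => isClosed_le continuous_const (by fun_prop)

variable [FiniteDimensional ℝ V]

theorem sq_mem_nonnegCone (y : V) : J.L y y ∈ J.nonnegCone := by
  obtain ⟨s, c, h, rfl⟩ := J.exists_isFrame y
  rw [h.mul_sum, h.sum_mem_nonnegCone_iff]
  exact fun r _ _ => mul_self_nonneg r

theorem inner_nonneg {x y : V} (hx : x ∈ J.nonnegCone) (hy : y ∈ J.nonnegCone) :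
    0 ≤ inner ℝ x y := by
  obtain ⟨s, c, h, rfl⟩ := J.exists_isFrame y
  rw [h.sum_mem_nonnegCone_iff] at hy
  rw [inner_sum]
  refine Finset.sum_nonneg fun r hr => ?_
  rw [real_inner_smul_right]
  by_cases hc : c r = 0
  · simp [hc]
  · rw [← h.mul_self r hr]
    exact mul_nonneg (hy r hr hc) (hx _)

theorem inner_pos {x y : V} (hx : x ∈ J.cone) (hy : y ∈ J.nonnegCone) (hy0 : y ≠ 0) :
    0 < inner ℝ x y := by
  obtain ⟨s, c, h, rfl⟩ := J.exists_isFrame y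
  rw [h.sum_mem_nonnegCone_iff] at hy
  obtain ⟨r, hr, hrc⟩ := Finset.exists_ne_zero_of_sum_ne_zero hy0
  rw [smul_ne_zero_iff] at hrc
  rw [inner_sum]
  refine Finset.sum_pos' (fun t ht => ?_) ⟨r, hr, ?_⟩
  · rw [real_inner_smul_right]
    by_cases hc : c t = 0
    · simp [hc]
    · rw [← h.mul_self t ht]
      exact mul_nonneg (hy t ht hc) (J.cone_subset_nonnegCone hx _)
  · rw [real_inner_smul_right, ← h.mul_self r hr]
    exact mul_pos (lt_of_le_of_ne (hy r hr hrc.2) hrc.1.symm) (hx _ hrc.2)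

/-- The cone is self-dual. -/
theorem mem_cone_iff_inner {x : V} :
    x ∈ J.cone ↔ ∀ y ∈ J.nonnegCone, y ≠ 0 → 0 < inner ℝ x y :=
  ⟨fun hx _ hy hy0 => J.inner_pos hx hy hy0,
    fun h y hy => h _ (J.sq_mem_nonnegCone y) (J.sq_ne_zero hy)⟩

/-- Complementary slackness. In spectral expansions of `x` and `y` every term of the inner product
is nonnegative, hence zero. For idempotents, `⟨c, d⟩ = ⟨c d, d⟩ = 0` gives `c d = 0` by
`inner_L_of_idempotent`. -/
theorem mul_eq_zero_of_inner_eq_zero {x y : V} (hx : x ∈ J.nonnegCone) (hy : y ∈ J.nonnegCone)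
    (hxy : inner ℝ x y = 0) : J.L x y = 0 := by
  obtain ⟨s, c, h, rfl⟩ := J.exists_isFrame x
  obtain ⟨t, d, k, rfl⟩ := J.exists_isFrame y
  have hx' := (h.sum_mem_nonnegCone_iff _).1 hx
  have hy' := (k.sum_mem_nonnegCone_iff _).1 hy
  have hcd : ∀ r ∈ s, ∀ q ∈ t, 0 ≤ inner ℝ (c r) (d q) := by
    intro r hr q hq
    rw [← k.mul_self q hq]
    exact h.inner_sq_nonneg hr _
  have hterm : ∀ r ∈ s, ∀ q ∈ t, 0 ≤ inner ℝ (r • c r) (q • d q) := by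
    intro r hr q hq
    rw [real_inner_smul_left, real_inner_smul_right]
    by_cases hc : c r = 0
    · simp [hc]
    by_cases hd : d q = 0
    · simp [hd]
    exact mul_nonneg (hx' r hr hc) (mul_nonneg (hy' q hq hd) (hcd r hr q hq))
  simp only [sum_inner, inner_sum] at hxy
  rw [Finset.sum_eq_zero_iff_of_nonneg
    fun q hq => Finset.sum_nonneg fun r hr => hterm r hr q hq] at hxy
  rw [map_sum]
  refine Finset.sum_eq_zero fun q hq => ?_
  rw [J.comm, map_sum]
  refine Finset.sum_eq_zero fun r hr => ?_
  have h0 := (Finset.sum_eq_zero_iff_of_nonneg fun r hr => hterm r hr q hq).1 (hxy q hq) r hr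
  rw [real_inner_smul_left, real_inner_smul_right, mul_eq_zero, mul_eq_zero] at h0
  simp only [map_smul, smul_apply]
  rcases h0 with h0 | h0 | h0
  · simp [h0]
  · simp [h0]
  · have h1 : inner ℝ (J.L (c r) (d q)) (d q) = 0 := by
      rw [J.comm, J.inner_mul, k.mul_self q hq, h0]
    rw [inner_L_of_idempotent (h.mul_self r hr)] at h1
    have h2 : J.L (c r) (d q) = 0 := by
      have h3 : ‖J.L (c r) (d q)‖ ^ 2 = 0 := by
        nlinarith [sq_nonneg (‖J.L (c r) (d q)‖),
          sq_nonneg (‖J.L (c r) (d q) - J.L (c r) (J.L (c r) (d q))‖)]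
      simpa using h3
    rw [J.comm] at h2
    simp [h2]

/-- By homogeneity it is enough to test `y` on the unit sphere, and a strict inequality over a
compact set is an open condition. -/
theorem isOpen_cone : IsOpen J.cone := by
  have hK : IsCompact (Metric.sphere (0 : V) 1) := isCompact_sphere _ _
  have h1 : J.cone = {x | ∀ y ∈ Metric.sphere (0 : V) 1, 0 < inner ℝ x (J.L y y)} := by
    ext x
    constructor
    · intro hx y hy
      exact hx y (by rintro rfl; simp at hy)
    · intro hx y hy
      have h2 := hx (‖y‖⁻¹ • y) (by simp [norm_smul, hy])
      simp only [map_smul, smul_apply, real_inner_smul_right] at h2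
      have h3 : 0 < ‖y‖⁻¹ := by positivity
      exact pos_of_mul_pos_right (pos_of_mul_pos_right h2 h3.le) h3.le
  rw [h1]
  rw [isOpen_iff_eventually]
  intro x hx
  refine hK.eventually_forall_of_forall_eventually fun y hy => ?_
  exact continuous_const.continuousAt.eventually_lt
    (f := fun _ => (0 : ℝ)) (g := fun p : V × V => inner ℝ p.1 (J.L p.2 p.2))
    (Continuous.continuousAt (by fun_prop)) (hx y hy)

end Spectral
end EuclideanJordan

namespace EuclideanJordan

/-! ### Exponentials of multiplication operators act on the cone -/

section ExpCone

variable {V : Type*} [NormedAddCommGroup V] [InnerProductSpace ℝ V] [FiniteDimensional ℝ V]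
  (J : EuclideanJordan V)

theorem exp_neg_mul_exp (X : V →L[ℝ] V) : NormedSpace.exp (-X) * NormedSpace.exp X = 1 := by
  let _ : NormedAlgebra ℚ (V →L[ℝ] V) := .restrictScalars ℚ ℝ _
  rw [← NormedSpace.exp_add_of_commute (Commute.refl X).neg_left, neg_add_cancel,
    NormedSpace.exp_zero]

theorem exp_mul_exp_neg (X : V →L[ℝ] V) : NormedSpace.exp X * NormedSpace.exp (-X) = 1 := by
  simpa using exp_neg_mul_exp (-X)

theorem continuous_exp : Continuous (NormedSpace.exp : (V →L[ℝ] V) → V →L[ℝ] V) :=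
  let _ : NormedAlgebra ℚ (V →L[ℝ] V) := .restrictScalars ℚ ℝ _
  NormedSpace.exp_continuous

theorem hasDerivAt_exp_smul_apply (X : V →L[ℝ] V) (y : V) (t : ℝ) :
    HasDerivAt (fun t : ℝ => NormedSpace.exp (t • X) y) (X (NormedSpace.exp (t • X) y)) t :=
  (ContinuousLinearMap.apply ℝ V y).hasFDerivAt.comp_hasDerivAt t
    (hasDerivAt_exp_smul_const' X t)

/-- The flow of a strictly cross-positive operator preserves the cone. -/
theorem exp_smul_mem_cone_of_strict {X : V →L[ℝ] V}
    (hX : ∀ c ∈ J.nonnegCone, c ≠ 0 → ∀ z, z ≠ 0 → inner ℝ c (J.L z z) = 0 →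
      0 < inner ℝ (X c) (J.L z z)) {y : V} (hy : y ∈ J.cone) {t : ℝ} (ht : 0 ≤ t) :
    NormedSpace.exp (t • X) y ∈ J.cone := by
  by_contra hcon
  have hcont : Continuous fun t : ℝ => NormedSpace.exp (t • X) y :=
    continuous_iff_continuousAt.2 fun t => (hasDerivAt_exp_smul_apply X y t).continuousAt
  -- The infimum `t₀` of `S` is the first exit time. There the orbit is a nonzero point of the
  -- closed cone that is orthogonal to some `z²` with `z ≠ 0`.
  set S : Set ℝ := Set.Ici 0 ∩ (fun t : ℝ => NormedSpace.exp (t • X) y) ⁻¹' J.coneᶜ with hS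
  have hSc : IsClosed S := isClosed_Ici.inter (J.isOpen_cone.isClosed_compl.preimage hcont)
  have hSb : BddBelow S := ⟨0, fun t ht => ht.1⟩
  have hmem := hSc.csInf_mem ⟨t, ht, hcon⟩ hSb
  set t₀ := sInf S
  have h0 : 0 < t₀ := by
    refine lt_of_le_of_ne hmem.1 fun h => hmem.2 ?_
    simp only [← h, zero_smul, NormedSpace.exp_zero]
    simpa using hy
  have hlt : ∀ r ∈ Set.Ico 0 t₀, NormedSpace.exp (r • X) y ∈ J.cone := by
    intro r hr
    by_contra h
    exact absurd (csInf_le hSb ⟨hr.1, h⟩) (not_le.2 hr.2)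
  have hev : ∀ᶠ r in 𝓝[<] t₀, NormedSpace.exp (r • X) y ∈ J.cone := by
    filter_upwards [Ioo_mem_nhdsLT h0] with r hr
    exact hlt r ⟨hr.1.le, hr.2⟩
  have hw : NormedSpace.exp (t₀ • X) y ∈ J.nonnegCone :=
    J.isClosed_nonnegCone.mem_of_tendsto (hcont.continuousAt.tendsto.mono_left nhdsWithin_le_nhds)
      (hev.mono fun r hr => J.cone_subset_nonnegCone hr)
  obtain ⟨z, hz, hwz⟩ : ∃ z, z ≠ 0 ∧ inner ℝ (NormedSpace.exp (t₀ • X) y) (J.L z z) ≤ 0 := by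
    have := hmem.2
    simp only [Set.mem_preimage, Set.mem_compl_iff, cone, Set.mem_ofPred_eq] at this
    push Not at this
    exact this
  have hwz0 := le_antisymm hwz (hw z)
  have hw0 : NormedSpace.exp (t₀ • X) y ≠ 0 := by
    intro h
    have h1 := congrArg (fun T : V →L[ℝ] V => T y) (exp_neg_mul_exp (t₀ • X))
    simp only [mul_apply_eq_comp, h, map_zero] at h1
    have h2 := hy z hz
    simp [← show (0 : V) = y from h1] at h2
  have hd := hX _ hw hw0 z hz hwz0
  have hder : HasDerivAt (fun t : ℝ => inner ℝ (NormedSpace.exp (t • X) y) (J.L z z))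
      (inner ℝ (X (NormedSpace.exp (t₀ • X) y)) (J.L z z)) t₀ := by
    simpa using (hasDerivAt_exp_smul_apply X y t₀).inner ℝ (hasDerivAt_const t₀ (J.L z z))
  have hslope := hasDerivAt_iff_tendsto_slope.1 hder
  -- Before `t₀` the pairing with `z²` is positive and at `t₀` it vanishes, so its derivative is at
  -- most `0`, contrary to `hd`.
  have hle := le_of_tendsto (hslope.mono_left (nhdsWithin_mono t₀ (s := Set.Iio t₀)
    fun r hr => ne_of_lt hr)) (b := 0) (by
      filter_upwards [hev, self_mem_nhdsWithin] with r hr hr'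
      rw [slope_def_field, hwz0, sub_zero]
      exact (div_neg_of_pos_of_neg (hr z hz) (sub_neg.2 hr')).le)
  linarith

/-- On an orthogonal pair `c, z²` one has `⟨x c, z²⟩ = ⟨x, c z²⟩ = 0`, so `L x` is cross-positive
but not strictly. The perturbation `ε e ⊗ e` makes it strict, and the limit `ε → 0` costs the
interior. -/
theorem exp_L_mem_nonnegCone (x : V) {y : V} (hy : y ∈ J.cone) :
    NormedSpace.exp (J.L x) y ∈ J.nonnegCone := by
  set N : V →L[ℝ] V := (innerSL ℝ J.one).smulRight J.one with hN
  have h1 : ∀ ε : ℝ, 0 < ε → NormedSpace.exp (J.L x + ε • N) y ∈ J.cone := by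
    intro ε hε
    have := J.exp_smul_mem_cone_of_strict (X := J.L x + ε • N) ?_ hy zero_le_one
    · simpa using this
    intro c hc hc0 z hz hcz
    have h0 := J.mul_eq_zero_of_inner_eq_zero hc (J.sq_mem_nonnegCone z) hcz
    have h2 : inner ℝ (J.L x c) (J.L z z) = 0 := by
      rw [J.comm, J.inner_mul, h0, inner_zero_right]
    have h3 := J.inner_pos J.one_mem_cone hc hc0
    have h4 := J.one_mem_cone z hz
    simp only [add_apply, smul_apply, inner_add_left, h2, hN,
      ContinuousLinearMap.smulRight_apply, innerSL_apply_apply, real_inner_smul_left]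
    positivity
  have h2 : Filter.Tendsto (fun ε : ℝ => NormedSpace.exp (J.L x + ε • N) y) (𝓝[>] 0)
      (𝓝 (NormedSpace.exp (J.L x) y)) := by
    have h3 : Continuous fun ε : ℝ => NormedSpace.exp (J.L x + ε • N) y :=
      (ContinuousLinearMap.apply ℝ V y).continuous.comp
        (continuous_exp.comp (by fun_prop))
    have h4 := h3.tendsto 0
    simp only [zero_smul, add_zero] at h4
    exact h4.mono_left nhdsWithin_le_nhds
  refine J.isClosed_nonnegCone.mem_of_tendsto h2 ?_
  filter_upwards [self_mem_nhdsWithin] with ε hε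
  exact J.cone_subset_nonnegCone (h1 ε hε)

theorem exp_L_one_mem_cone (x : V) : NormedSpace.exp (J.L x) J.one ∈ J.cone := by
  obtain ⟨s, c, h, hx⟩ := J.exists_isFrame x
  rw [← hx, h.exp_apply, h.sum_mem_cone_iff]
  exact fun i _ _ => Real.exp_pos _

theorem exists_sub_smul_mem_cone {x : V} (hx : x ∈ J.cone) (y : V) :
    ∃ δ : ℝ, 0 < δ ∧ x - δ • y ∈ J.cone := by
  have h1 : ∀ᶠ δ : ℝ in 𝓝 0, x - δ • y ∈ J.cone := by
    have h2 : Continuous fun δ : ℝ => x - δ • y := by fun_prop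
    exact h2.continuousAt.eventually_mem (J.isOpen_cone.mem_nhds (by simpa using hx))
  have h3 : ∀ᶠ δ : ℝ in 𝓝[>] 0, x - δ • y ∈ J.cone := h1.filter_mono nhdsWithin_le_nhds
  obtain ⟨δ, hδ, h0⟩ := (h3.and self_mem_nhdsWithin).exists
  exact ⟨δ, h0, hδ⟩

/-- The interior is recovered by splitting off a small multiple of the unit: `exp (L x) e` has
positive spectral coefficients, and adding a point of the closed cone keeps it in the open one. -/
theorem exp_L_mem_cone (x : V) {y : V} (hy : y ∈ J.cone) :
    NormedSpace.exp (J.L x) y ∈ J.cone := by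
  obtain ⟨δ, hδ, h⟩ := J.exists_sub_smul_mem_cone hy J.one
  have h1 := J.add_mem_cone (J.exp_L_mem_nonnegCone x h)
    (J.smul_mem_cone hδ (J.exp_L_one_mem_cone x))
  simpa using h1

theorem exists_exp_L_one {x : V} (hx : x ∈ J.cone) :
    ∃ y, NormedSpace.exp (J.L y) J.one = x := by
  obtain ⟨s, c, h, rfl⟩ := J.exists_isFrame x
  rw [h.sum_mem_cone_iff] at hx
  -- The value of `Real.log r` at `r ≤ 0` is harmless, since then `c r = 0`.
  refine ⟨∑ r ∈ s, Real.log r • c r, ?_⟩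
  rw [h.exp_apply]
  refine Finset.sum_congr rfl fun r hr => ?_
  by_cases hc : c r = 0
  · simp [hc]
  · rw [Real.exp_log (hx r hr hc)]

/-- Comparing coefficients on a frame gives `e^r = e^(-r)`. This makes the unit the only fixed point
of inversion. -/
theorem eq_zero_of_exp_eq_exp_neg {x : V}
    (hx : NormedSpace.exp (J.L x) J.one = NormedSpace.exp (J.L (-x)) J.one) : x = 0 := by
  obtain ⟨s, c, h, rfl⟩ := J.exists_isFrame x
  have h1 : -∑ r ∈ s, r • c r = ∑ r ∈ s, (-r) • c r := by simp
  rw [h1, h.exp_apply, h.exp_apply] at hx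
  refine Finset.sum_eq_zero fun r hr => ?_
  by_cases hc : c r = 0
  · simp [hc]
  have h2 := congrArg (fun y => inner ℝ y (c r)) hx
  simp only [h.inner_sum _ hr] at h2
  have h3 := Real.exp_injective (mul_right_cancel₀ (by positivity) h2)
  have : r = 0 := by linarith
  simp [this]

/-- `exp (L x)` as an automorphism of the cone. -/
noncomputable def expL (x : V) : (V →L[ℝ] V)ˣ where
  val := NormedSpace.exp (J.L x)
  inv := NormedSpace.exp (-J.L x)
  val_inv := exp_mul_exp_neg _
  inv_val := exp_neg_mul_exp _

theorem expL_mem_coneAut (x : V) : J.expL x ∈ coneAut J.cone := by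
  refine Set.Subset.antisymm ?_ fun y hy => ?_
  · rintro _ ⟨y, hy, rfl⟩
    exact J.exp_L_mem_cone x hy
  · refine ⟨NormedSpace.exp (J.L (-x)) y, J.exp_L_mem_cone _ hy, ?_⟩
    have := congrArg (fun T : V →L[ℝ] V => T y) (exp_mul_exp_neg (J.L x))
    simpa [expL] using this

theorem continuous_expL : Continuous J.expL := by
  rw [Units.continuous_iff]
  exact ⟨continuous_exp.comp J.L.continuous,
    continuous_exp.comp J.L.continuous.neg⟩

theorem expL_mem_coneAutZero (x : V) : J.expL x ∈ coneAutZero J.cone := by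
  refine ⟨⟨J.expL x, J.expL_mem_coneAut x⟩, ?_, rfl⟩
  have hc : Continuous fun y : V => (⟨J.expL y, J.expL_mem_coneAut y⟩ : coneAut J.cone) :=
    J.continuous_expL.subtype_mk _
  have h0 : (⟨J.expL 0, J.expL_mem_coneAut 0⟩ : coneAut J.cone) = 1 := by
    apply Subtype.ext
    apply Units.ext
    simp [expL]
  -- The image of the connected space `V` contains `exp 0 = 1`, so it lies in the identity
  -- component.
  have h1 := (isPreconnected_univ.image _ hc.continuousOn).subset_connectedComponent
    ⟨0, Set.mem_univ _, h0⟩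
  exact h1 ⟨x, Set.mem_univ _, rfl⟩

end ExpCone

end EuclideanJordan

namespace EuclideanJordan

/-! ### The stabilizer of the unit and the logarithmic potential -/

section Potential

variable {V : Type*} [NormedAddCommGroup V] [InnerProductSpace ℝ V] (J : EuclideanJordan V)

theorem inv_apply_apply (a : (V →L[ℝ] V)ˣ) (x : V) :
    ((a⁻¹ : (V →L[ℝ] V)ˣ) : V →L[ℝ] V) ((a : V →L[ℝ] V) x) = x := by
  rw [← mul_apply_eq_comp, Units.inv_mul, one_apply_eq_self]

theorem apply_inv_apply (a : (V →L[ℝ] V)ˣ) (x : V) :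
    (a : V →L[ℝ] V) (((a⁻¹ : (V →L[ℝ] V)ˣ) : V →L[ℝ] V) x) = x := by
  rw [← mul_apply_eq_comp, Units.mul_inv, one_apply_eq_self]

variable {J} in
theorem apply_mem_cone {a : (V →L[ℝ] V)ˣ} (ha : a ∈ coneAut J.cone) {x : V} (hx : x ∈ J.cone) :
    (a : V →L[ℝ] V) x ∈ J.cone := by
  have h : (fun x => (a : V →L[ℝ] V) x) '' J.cone = J.cone := ha
  rw [← h]
  exact ⟨x, hx, rfl⟩

theorem continuous_abs_det : Continuous fun T : V →L[ℝ] V => |T.det| :=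
  continuous_abs.comp ContinuousLinearMap.continuous_det

theorem det_mul (S T : V →L[ℝ] V) : (S * T).det = S.det * T.det :=
  LinearMap.det_comp (S : V →ₗ[ℝ] V) T

theorem det_one : (1 : V →L[ℝ] V).det = 1 := LinearMap.det_id

theorem det_ne_zero (a : (V →L[ℝ] V)ˣ) : (a : V →L[ℝ] V).det ≠ 0 := by
  intro h
  have := det_mul (a : V →L[ℝ] V) (a⁻¹ : (V →L[ℝ] V)ˣ)
  rw [Units.mul_inv, h, zero_mul, det_one] at this
  exact one_ne_zero this

/-- The map `y ↦ exp (L y) e`. -/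
noncomputable def expOne (y : V) : V := NormedSpace.exp (J.L y) J.one

theorem expOne_zero : J.expOne 0 = J.one := by simp [expOne]

variable [FiniteDimensional ℝ V]

theorem exists_coneAutZero_apply_one {x : V} (hx : x ∈ J.cone) :
    ∃ y, x = (J.expL y : V →L[ℝ] V) J.one := by
  obtain ⟨y, hy⟩ := J.exists_exp_L_one hx
  exact ⟨y, hy.symm⟩

variable {J} in
-- If `e ± v` lie in the cone, so do `e ± a v`. Self-duality gives `⟨e + a v, e - a v⟩ ≥ 0`, that is
-- `‖a v‖ ≤ ‖e‖`.
theorem exists_norm_le_of_stabilizer : ∃ R : ℝ, ∀ a ∈ coneAut J.cone,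
    (a : V →L[ℝ] V) J.one = J.one → ‖(a : V →L[ℝ] V)‖ ≤ R := by
  obtain ⟨δ, hδ, hball⟩ := Metric.isOpen_iff.1 J.isOpen_cone J.one J.one_mem_cone
  refine ⟨‖J.one‖ * (2 / δ), fun a ha hae => ?_⟩
  -- It suffices to take `δ/2 ≤ ‖v‖ < δ`: the upper bound keeps `e ± v` in the cone and the lower
  -- one gives `1 ≤ (2/δ) ‖v‖`.
  refine ContinuousLinearMap.opNorm_le_of_shell hδ (by positivity) (c := (2 : ℝ)) (by norm_num)
    fun v hv1 hv2 => ?_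
  have h1 : J.one + v ∈ J.cone := hball (by simpa [mem_ball_iff_norm] using hv2)
  have h2 : J.one - v ∈ J.cone := hball (by simpa [mem_ball_iff_norm] using hv2)
  have h3 := apply_mem_cone ha h1
  have h4 := apply_mem_cone ha h2
  rw [map_add, hae] at h3
  rw [map_sub, hae] at h4
  have h5 := J.inner_nonneg (J.cone_subset_nonnegCone h3) (J.cone_subset_nonnegCone h4)
  rw [inner_add_left, inner_sub_right, inner_sub_right, real_inner_self_eq_norm_sq,
    real_inner_self_eq_norm_sq, real_inner_comm J.one] at h5
  have h6 : ‖(a : V →L[ℝ] V) v‖ ≤ ‖J.one‖ := by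
    nlinarith [norm_nonneg ((a : V →L[ℝ] V) v), norm_nonneg J.one]
  have h7 : 1 ≤ 2 / δ * ‖v‖ := by
    rw [Real.norm_ofNat, div_le_iff₀ (by norm_num)] at hv1
    rw [div_mul_eq_mul_div, le_div_iff₀ hδ]
    linarith
  calc _ ≤ ‖J.one‖ * 1 := by simpa using h6
    _ ≤ ‖J.one‖ * (2 / δ * ‖v‖) := by gcongr
    _ = _ := by ring

variable {J} in
-- The powers of `a` also fix the unit, so they are uniformly bounded, and so are the powers of its
-- determinant.
theorem abs_det_le_one {a : (V →L[ℝ] V)ˣ} (ha : a ∈ coneAut J.cone)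
    (hae : (a : V →L[ℝ] V) J.one = J.one) : |(a : V →L[ℝ] V).det| ≤ 1 := by
  obtain ⟨R, hR⟩ := exists_norm_le_of_stabilizer (J := J)
  obtain ⟨M, hM⟩ := (isCompact_closedBall (0 : V →L[ℝ] V) R).bddAbove_image
    continuous_abs_det.continuousOn
  have h1 : ∀ n : ℕ, |(a : V →L[ℝ] V).det| ^ n ≤ M := by
    intro n
    have h2 : ((a ^ n : (V →L[ℝ] V)ˣ) : V →L[ℝ] V) J.one = J.one := by
      induction n with
      | zero => simp
      | succ n ih =>
        rw [pow_succ', Units.val_mul, mul_apply_eq_comp, ih, hae]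
    have h3 := hM ⟨_, by simpa using hR (a ^ n) (Subgroup.pow_mem _ ha n) h2, rfl⟩
    have h4 : ((a ^ n : (V →L[ℝ] V)ˣ) : V →L[ℝ] V).det = (a : V →L[ℝ] V).det ^ n := by
      clear h2 h3
      induction n with
      | zero => simp [det_one]
      | succ n ih => rw [pow_succ, Units.val_mul, det_mul, ih, pow_succ]
    rw [← abs_pow, ← h4]
    exact h3
  by_contra hcon
  obtain ⟨n, hn⟩ := pow_unbounded_of_one_lt M (not_le.1 hcon)
  exact absurd (h1 n) (not_le.2 hn)

variable {J} in
theorem log_abs_det_eq_zero {a : (V →L[ℝ] V)ˣ} (ha : a ∈ coneAut J.cone)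
    (hae : (a : V →L[ℝ] V) J.one = J.one) : Real.log |(a : V →L[ℝ] V).det| = 0 := by
  have h1 := abs_det_le_one ha hae
  have h2 := abs_det_le_one (Subgroup.inv_mem _ ha) (by
    conv_lhs => rw [← hae]
    exact inv_apply_apply a J.one)
  have h3 : |(a : V →L[ℝ] V).det| * |((a⁻¹ : (V →L[ℝ] V)ˣ) : V →L[ℝ] V).det| = 1 := by
    rw [← abs_mul, ← det_mul, Units.mul_inv, det_one, abs_one]
  have h4 : 0 ≤ |((a⁻¹ : (V →L[ℝ] V)ˣ) : V →L[ℝ] V).det| := abs_nonneg _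
  have h5 : |(a : V →L[ℝ] V).det| = 1 := by nlinarith [abs_nonneg (a : V →L[ℝ] V).det]
  rw [h5, Real.log_one]

open Classical in
/-- The potential `-log |det a|` at `a e`; it is a multiple of the logarithm of the Koszul–Vinberg
characteristic function, up to a constant. -/
noncomputable def pot (x : V) : ℝ :=
  if h : ∃ a ∈ coneAut J.cone, (a : V →L[ℝ] V) J.one = x then
    -Real.log |(h.choose : V →L[ℝ] V).det| else 0

variable {J} in
-- Independence of the choice: two cone automorphisms with the same value at `e` differ by a
-- stabilizer element, whose determinant is `±1`.
theorem pot_apply_one {a : (V →L[ℝ] V)ˣ} (ha : a ∈ coneAut J.cone) :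
    J.pot ((a : V →L[ℝ] V) J.one) = -Real.log |(a : V →L[ℝ] V).det| := by
  have h : ∃ b ∈ coneAut J.cone, (b : V →L[ℝ] V) J.one = (a : V →L[ℝ] V) J.one := ⟨a, ha, rfl⟩
  rw [pot, dif_pos h]
  set b := h.choose
  have hb : b ∈ coneAut J.cone := h.choose_spec.1
  have hbe : (b : V →L[ℝ] V) J.one = (a : V →L[ℝ] V) J.one := h.choose_spec.2
  have h1 := log_abs_det_eq_zero (Subgroup.mul_mem _ (Subgroup.inv_mem _ ha) hb) (by
    rw [Units.val_mul, mul_apply_eq_comp, hbe, inv_apply_apply])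
  have h2 : (b : V →L[ℝ] V).det = (a : V →L[ℝ] V).det *
      ((a⁻¹ * b : (V →L[ℝ] V)ˣ) : V →L[ℝ] V).det := by
    rw [← det_mul, ← Units.val_mul, mul_inv_cancel_left]
  rw [h2, abs_mul, Real.log_mul (abs_ne_zero.2 (det_ne_zero _)) (abs_ne_zero.2 (det_ne_zero _)),
    h1, add_zero]

variable {J} in
theorem pot_apply {a : (V →L[ℝ] V)ˣ} (ha : a ∈ coneAut J.cone) {x : V} (hx : x ∈ J.cone) :
    J.pot ((a : V →L[ℝ] V) x) = J.pot x - Real.log |(a : V →L[ℝ] V).det| := by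
  obtain ⟨y, rfl⟩ := J.exists_coneAutZero_apply_one hx
  rw [pot_apply_one (J.expL_mem_coneAut y), ← mul_apply_eq_comp, ← Units.val_mul,
    pot_apply_one (Subgroup.mul_mem _ ha (J.expL_mem_coneAut y)), Units.val_mul, det_mul, abs_mul,
    Real.log_mul (abs_ne_zero.2 (det_ne_zero _)) (abs_ne_zero.2 (det_ne_zero _))]
  ring

theorem exp_apply_of_eigenvector {X : V →L[ℝ] V} {v : V} {μ : ℝ} (h : X v = μ • v) :
    NormedSpace.exp X v = Real.exp μ • v := by
  have hp : ∀ k : ℕ, (X ^ k) v = μ ^ k • v := by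
    intro k
    induction k with
    | zero => simp
    | succ k ih => rw [pow_succ', mul_apply_eq_comp, ih, map_smul, h, smul_smul, pow_succ]
  have h1 := (NormedSpace.exp_series_hasSum_exp' (𝕂 := ℝ) X).mapL
    (ContinuousLinearMap.apply ℝ V v)
  refine h1.unique ?_
  have h2 := (NormedSpace.exp_series_hasSum_exp' (𝕂 := ℝ) μ).smul_const v
  rw [← Real.exp_eq_exp_ℝ] at h2
  simpa [smul_smul, hp] using h2

theorem log_abs_det_exp (y : V) : Real.log |(NormedSpace.exp (J.L y)).det| =
    LinearMap.trace ℝ V (J.L y : V →ₗ[ℝ] V) := by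
  classical
  have hT : (J.L y : V →ₗ[ℝ] V).IsSymmetric := fun x z => J.inner_mul y x z
  set b := (hT.eigenvectorBasis rfl).toBasis with hb
  set μ := hT.eigenvalues rfl with hμ
  have hTb : ∀ i, J.L y (b i) = μ i • b i := fun i => by
    rw [hb, OrthonormalBasis.coe_toBasis]
    exact hT.apply_eigenvectorBasis rfl i
  have h1 : LinearMap.toMatrix b b (J.L y : V →ₗ[ℝ] V) = Matrix.diagonal μ := by
    ext i j
    rw [LinearMap.toMatrix_apply, ContinuousLinearMap.coe_coe, hTb, map_smul, b.repr_self]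
    simp [Matrix.diagonal_apply, Finsupp.single_apply, eq_comm]
    aesop
  have h2 : LinearMap.toMatrix b b (NormedSpace.exp (J.L y) : V →L[ℝ] V).toLinearMap =
      Matrix.diagonal fun i => Real.exp (μ i) := by
    ext i j
    rw [LinearMap.toMatrix_apply, ContinuousLinearMap.coe_coe, exp_apply_of_eigenvector (hTb j),
      map_smul, b.repr_self]
    simp [Matrix.diagonal_apply, Finsupp.single_apply, eq_comm]
    aesop
  rw [ContinuousLinearMap.det, ← LinearMap.det_toMatrix b, h2, Matrix.det_diagonal,
    LinearMap.trace_eq_matrix_trace ℝ b, h1, Matrix.trace_diagonal, ← Real.exp_sum, Real.abs_exp,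
    Real.log_exp]

theorem contDiff_expOne : ContDiff ℝ ∞ J.expOne := by
  have h1 : ContDiff ℝ ∞ (NormedSpace.exp : (V →L[ℝ] V) → V →L[ℝ] V) :=
    contDiff_iff_contDiffAt.2 fun X => (NormedSpace.exp_analytic (𝕂 := ℝ) X).contDiffAt
  exact (ContinuousLinearMap.apply ℝ V J.one).contDiff.comp (h1.comp J.L.contDiff)

/-- To first order `exp (L y) e` is `e + L y e = e + y`, so `expOne` is a chart at the unit. -/
theorem hasFDerivAt_expOne_zero : HasFDerivAt J.expOne (ContinuousLinearMap.id ℝ V) 0 := by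
  have h1 : HasFDerivAt (NormedSpace.exp : (V →L[ℝ] V) → V →L[ℝ] V)
      (1 : (V →L[ℝ] V) →L[ℝ] V →L[ℝ] V) (J.L 0) := by
    rw [map_zero]
    exact hasFDerivAt_exp_zero (𝕂 := ℝ) (𝔸 := V →L[ℝ] V)
  have h2 := (ContinuousLinearMap.apply ℝ V J.one).hasFDerivAt.comp 0
    (h1.comp 0 J.L.hasFDerivAt)
  convert! h2 using 1
  ext v
  simp [J.mul_one]

/-- In the exponential chart the potential is linear. All its derivatives at the unit are computed
from this formula. -/
theorem pot_expOne {κ : ℝ} (hκ : ∀ y, LinearMap.trace ℝ V (J.L y : V →ₗ[ℝ] V) =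
    κ * inner ℝ J.one y) (y : V) : J.pot (J.expOne y) = -(κ * inner ℝ J.one y) := by
  rw [← hκ, ← J.log_abs_det_exp]
  exact pot_apply_one (J.expL_mem_coneAut y)

end Potential

end EuclideanJordan

/-! ### Hessian structures -/

section Hessian

variable {V : Type*} [NormedAddCommGroup V] [NormedSpace ℝ V]

/-- The data `g = D²ψ`, `A = D³ψ`, `X ∘ Y = g⁻¹ A(X, Y)` of a potential `ψ`. -/
noncomputable def hessianData (ψ : V → ℝ) : PreFrobeniusData V where
  g := fderiv ℝ (fderiv ℝ ψ)
  A := fderiv ℝ (fderiv ℝ (fderiv ℝ ψ))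
  pot := ψ
  mul x := (ContinuousLinearMap.compL ℝ V (V →L[ℝ] ℝ) V
    (fderiv ℝ (fderiv ℝ ψ) x).inverse).comp (fderiv ℝ (fderiv ℝ (fderiv ℝ ψ)) x)

/-- `ContinuousLinearMap.inverse` is zero on non-invertible maps, so invertibility must be supplied;
it follows from injectivity by counting dimensions. -/
theorem apply_inverse_of_injective {V : Type*} [NormedAddCommGroup V] [NormedSpace ℝ V]
    [FiniteDimensional ℝ V] (B : V →L[ℝ] V →L[ℝ] ℝ) (hB : Function.Injective B)
    (φ : V →L[ℝ] ℝ) : B (B.inverse φ) = φ := by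
  have hdim : Module.finrank ℝ V = Module.finrank ℝ (V →L[ℝ] ℝ) := by
    rw [← (LinearMap.toContinuousLinearMap (𝕜 := ℝ) (E := V) (F' := ℝ)).finrank_eq]
    exact Subspace.dual_finrank_eq.symm
  set e := (LinearMap.linearEquivOfInjective (B : V →ₗ[ℝ] V →L[ℝ] ℝ) hB
    hdim).toContinuousLinearEquiv with he
  have h : B = (e : V →L[ℝ] V →L[ℝ] ℝ) := by
    ext1 v
    rfl
  rw [h, ContinuousLinearMap.inverse_equiv]
  exact e.apply_symm_apply φ

section

variable {D : Set V} {ψ : V → ℝ} (hD : IsOpen D) (hψ : ContDiffOn ℝ ∞ ψ D)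
include hD hψ

theorem contDiffOn_fderiv_pot : ContDiffOn ℝ ∞ (fderiv ℝ ψ) D :=
  hψ.fderiv_of_isOpen hD (m := ∞) (by simp)

theorem contDiffOn_hess : ContDiffOn ℝ ∞ (fderiv ℝ (fderiv ℝ ψ)) D :=
  (contDiffOn_fderiv_pot hD hψ).fderiv_of_isOpen hD (m := ∞) (by simp)

theorem hess_symm {x : V} (hx : x ∈ D) (u v : V) :
    fderiv ℝ (fderiv ℝ ψ) x u v = fderiv ℝ (fderiv ℝ ψ) x v u :=
  ((hψ.contDiffAt (hD.mem_nhds hx)).isSymmSndFDerivAt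
    (minSmoothness_of_isRCLikeNormedField.trans_le
      (WithTop.coe_le_coe.2 (le_top : (2 : ℕ∞) ≤ ⊤)))).eq u v

theorem third_symm_left {x : V} (hx : x ∈ D) (u v : V) :
    fderiv ℝ (fderiv ℝ (fderiv ℝ ψ)) x u v = fderiv ℝ (fderiv ℝ (fderiv ℝ ψ)) x v u :=
  (((contDiffOn_fderiv_pot hD hψ).contDiffAt (hD.mem_nhds hx)).isSymmSndFDerivAt
    (minSmoothness_of_isRCLikeNormedField.trans_le
      (WithTop.coe_le_coe.2 (le_top : (2 : ℕ∞) ≤ ⊤)))).eq u v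

theorem hasFDerivAt_hess_apply {x : V} (hx : x ∈ D) (v w : V) :
    HasFDerivAt (fun x => fderiv ℝ (fderiv ℝ ψ) x v w)
      (((fderiv ℝ (fderiv ℝ (fderiv ℝ ψ)) x).flip v).flip w) x := by
  have h1 : DifferentiableAt ℝ (fderiv ℝ (fderiv ℝ ψ)) x :=
    ((contDiffOn_hess hD hψ).contDiffAt (hD.mem_nhds hx)).differentiableAt (by simp)
  have h2 := (h1.hasFDerivAt.clm_apply (hasFDerivAt_const v x)).clm_apply (hasFDerivAt_const w x)
  convert! h2 using 1
  ext u
  simp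

/-- Obtained by differentiating the symmetry of the Hessian. Together with `third_symm_left` it
yields full symmetry of the third derivative. -/
theorem third_symm_right {x : V} (hx : x ∈ D) (u v w : V) :
    fderiv ℝ (fderiv ℝ (fderiv ℝ ψ)) x u v w = fderiv ℝ (fderiv ℝ (fderiv ℝ ψ)) x u w v := by
  have h1 := hasFDerivAt_hess_apply hD hψ hx v w
  have h2 := hasFDerivAt_hess_apply hD hψ hx w v
  have h3 := h1.congr_of_eventuallyEq (f₁ := fun x => fderiv ℝ (fderiv ℝ ψ) x w v) (by
    filter_upwards [hD.mem_nhds hx] with y hy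
    exact hess_symm hD hψ hy w v)
  exact congrArg (fun T : V →L[ℝ] ℝ => T u) (h3.unique h2)

/-- For a Hessian metric only non-degeneracy is a condition; the rest is the symmetry of the second
and third derivatives of `ψ`. -/
theorem isPotentialPreFrobenius_hessianData [FiniteDimensional ℝ V]
    (hnd : ∀ x ∈ D, ∀ u, (∀ v, fderiv ℝ (fderiv ℝ ψ) x u v = 0) → u = 0) :
    IsPotentialPreFrobenius D (hessianData ψ) := by
  have hmul : ∀ x ∈ D, ∀ u v w, (hessianData ψ).g x ((hessianData ψ).mul x u v) w =
      (hessianData ψ).A x u v w := by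
    intro x hx u v w
    have h1 : Function.Injective (fderiv ℝ (fderiv ℝ ψ) x) :=
      (injective_iff_map_eq_zero _).2 fun u hu => hnd x hx u fun v => by rw [hu]; rfl
    exact congrArg (fun φ : V →L[ℝ] ℝ => φ w) (apply_inverse_of_injective _ h1 _)
  exact
    { isOpen := hD
      smooth_g := contDiffOn_hess hD hψ
      g_symm := fun x hx => hess_symm hD hψ hx
      g_nondegenerate := hnd
      nabla_g_symm := fun x hx u v w =>
        congrArg (fun φ : V →L[ℝ] ℝ => φ w) (third_symm_left hD hψ hx u v)
      smooth_pot := hψ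
      A_symm := fun x hx u v w =>
        ⟨congrArg (fun φ : V →L[ℝ] ℝ => φ w) (third_symm_left hD hψ hx u v),
          third_symm_right hD hψ hx u v w⟩
      A_eq := fun x hx u v w => by
        rw [iteratedFDeriv_succ_apply_right, iteratedFDeriv_two_apply]
        rfl
      g_mul_left := hmul
      g_mul_right := fun x hx u v w => by
        have h1 := hess_symm hD hψ hx u ((hessianData ψ).mul x v w)
        have h2 := hmul x hx v w u
        have h3 := third_symm_right hD hψ hx v w u
        have h4 := congrArg (fun φ : V →L[ℝ] ℝ => φ w) (third_symm_left hD hψ hx u v)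
        exact (h1.trans h2).trans (h3.trans h4.symm) }

end

/-- The Hessian of the restriction of a potential to a subspace. -/
theorem hess_comp_subtype {D : Set V} {ψ : V → ℝ} (hD : IsOpen D) (hψ : ContDiffOn ℝ ∞ ψ D)
    (W : Submodule ℝ V) {w : W} (hw : (w : V) ∈ D) (u v : W) :
    fderiv ℝ (fderiv ℝ fun w : W => ψ w) w u v = fderiv ℝ (fderiv ℝ ψ) w u v := by
  have h1 : ∀ w : W, (w : V) ∈ D →
      fderiv ℝ (fun w : W => ψ w) w = (fderiv ℝ ψ w).comp W.subtypeL := fun w hw =>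
    (((hψ.contDiffAt (hD.mem_nhds hw)).differentiableAt (by simp)).hasFDerivAt.comp w
      W.subtypeL.hasFDerivAt).fderiv
  have h2 : fderiv ℝ (fun w : W => ψ w) =ᶠ[𝓝 w] fun w => (fderiv ℝ ψ w).comp W.subtypeL := by
    filter_upwards [(hD.preimage W.subtypeL.continuous).mem_nhds hw] with y hy
    exact h1 y hy
  have h3 := (((ContinuousLinearMap.compL ℝ W V ℝ).flip W.subtypeL).hasFDerivAt.comp (w : V)
    (((contDiffOn_fderiv_pot hD hψ).contDiffAt (hD.mem_nhds hw)).differentiableAt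
      (by simp)).hasFDerivAt).comp w W.subtypeL.hasFDerivAt
  rw [(h3.congr_of_eventuallyEq h2).fderiv]
  rfl

theorem third_comp_subtype {D : Set V} {ψ : V → ℝ} (hD : IsOpen D) (hψ : ContDiffOn ℝ ∞ ψ D)
    (W : Submodule ℝ V) {w : W} (hw : (w : V) ∈ D) (u v z : W) :
    fderiv ℝ (fderiv ℝ (fderiv ℝ fun w : W => ψ w)) w u v z =
      fderiv ℝ (fderiv ℝ (fderiv ℝ ψ)) w u v z := by
  have hD' := hD.preimage W.subtypeL.continuous
  have hψ' : ContDiffOn ℝ ∞ (fun w : W => ψ w) (W.subtypeL ⁻¹' D) :=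
    hψ.comp W.subtypeL.contDiff.contDiffOn fun w hw => hw
  have h1 := hasFDerivAt_hess_apply hD' hψ' hw v z
  have h2 := (hasFDerivAt_hess_apply hD hψ hw v z).comp w W.subtypeL.hasFDerivAt
  have h3 := h1.congr_of_eventuallyEq
    (f₁ := (fun x : V => fderiv ℝ (fderiv ℝ ψ) x v z) ∘ W.subtypeL) (by
      filter_upwards [hD'.mem_nhds hw] with y hy
      exact (hess_comp_subtype hD hψ W hy v z).symm)
  exact congrArg (fun T : W →L[ℝ] ℝ => T u) (h3.unique h2)

end Hessian

namespace EuclideanJordan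

/-! ### The Hessian metric on the cone and the Jordan inverse -/

section Metric

variable {V : Type*} [NormedAddCommGroup V] [InnerProductSpace ℝ V]
  (J : EuclideanJordan V)

/-- The trace form of `J` is `κ` times the inner product, with `κ` positive. -/
def IsTraceConst (κ : ℝ) : Prop :=
  0 < κ ∧ ∀ y, LinearMap.trace ℝ V (J.L y : V →ₗ[ℝ] V) = κ * inner ℝ J.one y

variable [FiniteDimensional ℝ V] {J} {κ : ℝ}

/-- Near the unit `expOne` has a smooth local inverse, and in terms of it the potential is a linear
function. -/
theorem contDiffAt_pot_one (hκ : J.IsTraceConst κ) : ContDiffAt ℝ ∞ J.pot J.one := by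
  have hf : ContDiffAt ℝ ∞ J.expOne 0 := J.contDiff_expOne.contDiffAt
  have hf' : HasFDerivAt J.expOne ((ContinuousLinearEquiv.refl ℝ V : V ≃L[ℝ] V) : V →L[ℝ] V) 0 :=
    J.hasFDerivAt_expOne_zero
  have h1 := hf.to_localInverse hf' (by simp)
  have h2 := (hf.hasStrictFDerivAt' hf' (by simp)).eventually_right_inverse
  rw [J.expOne_zero] at h1 h2
  have h3 : ContDiffAt ℝ ∞ (fun x => -(κ * inner ℝ J.one (hf.localInverse hf' (by simp) x)))
      J.one := (contDiffAt_const.mul (contDiffAt_const.inner ℝ h1)).neg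
  refine h3.congr_of_eventuallyEq ?_
  filter_upwards [h2] with x hx
  conv_lhs => rw [← hx]
  exact J.pot_expOne hκ.2 _

theorem pot_eventuallyEq {a : (V →L[ℝ] V)ˣ} (ha : a ∈ coneAut J.cone) {x : V}
    (hx : x ∈ J.cone) : (fun x => J.pot ((a : V →L[ℝ] V) x)) =ᶠ[𝓝 x]
      fun x => J.pot x - Real.log |(a : V →L[ℝ] V).det| := by
  filter_upwards [J.isOpen_cone.mem_nhds hx] with y hy
  exact pot_apply ha hy

/-- Smoothness is carried from the unit to `a e` by `a⁻¹`, which changes the potential only by a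
constant. -/
theorem contDiffOn_pot (hκ : J.IsTraceConst κ) : ContDiffOn ℝ ∞ J.pot J.cone := by
  intro x hx
  refine ContDiffAt.contDiffWithinAt ?_
  obtain ⟨y, rfl⟩ := J.exists_coneAutZero_apply_one hx
  have ha := Subgroup.inv_mem _ (J.expL_mem_coneAut y)
  have h1 := pot_eventuallyEq ha hx
  set a := J.expL y
  have h2 : ContDiffAt ℝ ∞ (fun x => J.pot (((a⁻¹ : (V →L[ℝ] V)ˣ) : V →L[ℝ] V) x))
      ((a : V →L[ℝ] V) J.one) := by
    have h3 : ContDiffAt ℝ ∞ J.pot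
        (((a⁻¹ : (V →L[ℝ] V)ˣ) : V →L[ℝ] V) ((a : V →L[ℝ] V) J.one)) := by
      rw [inv_apply_apply]
      exact contDiffAt_pot_one hκ
    exact h3.comp ((a : V →L[ℝ] V) J.one)
      ((a⁻¹ : (V →L[ℝ] V)ˣ) : V →L[ℝ] V).contDiff.contDiffAt
  have h3 := (h2.congr_of_eventuallyEq h1.symm).add
    (contDiffAt_const (c := Real.log |((a⁻¹ : (V →L[ℝ] V)ˣ) : V →L[ℝ] V).det|))
  simpa using h3

theorem differentiableAt_pot (hκ : J.IsTraceConst κ) {x : V} (hx : x ∈ J.cone) :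
    DifferentiableAt ℝ J.pot x :=
  ((contDiffOn_pot hκ).contDiffAt (J.isOpen_cone.mem_nhds hx)).differentiableAt (by simp)

theorem hasFDerivAt_fderiv_pot_apply (hκ : J.IsTraceConst κ) {x : V} (hx : x ∈ J.cone) (v : V) :
    HasFDerivAt (fun x => fderiv ℝ J.pot x v) ((fderiv ℝ (fderiv ℝ J.pot) x).flip v) x := by
  have h1 : DifferentiableAt ℝ (fderiv ℝ J.pot) x :=
    ((contDiffOn_fderiv_pot J.isOpen_cone (contDiffOn_pot hκ)).contDiffAt
      (J.isOpen_cone.mem_nhds hx)).differentiableAt (by simp)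
  have h2 := h1.hasFDerivAt.clm_apply (hasFDerivAt_const v x)
  convert! h2 using 1
  ext u
  simp

/-- The constant `log |det a|` disappears on differentiation; differentiating once more gives the
invariance of the metric. -/
theorem fderiv_pot_apply (hκ : J.IsTraceConst κ) {a : (V →L[ℝ] V)ˣ} (ha : a ∈ coneAut J.cone)
    {x : V} (hx : x ∈ J.cone) (v : V) :
    fderiv ℝ J.pot ((a : V →L[ℝ] V) x) ((a : V →L[ℝ] V) v) = fderiv ℝ J.pot x v := by
  have h1 := (differentiableAt_pot hκ (apply_mem_cone ha hx)).hasFDerivAt.comp x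
    (a : V →L[ℝ] V).hasFDerivAt
  have h2 := (differentiableAt_pot hκ hx).hasFDerivAt.sub_const
    (Real.log |(a : V →L[ℝ] V).det|)
  have h3 := h2.congr_of_eventuallyEq (pot_eventuallyEq ha hx)
  exact congrArg (fun T : V →L[ℝ] ℝ => T v) (h1.unique h3)

theorem hess_pot_apply (hκ : J.IsTraceConst κ) {a : (V →L[ℝ] V)ˣ} (ha : a ∈ coneAut J.cone)
    {x : V} (hx : x ∈ J.cone) (u v : V) :
    fderiv ℝ (fderiv ℝ J.pot) ((a : V →L[ℝ] V) x) ((a : V →L[ℝ] V) u) ((a : V →L[ℝ] V) v) =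
      fderiv ℝ (fderiv ℝ J.pot) x u v := by
  have h1 := (hasFDerivAt_fderiv_pot_apply hκ (apply_mem_cone ha hx)
    ((a : V →L[ℝ] V) v)).comp x (a : V →L[ℝ] V).hasFDerivAt
  have h2 := (hasFDerivAt_fderiv_pot_apply hκ hx v).congr_of_eventuallyEq
    (f₁ := (fun x => fderiv ℝ J.pot x ((a : V →L[ℝ] V) v)) ∘ (a : V →L[ℝ] V)) (by
      filter_upwards [J.isOpen_cone.mem_nhds hx] with y hy
      exact fderiv_pot_apply hκ ha hy v)
  exact congrArg (fun T : V →L[ℝ] ℝ => T u) (h1.unique h2)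

theorem fderiv_pot_one (hκ : J.IsTraceConst κ) (v : V) :
    fderiv ℝ J.pot J.one v = -(κ * inner ℝ J.one v) := by
  have h0 := (differentiableAt_pot hκ J.one_mem_cone).hasFDerivAt
  rw [← J.expOne_zero] at h0
  have h1 := h0.comp (0 : V) J.hasFDerivAt_expOne_zero
  have h2 : HasFDerivAt (fun y => -(κ * inner ℝ J.one y)) (-(κ • innerSL ℝ J.one)) (0 : V) :=
    ((innerSL ℝ J.one).hasFDerivAt.const_mul κ).neg
  have h3 := h2.congr_of_eventuallyEq (f₁ := J.pot ∘ J.expOne)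
    (Filter.Eventually.of_forall fun y => J.pot_expOne hκ.2 y)
  have h4 := congrArg (fun T : V →L[ℝ] ℝ => T v) (h1.unique h3)
  rw [J.expOne_zero] at h4
  simpa using h4

variable (J) in
theorem inner_exp_L (y u v : V) :
    inner ℝ (NormedSpace.exp (J.L y) u) v = inner ℝ u (NormedSpace.exp (J.L y) v) := by
  have h1 : star (J.L y) = J.L y := by
    rw [ContinuousLinearMap.star_eq_adjoint, eq_comm, ContinuousLinearMap.eq_adjoint_iff]
    exact fun u v => J.inner_mul y u v
  have h2 : star (NormedSpace.exp (J.L y)) = NormedSpace.exp (J.L y) := by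
    let : NormedAlgebra ℚ (V →L[ℝ] V) := .restrictScalars ℚ ℝ _
    rw [NormedSpace.star_exp, h1]
  conv_lhs => rw [← h2]
  rw [ContinuousLinearMap.star_eq_adjoint, ContinuousLinearMap.adjoint_inner_left]

variable (J) in
theorem expOne_mem_cone (y : V) : J.expOne y ∈ J.cone := J.exp_L_one_mem_cone y

/-- Invariance under `exp (L y)` moves the derivative to the unit, and self-adjointness moves `exp
(-L y)` onto `e`. So the gradient at `x` is `-κ x⁻¹`. -/
theorem fderiv_pot_expOne (hκ : J.IsTraceConst κ) (y v : V) :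
    fderiv ℝ J.pot (J.expOne y) v = -(κ * inner ℝ (J.expOne (-y)) v) := by
  have h1 := fderiv_pot_apply hκ (J.expL_mem_coneAut y) J.one_mem_cone
    ((((J.expL y)⁻¹ : (V →L[ℝ] V)ˣ) : V →L[ℝ] V) v)
  rw [apply_inv_apply, fderiv_pot_one hκ] at h1
  have h2 : (((J.expL y)⁻¹ : (V →L[ℝ] V)ˣ) : V →L[ℝ] V) = NormedSpace.exp (J.L (-y)) := by
    rw [map_neg]; rfl
  rw [h2, ← inner_exp_L] at h1
  exact h1

/-- Differentiate the gradient formula along the exponential chart: `y ↦ expOne (-y)` has derivative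
`-id` at `0`. -/
theorem hess_pot_one (hκ : J.IsTraceConst κ) (u v : V) :
    fderiv ℝ (fderiv ℝ J.pot) J.one u v = κ * inner ℝ u v := by
  have h0 := hasFDerivAt_fderiv_pot_apply hκ J.one_mem_cone v
  rw [← J.expOne_zero] at h0
  have h1 := h0.comp (0 : V) J.hasFDerivAt_expOne_zero
  have h2 : HasFDerivAt (fun y => J.expOne (-y)) (-ContinuousLinearMap.id ℝ V) 0 := by
    have h3 : HasFDerivAt (fun y : V => -y) (-ContinuousLinearMap.id ℝ V) 0 :=
      (hasFDerivAt_id 0).neg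
    have h4 := J.hasFDerivAt_expOne_zero
    rw [← neg_zero] at h4
    have h5 := h4.comp (0 : V) h3
    exact h5
  have h3 := ((h2.inner ℝ (hasFDerivAt_const v (0 : V))).const_mul κ).neg
  have h4 := h3.congr_of_eventuallyEq (f₁ := (fun x => fderiv ℝ J.pot x v) ∘ J.expOne)
    (Filter.Eventually.of_forall fun y => fderiv_pot_expOne hκ y v)
  have h5 := congrArg (fun T : V →L[ℝ] ℝ => T u) (h1.unique h4)
  rw [J.expOne_zero] at h5
  simpa using h5

theorem hess_pot_pos (hκ : J.IsTraceConst κ) {x : V} (hx : x ∈ J.cone) {u : V} (hu : u ≠ 0) :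
    0 < fderiv ℝ (fderiv ℝ J.pot) x u u := by
  obtain ⟨y, rfl⟩ := J.exists_coneAutZero_apply_one hx
  rw [← apply_inv_apply (J.expL y) u, hess_pot_apply hκ (J.expL_mem_coneAut y) J.one_mem_cone,
    hess_pot_one hκ, real_inner_self_eq_norm_sq]
  have h1 : (((J.expL y)⁻¹ : (V →L[ℝ] V)ˣ) : V →L[ℝ] V) u ≠ 0 := by
    intro h
    apply hu
    rw [← apply_inv_apply (J.expL y) u, h, map_zero]
  have := hκ.1
  positivity

theorem isPotentialPreFrobenius_pot (hκ : J.IsTraceConst κ) :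
    IsPotentialPreFrobenius J.cone (hessianData J.pot) := by
  refine isPotentialPreFrobenius_hessianData J.isOpen_cone (contDiffOn_pot hκ) ?_
  intro x hx u hu
  by_contra h
  exact (hess_pot_pos hκ hx h).ne' (hu u)

/-- The inverse `x⁻¹ = -κ⁻¹ grad ψ(x)`. -/
noncomputable def jinv (J : EuclideanJordan V) (κ : ℝ) (x : V) : V :=
  (-κ⁻¹) • (InnerProductSpace.toDual ℝ V).symm (fderiv ℝ J.pot x)

theorem inner_jinv (x v : V) : inner ℝ (J.jinv κ x) v = -κ⁻¹ * fderiv ℝ J.pot x v := by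
  rw [jinv, real_inner_smul_left, InnerProductSpace.toDual_symm_apply]

theorem jinv_expOne (hκ : J.IsTraceConst κ) (y : V) :
    J.jinv κ (J.expOne y) = J.expOne (-y) := by
  refine ext_inner_right ℝ fun v => ?_
  rw [inner_jinv, fderiv_pot_expOne hκ]
  field_simp [hκ.1.ne']

theorem contDiffOn_jinv (hκ : J.IsTraceConst κ) : ContDiffOn ℝ ∞ (J.jinv κ) J.cone :=
  ((InnerProductSpace.toDual ℝ V).symm.contDiff.comp_contDiffOn
    (contDiffOn_fderiv_pot J.isOpen_cone (contDiffOn_pot hκ))).const_smul _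

theorem exists_expOne {x : V} (hx : x ∈ J.cone) : ∃ y, x = J.expOne y := by
  obtain ⟨y, hy⟩ := J.exists_exp_L_one hx
  exact ⟨y, hy.symm⟩

theorem jinv_mem (hκ : J.IsTraceConst κ) {x : V} (hx : x ∈ J.cone) : J.jinv κ x ∈ J.cone := by
  obtain ⟨y, rfl⟩ := exists_expOne hx
  rw [jinv_expOne hκ]
  exact J.expOne_mem_cone _

theorem jinv_jinv (hκ : J.IsTraceConst κ) {x : V} (hx : x ∈ J.cone) :
    J.jinv κ (J.jinv κ x) = x := by
  obtain ⟨y, rfl⟩ := exists_expOne hx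
  rw [jinv_expOne hκ, jinv_expOne hκ, neg_neg]

theorem eq_one_of_jinv_eq (hκ : J.IsTraceConst κ) {x : V} (hx : x ∈ J.cone)
    (h : J.jinv κ x = x) : x = J.one := by
  obtain ⟨y, rfl⟩ := exists_expOne hx
  rw [jinv_expOne hκ] at h
  rw [J.eq_zero_of_exp_eq_exp_neg h.symm, J.expOne_zero]

/-- Equivalently `(a x)⁻¹ = (a†)⁻¹ x⁻¹`: inversion intertwines `a` with its contragredient. -/
theorem inner_jinv_apply (hκ : J.IsTraceConst κ) {a : (V →L[ℝ] V)ˣ} (ha : a ∈ coneAut J.cone)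
    {x : V} (hx : x ∈ J.cone) (v : V) :
    inner ℝ (J.jinv κ ((a : V →L[ℝ] V) x)) ((a : V →L[ℝ] V) v) = inner ℝ (J.jinv κ x) v := by
  rw [inner_jinv, inner_jinv, fderiv_pot_apply hκ ha hx]

end Metric

end EuclideanJordan

/-! ### The symmetric space -/

theorem IsIsometryOn.comp {V : Type*} [NormedAddCommGroup V] [NormedSpace ℝ V] {D : Set V}
    {g : V → V →L[ℝ] V →L[ℝ] ℝ} {s t : V → V} (hD : IsOpen D) (hs : IsIsometryOn D g s)
    (ht : IsIsometryOn D g t) : IsIsometryOn D g (s ∘ t) where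
  bijOn := hs.bijOn.comp ht.bijOn
  smooth := hs.smooth.comp ht.smooth ht.bijOn.mapsTo
  isometry x hx u v := by
    have h1 := ((hs.smooth.contDiffAt (hD.mem_nhds (ht.bijOn.mapsTo hx))).differentiableAt
      (by simp)).hasFDerivAt.comp x
      ((ht.smooth.contDiffAt (hD.mem_nhds hx)).differentiableAt (by simp)).hasFDerivAt
    rw [h1.fderiv, ← ht.isometry x hx u v, ← hs.isometry _ (ht.bijOn.mapsTo hx)]
    rfl

namespace EuclideanJordan

section Symmetric

variable {V : Type*} [NormedAddCommGroup V] [InnerProductSpace ℝ V] [FiniteDimensional ℝ V]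
  {J : EuclideanJordan V} {κ : ℝ}

theorem isIsometryOn_of_mem_coneAut (hκ : J.IsTraceConst κ) {a : (V →L[ℝ] V)ˣ}
    (ha : a ∈ coneAut J.cone) :
    IsIsometryOn J.cone (hessianData J.pot).g (a : V →L[ℝ] V) where
  bijOn := by
    refine ⟨fun x hx => apply_mem_cone ha hx, fun x _ y _ h => ?_, ?_⟩
    · rw [← inv_apply_apply a x, ← inv_apply_apply a y]
      exact congrArg _ h
    · have h : (fun x => (a : V →L[ℝ] V) x) '' J.cone = J.cone := ha
      exact h.ge
  smooth := (a : V →L[ℝ] V).contDiff.contDiffOn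
  isometry x hx u v := by
    rw [ContinuousLinearMap.fderiv]
    exact hess_pot_apply hκ ha hx u v

theorem hasFDerivAt_jinv (hκ : J.IsTraceConst κ) {x : V} (hx : x ∈ J.cone) (u v : V) :
    inner ℝ (fderiv ℝ (J.jinv κ) x u) v = -κ⁻¹ * fderiv ℝ (fderiv ℝ J.pot) x u v := by
  have h1 := (((contDiffOn_jinv hκ).contDiffAt (J.isOpen_cone.mem_nhds hx)).differentiableAt
    (by simp)).hasFDerivAt.inner ℝ (hasFDerivAt_const v x)
  have h2 := (hasFDerivAt_fderiv_pot_apply hκ hx v).const_mul (-κ⁻¹)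
  have h3 := h2.congr_of_eventuallyEq (f₁ := fun x => inner ℝ (J.jinv κ x) v)
    (Filter.Eventually.of_forall fun x => inner_jinv x v)
  have h4 := congrArg (fun T : V →L[ℝ] ℝ => T u) (h1.unique h3)
  simpa using h4

theorem inner_expL (y u v : V) : inner ℝ ((J.expL y : V →L[ℝ] V) u) v =
    inner ℝ u ((J.expL y : V →L[ℝ] V) v) := J.inner_exp_L y u v

theorem expL_neg (y : V) : J.expL (-y) = (J.expL y)⁻¹ := by
  apply Units.ext
  change NormedSpace.exp (J.L (-y)) = NormedSpace.exp (-J.L y)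
  rw [map_neg]

theorem isIsometryOn_jinv (hκ : J.IsTraceConst κ) :
    IsIsometryOn J.cone (hessianData J.pot).g (J.jinv κ) where
  bijOn := by
    have h : Set.InvOn (J.jinv κ) (J.jinv κ) J.cone J.cone :=
      ⟨fun x hx => jinv_jinv hκ hx, fun x hx => jinv_jinv hκ hx⟩
    exact h.bijOn (fun x hx => jinv_mem hκ hx) (fun x hx => jinv_mem hκ hx)
  smooth := contDiffOn_jinv hκ
  isometry x hx u v := by
    obtain ⟨y, rfl⟩ := J.exists_coneAutZero_apply_one hx
    -- After translating source and target to the unit by `exp (L y)` and `exp (-L y)`, the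
    -- differential of inversion is `-id`, which preserves the inner product.
    have h1 : ∀ u, fderiv ℝ (J.jinv κ) ((J.expL y : V →L[ℝ] V) J.one)
        ((J.expL y : V →L[ℝ] V) u) = -((J.expL (-y) : V →L[ℝ] V) u) := by
      intro u
      refine ext_inner_right ℝ fun v => ?_
      rw [hasFDerivAt_jinv hκ hx, ← apply_inv_apply (J.expL y) v,
        hess_pot_apply hκ (J.expL_mem_coneAut y) J.one_mem_cone, hess_pot_one hκ, inner_neg_left,
        inner_expL, expL_neg, inv_apply_apply]
      field_simp [hκ.1.ne']
    have h2 : J.jinv κ ((J.expL y : V →L[ℝ] V) J.one) = (J.expL (-y) : V →L[ℝ] V) J.one :=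
      jinv_expOne hκ y
    change fderiv ℝ (fderiv ℝ J.pot) _ _ _ = fderiv ℝ (fderiv ℝ J.pot) _ _ _
    rw [← apply_inv_apply (J.expL y) u, ← apply_inv_apply (J.expL y) v, h1, h1, h2, map_neg,
      map_neg, neg_apply, neg_neg,
      hess_pot_apply hκ (J.expL_mem_coneAut _) J.one_mem_cone,
      hess_pot_apply hκ (J.expL_mem_coneAut _) J.one_mem_cone]

theorem jinv_one (hκ : J.IsTraceConst κ) : J.jinv κ J.one = J.one := by
  have h := jinv_expOne hκ 0
  rwa [neg_zero, J.expOne_zero] at h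

theorem isRiemannianSymmetricSpace (hκ : J.IsTraceConst κ) :
    IsRiemannianSymmetricSpace J.cone (hessianData J.pot).g where
  isOpen := J.isOpen_cone
  isConnected := J.convex_cone.isConnected ⟨_, J.one_mem_cone⟩
  smooth := (isPotentialPreFrobenius_pot hκ).smooth_g
  symm := (isPotentialPreFrobenius_pot hκ).g_symm
  pos x hx u hu := hess_pot_pos hκ hx hu
  exists_symmetry p hp := by
    obtain ⟨y, rfl⟩ := J.exists_coneAutZero_apply_one hp
    have ha := J.expL_mem_coneAut y
    have ha' := Subgroup.inv_mem _ ha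
    -- The symmetry at `p = a e` is inversion conjugated by `a`. Its fixed point is unique in the
    -- whole cone, so the neighbourhood can be everything.
    refine ⟨(J.expL y : V →L[ℝ] V) ∘ J.jinv κ ∘ (((J.expL y)⁻¹ : (V →L[ℝ] V)ˣ) : V →L[ℝ] V),
      (isIsometryOn_of_mem_coneAut hκ ha).comp J.isOpen_cone
        ((isIsometryOn_jinv hκ).comp J.isOpen_cone (isIsometryOn_of_mem_coneAut hκ ha')),
      fun x hx => ?_, ?_, Set.univ, Filter.univ_mem, fun x hx h => ?_⟩
    · simp only [Function.comp_apply, inv_apply_apply]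
      rw [jinv_jinv hκ (apply_mem_cone ha' hx), apply_inv_apply]
    · simp only [Function.comp_apply, inv_apply_apply, jinv_one hκ]
    · simp only [Function.comp_apply] at h
      have h1 := congrArg (((J.expL y)⁻¹ : (V →L[ℝ] V)ˣ) : V →L[ℝ] V) h
      rw [inv_apply_apply] at h1
      rw [← apply_inv_apply (J.expL y) x, eq_one_of_jinv_eq hκ (apply_mem_cone ha' hx.2) h1]

end Symmetric

/-! ### The automorphism group, its stabilizer and the Cartan involution -/

section Group

variable {V : Type*} [NormedAddCommGroup V] [InnerProductSpace ℝ V]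
  {J : EuclideanJordan V}

variable (J) in
theorem not_isCompact_cone [Nontrivial V] : ¬ IsCompact J.cone := by
  intro h
  have h0 : J.one ≠ 0 := by
    intro h0
    obtain ⟨v, hv⟩ := exists_ne (0 : V)
    apply hv
    rw [← J.one_mul v, h0, map_zero, zero_apply]
  obtain ⟨R, hR⟩ := h.isBounded.exists_norm_le
  have hR0 : 0 ≤ R := (norm_nonneg _).trans (hR _ J.one_mem_cone)
  have h1 : 0 < ‖J.one‖ := norm_pos_iff.2 h0
  have h2 := hR _ (J.smul_mem_cone (r := (R + 1) / ‖J.one‖) (by positivity) J.one_mem_cone)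
  rw [norm_smul, Real.norm_of_nonneg (by positivity), div_mul_cancel₀ _ h1.ne'] at h2
  linarith

theorem coneAutZero_le {D : Set V} : coneAutZero D ≤ coneAut D := by
  rintro _ ⟨b, _, rfl⟩
  exact b.2

theorem coe_coneAutZero (D : Set V) : (coneAutZero D : Set (V →L[ℝ] V)ˣ) =
    Subtype.val '' connectedComponent (1 : coneAut D) := rfl

theorem isConnected_coneAutZero (D : Set V) :
    IsConnected (coneAutZero D : Set (V →L[ℝ] V)ˣ) := by
  rw [coe_coneAutZero]
  exact isConnected_connectedComponent.image _ continuous_subtype_val.continuousOn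

theorem apply_mem_nonnegCone {a : (V →L[ℝ] V)ˣ} (ha : a ∈ coneAut J.cone) {x : V}
    (hx : x ∈ J.nonnegCone) : (a : V →L[ℝ] V) x ∈ J.nonnegCone := by
  have h1 : Filter.Tendsto (fun ε : ℝ => (a : V →L[ℝ] V) (x + ε • J.one)) (𝓝[>] 0)
      (𝓝 ((a : V →L[ℝ] V) x)) := by
    have h3 : Continuous fun ε : ℝ => (a : V →L[ℝ] V) (x + ε • J.one) := by fun_prop
    have h4 := h3.tendsto 0
    simp only [zero_smul, add_zero] at h4
    exact h4.mono_left nhdsWithin_le_nhds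
  refine J.isClosed_nonnegCone.mem_of_tendsto h1 ?_
  filter_upwards [self_mem_nhdsWithin] with ε hε
  exact J.cone_subset_nonnegCone
    (apply_mem_cone ha (J.add_mem_cone hx (J.smul_mem_cone hε J.one_mem_cone)))

theorem mem_coneAut_of_mapsTo {a : (V →L[ℝ] V)ˣ}
    (h1 : ∀ x ∈ J.cone, (a : V →L[ℝ] V) x ∈ J.cone)
    (h2 : ∀ x ∈ J.cone, ((a⁻¹ : (V →L[ℝ] V)ˣ) : V →L[ℝ] V) x ∈ J.cone) : a ∈ coneAut J.cone := by
  refine Set.Subset.antisymm ?_ fun x hx => ⟨_, h2 x hx, apply_inv_apply a x⟩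
  rintro _ ⟨x, hx, rfl⟩
  exact h1 x hx

variable [FiniteDimensional ℝ V]

/-- Subtract a small multiple of `a⁻¹ e` inside the cone; its image `δ e` puts the total back into
the interior. -/
theorem apply_mem_cone_of_nonneg {a : (V →L[ℝ] V)ˣ}
    (h : ∀ x ∈ J.nonnegCone, (a : V →L[ℝ] V) x ∈ J.nonnegCone) {x : V} (hx : x ∈ J.cone) :
    (a : V →L[ℝ] V) x ∈ J.cone := by
  obtain ⟨δ, hδ, hm⟩ := J.exists_sub_smul_mem_cone hx
    (((a⁻¹ : (V →L[ℝ] V)ˣ) : V →L[ℝ] V) J.one)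
  have h1 := J.add_mem_cone (h _ (J.cone_subset_nonnegCone hm))
    (J.smul_mem_cone hδ J.one_mem_cone)
  simpa [apply_inv_apply] using h1

variable (J) in
-- Membership is rephrased as `a` and `a⁻¹` preserving the closed cone, which is a closed condition
-- at each point.
theorem isClosed_coneAut : IsClosed (coneAut J.cone : Set (V →L[ℝ] V)ˣ) := by
  have h1 : (coneAut J.cone : Set (V →L[ℝ] V)ˣ) =
      {a : (V →L[ℝ] V)ˣ | ∀ x ∈ J.nonnegCone, (a : V →L[ℝ] V) x ∈ J.nonnegCone ∧
        ((a⁻¹ : (V →L[ℝ] V)ˣ) : V →L[ℝ] V) x ∈ J.nonnegCone} := by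
    ext a
    constructor
    · exact fun ha x hx => ⟨apply_mem_nonnegCone ha hx,
        apply_mem_nonnegCone (Subgroup.inv_mem _ ha) hx⟩
    · exact fun h => mem_coneAut_of_mapsTo
        (fun x hx => apply_mem_cone_of_nonneg (fun x hx => (h x hx).1) hx)
        (fun x hx => apply_mem_cone_of_nonneg (fun x hx => (h x hx).2) hx)
  rw [h1]
  have h2 : ∀ x : V, Continuous fun a : (V →L[ℝ] V)ˣ => (a : V →L[ℝ] V) x := fun x =>
    (ContinuousLinearMap.apply ℝ V x).continuous.comp Units.continuous_val
  have h3 : ∀ x : V, IsClosed {a : (V →L[ℝ] V)ˣ | (a : V →L[ℝ] V) x ∈ J.nonnegCone ∧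
      ((a⁻¹ : (V →L[ℝ] V)ˣ) : V →L[ℝ] V) x ∈ J.nonnegCone} := fun x =>
    (J.isClosed_nonnegCone.preimage (h2 x)).inter
      (J.isClosed_nonnegCone.preimage ((h2 x).comp continuous_inv))
  simp only [Set.ofPred_forall]
  exact isClosed_iInter fun x => isClosed_iInter fun _ => h3 x

variable (J) in
theorem isClosed_coneAutZero : IsClosed (coneAutZero J.cone : Set (V →L[ℝ] V)ˣ) := by
  rw [coe_coneAutZero]
  exact (isClosed_coneAut J).isClosedEmbedding_subtypeVal.isClosedMap _ isClosed_connectedComponent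

theorem isCompact_stabilizer : IsCompact {a : (V →L[ℝ] V)ˣ | a ∈ coneAutZero J.cone ∧
    (a : V →L[ℝ] V) J.one = J.one} := by
  obtain ⟨R, hR⟩ := exists_norm_le_of_stabilizer (J := J)
  have hK := (isCompact_closedBall (0 : V →L[ℝ] V) R).prod
    ((isCompact_closedBall (0 : V →L[ℝ] V) R).image MulOpposite.continuous_op)
  -- The topology of the unit group is that of pairs `(a, a⁻¹)`, so both components must be bounded;
  -- the stabilizer bound applies to each.
  refine (Units.isClosedEmbedding_embedProduct.isCompact_preimage hK).of_isClosed_subset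
    ((isClosed_coneAutZero J).inter (isClosed_eq
      ((ContinuousLinearMap.apply ℝ V J.one).continuous.comp Units.continuous_val)
      continuous_const)) ?_
  rintro a ⟨ha, hae⟩
  have ha' := coneAutZero_le ha
  refine ⟨by simpa using hR a ha' hae, _, ?_, rfl⟩
  simpa using hR a⁻¹ (Subgroup.inv_mem _ ha') (by
    conv_lhs => rw [← hae]
    exact inv_apply_apply a _)

theorem inner_star_apply (a : (V →L[ℝ] V)ˣ) (x y : V) :
    inner ℝ (((star a : (V →L[ℝ] V)ˣ) : V →L[ℝ] V) x) y = inner ℝ x ((a : V →L[ℝ] V) y) := by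
  rw [Units.coe_star, ContinuousLinearMap.star_eq_adjoint, ContinuousLinearMap.adjoint_inner_left]

/-- Self-duality of the cone: `⟨a† x, y⟩ = ⟨x, a y⟩` is positive for nonzero `y` in the closed cone.
-/
theorem star_apply_mem_cone {a : (V →L[ℝ] V)ˣ} (ha : a ∈ coneAut J.cone) {x : V}
    (hx : x ∈ J.cone) : ((star a : (V →L[ℝ] V)ˣ) : V →L[ℝ] V) x ∈ J.cone := by
  rw [mem_cone_iff_inner]
  intro y hy hy0
  rw [inner_star_apply]
  refine J.inner_pos hx (apply_mem_nonnegCone ha hy) fun h => hy0 ?_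
  rw [← inv_apply_apply a y, h, map_zero]

/-- The contragredient `a ↦ (a†)⁻¹`. -/
noncomputable def contragredient : (V →L[ℝ] V)ˣ →* (V →L[ℝ] V)ˣ where
  toFun a := (star a)⁻¹
  map_one' := by simp
  map_mul' a b := by simp

theorem contragredient_contragredient (a : (V →L[ℝ] V)ˣ) :
    contragredient (contragredient a) = a := by
  change (star (star a)⁻¹)⁻¹ = a
  simp

theorem continuous_contragredient :
    Continuous (contragredient : (V →L[ℝ] V)ˣ → (V →L[ℝ] V)ˣ) := by
  rw [Units.continuous_iff]
  exact ⟨continuous_star.comp (Units.continuous_val.comp continuous_inv),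
    continuous_star.comp Units.continuous_val⟩

theorem contragredient_mem_coneAut {a : (V →L[ℝ] V)ˣ} (ha : a ∈ coneAut J.cone) :
    contragredient a ∈ coneAut J.cone := by
  refine Subgroup.inv_mem _ (mem_coneAut_of_mapsTo (fun x hx => star_apply_mem_cone ha hx)
    fun x hx => ?_)
  have := star_apply_mem_cone (Subgroup.inv_mem _ ha) hx
  rwa [star_inv] at this

theorem contragredient_mem_coneAutZero {a : (V →L[ℝ] V)ˣ} (ha : a ∈ coneAutZero J.cone) :
    contragredient a ∈ coneAutZero J.cone := by
  obtain ⟨b, hb, rfl⟩ := ha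
  set f : coneAut J.cone → coneAut J.cone :=
    fun b => ⟨contragredient (b : (V →L[ℝ] V)ˣ), contragredient_mem_coneAut b.2⟩ with hf
  have hfc : Continuous f := (continuous_contragredient.comp continuous_subtype_val).subtype_mk _
  have h1 : f 1 = 1 := Subtype.ext (map_one contragredient)
  have h2 := hfc.image_connectedComponent_subset 1
  rw [h1] at h2
  exact ⟨f b, h2 ⟨b, hb, rfl⟩, rfl⟩

variable (J) in
/-- The Cartan involution `a ↦ (a†)⁻¹`. -/
noncomputable def cartan : coneAutZero J.cone ≃* coneAutZero J.cone where
  toFun a := ⟨contragredient (a : (V →L[ℝ] V)ˣ), contragredient_mem_coneAutZero a.2⟩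
  invFun a := ⟨contragredient (a : (V →L[ℝ] V)ˣ), contragredient_mem_coneAutZero a.2⟩
  left_inv _ := Subtype.ext (contragredient_contragredient _)
  right_inv _ := Subtype.ext (contragredient_contragredient _)
  map_mul' _ _ := Subtype.ext (map_mul contragredient _ _)

theorem contragredient_eq_self_iff (a : (V →L[ℝ] V)ˣ) : contragredient a = a ↔
    ∀ u v, inner ℝ ((a : V →L[ℝ] V) u) ((a : V →L[ℝ] V) v) = inner ℝ u v := by
  constructor
  · intro h u v
    rw [← inner_star_apply]
    have h1 : star a * a = 1 := inv_eq_iff_mul_eq_one.1 h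
    rw [← mul_apply_eq_comp, ← Units.val_mul, h1]
    rfl
  · intro h
    change (star a)⁻¹ = a
    rw [inv_eq_iff_mul_eq_one]
    apply Units.ext
    ext u
    refine ext_inner_right ℝ fun v => ?_
    rw [Units.val_mul, mul_apply_eq_comp, inner_star_apply, h]
    rfl

theorem isSymmetricPair {κ : ℝ} (hκ : J.IsTraceConst κ) :
    IsSymmetricPair (coneAutZero J.cone) J.cartan
    J.cone (hessianData J.pot).g J.one where
  isClosed := isClosed_coneAutZero J
  isConnected := isConnected_coneAutZero _
  base_mem := J.one_mem_cone
  isometry a ha := isIsometryOn_of_mem_coneAut hκ (coneAutZero_le ha)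
  transitive x hx := by
    obtain ⟨y, rfl⟩ := J.exists_coneAutZero_apply_one hx
    exact ⟨_, J.expL_mem_coneAutZero y, rfl⟩
  isCompact_stabilizer := isCompact_stabilizer
  continuous_inv := (continuous_contragredient.comp continuous_subtype_val).subtype_mk _
  involutive a := J.cartan.left_inv a
  -- An automorphism fixing `e` preserves the metric there, which is `κ ⟨·, ·⟩`; so it is
  -- orthogonal, that is fixed by the involution.
  stabilizer_le a hae := by
    refine Subtype.ext ((contragredient_eq_self_iff _).2 fun u v => ?_)
    have h1 := hess_pot_apply hκ (coneAutZero_le a.2) J.one_mem_cone u v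
    rw [hae, hess_pot_one hκ, hess_pot_one hκ] at h1
    exact mul_left_cancel₀ hκ.1.ne' h1
  -- An orthogonal cone automorphism commutes with inversion, so `a e` is a fixed point of inversion
  -- and equals `e`. The argument uses only `σ a = a`, not the component.
  le_stabilizer a ha := by
    have h1 : a ∈ {a | J.cartan a = a} := connectedComponentIn_subset _ _ ha
    have h2 := (contragredient_eq_self_iff _).1 (congrArg Subtype.val h1)
    have ha' := coneAutZero_le a.2
    refine eq_one_of_jinv_eq hκ (apply_mem_cone ha' J.one_mem_cone)
      (ext_inner_right ℝ fun v => ?_)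
    rw [← apply_inv_apply (a : (V →L[ℝ] V)ˣ) v, inner_jinv_apply hκ ha' J.one_mem_cone,
      jinv_one hκ, h2]

end Group

end EuclideanJordan

namespace EuclideanJordan

/-! ### The Frobenius locus of a frame -/

section Tangent

variable {V : Type*} [NormedAddCommGroup V] [InnerProductSpace ℝ V] [FiniteDimensional ℝ V]
  {J : EuclideanJordan V}

theorem L_mem_tangentPart (y : V) : J.L y ∈ tangentPart (coneAutZero J.cone) J.cartan := by
  intro t
  refine ⟨⟨J.expL (t • y), J.expL_mem_coneAutZero _⟩, ?_, ?_⟩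
  · change NormedSpace.exp (J.L (t • y)) = _
    rw [map_smul]
  · have h1 : star (J.expL (t • y)) = J.expL (t • y) := by
      apply Units.ext
      ext u
      exact ext_inner_right ℝ fun v => by rw [inner_star_apply, inner_expL]
    change (((star (J.expL (t • y)))⁻¹ : (V →L[ℝ] V)ˣ) : V →L[ℝ] V) = _
    rw [h1]
    change NormedSpace.exp (-J.L (t • y)) = _
    rw [map_smul]

/-- Differentiate `⟨exp (tY) u, exp (-tY) v⟩ = ⟨u, v⟩` at `t = 0`. -/
theorem isSymmetric_of_mem_tangentPart {Y : V →L[ℝ] V}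
    (hY : Y ∈ tangentPart (coneAutZero J.cone) J.cartan) (u v : V) :
    inner ℝ (Y u) v = inner ℝ u (Y v) := by
  have h1 : ∀ t : ℝ, inner ℝ (NormedSpace.exp (t • Y) u) (NormedSpace.exp (t • -Y) v) =
      inner ℝ u v := by
    intro t
    obtain ⟨a, ha, hσ⟩ := hY t
    rw [smul_neg, ← ha, ← hσ]
    change inner ℝ _ ((((star (a : (V →L[ℝ] V)ˣ))⁻¹ : (V →L[ℝ] V)ˣ) : V →L[ℝ] V) v) = _
    rw [real_inner_comm, ← inner_star_apply, apply_inv_apply, real_inner_comm]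
  have h2 := (hasDerivAt_exp_smul_apply Y u 0).inner ℝ (hasDerivAt_exp_smul_apply (-Y) v 0)
  simp only [h1] at h2
  have h3 := h2.unique (hasDerivAt_const (0 : ℝ) (inner ℝ u v))
  simp only [zero_smul, NormedSpace.exp_zero, one_apply_eq_self, neg_apply,
    inner_neg_right] at h3
  linarith

/-- Since `exp (tY)` preserves the closed cone for `t` of either sign, `⟨exp (tY) c, d⟩` has a
minimum at `t = 0`. -/
theorem inner_eq_zero_of_mem_tangentPart {Y : V →L[ℝ] V}
    (hY : Y ∈ tangentPart (coneAutZero J.cone) J.cartan) {c d : V} (hc : c ∈ J.nonnegCone)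
    (hd : d ∈ J.nonnegCone) (hcd : inner ℝ c d = 0) : inner ℝ (Y c) d = 0 := by
  have h1 := (hasDerivAt_exp_smul_apply Y c 0).inner ℝ (hasDerivAt_const (0 : ℝ) d)
  have h2 : IsLocalMin (fun t : ℝ => inner ℝ (NormedSpace.exp (t • Y) c) d) 0 := by
    refine Filter.Eventually.of_forall fun t => ?_
    obtain ⟨a, ha, -⟩ := hY t
    simp only [zero_smul, NormedSpace.exp_zero, one_apply_eq_self, hcd]
    rw [← ha]
    exact J.inner_nonneg (apply_mem_nonnegCone (coneAutZero_le a.2) hc) hd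
  have h3 := h2.hasDerivAt_eq_zero h1
  simpa using h3

theorem IsFrame.mem_nonnegCone {ι : Type*} {s : Finset ι} {c : ι → V} (h : J.IsFrame s c) {i : ι}
    (hi : i ∈ s) : c i ∈ J.nonnegCone := by
  rw [← h.mul_self i hi]
  exact J.sq_mem_nonnegCone _

/-- The tangent part of the Lie algebra consists of the multiplication operators. -/
theorem eq_L_of_mem_tangentPart {Y : V →L[ℝ] V}
    (hY : Y ∈ tangentPart (coneAutZero J.cone) J.cartan) : Y = J.L (Y J.one) := by
  have hsymm : ((Y - J.L (Y J.one) : V →L[ℝ] V) : V →ₗ[ℝ] V).IsSymmetric := by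
    intro u v
    simp only [ContinuousLinearMap.coe_coe, sub_apply, inner_sub_left, inner_sub_right]
    rw [isSymmetric_of_mem_tangentPart hY, J.inner_mul]
  -- The quadratic form of `Y - L (Y e)` is shown to vanish. On a frame for `x` the off-diagonal
  -- terms of `Y` are zero, and then `⟨Y c_r, c_r⟩ = ⟨Y c_r, e⟩ = ⟨Y e, c_r⟩`.
  have h0 := hsymm.inner_map_self_eq_zero.1 fun x => by
    obtain ⟨s, c, h, rfl⟩ := J.exists_isFrame x
    have hz : ∀ r ∈ s, ∀ t ∈ s, r ≠ t → inner ℝ (Y (c r)) (c t) = 0 := fun r hr t ht hrt =>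
      inner_eq_zero_of_mem_tangentPart hY (h.mem_nonnegCone hr) (h.mem_nonnegCone ht)
        (h.inner_eq_zero hr ht hrt)
    have hd : ∀ r ∈ s, inner ℝ (Y (c r)) (c r) = inner ℝ (Y J.one) (c r) := by
      intro r hr
      rw [isSymmetric_of_mem_tangentPart hY J.one, real_inner_comm _ J.one, ← h.sum_one,
        inner_sum, Finset.sum_eq_single r]
      · exact fun t ht htr => hz r hr t ht htr.symm
      · exact fun h' => absurd hr h'
    have h1 : inner ℝ (Y (∑ r ∈ s, r • c r)) (∑ r ∈ s, r • c r) =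
        ∑ r ∈ s, r * r * inner ℝ (Y J.one) (c r) := by
      rw [map_sum, sum_inner]
      refine Finset.sum_congr rfl fun r hr => ?_
      rw [inner_sum, Finset.sum_eq_single r]
      · rw [map_smul, real_inner_smul_left, real_inner_smul_right, hd r hr, mul_assoc]
      · intro t ht htr
        rw [map_smul, real_inner_smul_left, real_inner_smul_right, hz r hr t ht htr.symm]
        simp
      · exact fun h' => absurd hr h'
    have h2 : inner ℝ (J.L (Y J.one) (∑ r ∈ s, r • c r)) (∑ r ∈ s, r • c r) =
        ∑ r ∈ s, r * r * inner ℝ (Y J.one) (c r) := by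
      rw [J.comm, J.inner_mul, h.mul_sum, inner_sum]
      simp only [real_inner_smul_right]
    rw [ContinuousLinearMap.coe_coe, sub_apply, inner_sub_left, h1, h2, sub_self]
  ext v
  have h1 := congrArg (fun T : V →ₗ[ℝ] V => T v) h0
  simpa [sub_eq_zero] using h1

end Tangent

/-! ### The product and the geometry on the span of a frame -/

section Locus

variable {V : Type*} [NormedAddCommGroup V] [InnerProductSpace ℝ V]
  {J : EuclideanJordan V} {κ : ℝ} {ι : Type*} [Fintype ι] {c : ι → V}

/-- In the linearised Jordan identity for `c i, c j, c j` only the commutator of `L (c i)` with `L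
(c j)` survives. -/
theorem IsFrame.L_comm (h : J.IsFrame Finset.univ c) (i j : ι) (y : V) :
    J.L (c i) (J.L (c j) y) = J.L (c j) (J.L (c i) y) := by
  by_cases hij : i = j
  · rw [hij]
  have h1 := J.jordan_linear (c i) (c j) (c j) y
  rw [h.mul_self j (Finset.mem_univ _), h.mul_of_ne i (Finset.mem_univ _) j (Finset.mem_univ _) hij,
    h.mul_of_ne j (Finset.mem_univ _) i (Finset.mem_univ _) (Ne.symm hij)] at h1
  simpa [sub_eq_zero] using h1

theorem IsFrame.lie_L (h : J.IsFrame Finset.univ c) (a b : ι → ℝ) :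
    ⁅J.L (∑ i, a i • c i), J.L (∑ i, b i • c i)⁆ = 0 := by
  rw [Ring.lie_def, sub_eq_zero]
  ext y
  simp only [mul_apply_eq_comp, map_sum, map_smul, sum_apply, smul_apply, Finset.smul_sum,
    h.L_comm, smul_smul]
  rw [Finset.sum_comm]
  simp only [h.L_comm, mul_comm]

theorem hasDerivAt_line (r a : ι → ℝ) :
    HasDerivAt (fun t : ℝ => ∑ i, (r i + t * a i) • c i) (∑ i, a i • c i) 0 := by
  refine HasDerivAt.fun_sum fun i _ => ?_
  have h1 := (((hasDerivAt_id (0 : ℝ)).mul_const (a i)).const_add (r i)).smul_const (c i)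
  simpa using h1

theorem IsFrame.mem_cone (h : J.IsFrame Finset.univ c) {r : ι → ℝ} (hr : ∀ i, 0 < r i) :
    ∑ i, r i • c i ∈ J.cone := (h.sum_mem_cone_iff r).2 fun i _ _ => hr i

variable [FiniteDimensional ℝ V]

theorem IsFrame.expOne_sum (h : J.IsFrame Finset.univ c) (f : ι → ℝ) :
    J.expOne (∑ i, f i • c i) = ∑ i, Real.exp (f i) • c i := h.exp_apply f

theorem IsFrame.fderiv_pot (h : J.IsFrame Finset.univ c) (hκ : J.IsTraceConst κ) {r : ι → ℝ}
    (hr : ∀ i, 0 < r i) (z : V) : fderiv ℝ J.pot (∑ i, r i • c i) z =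
      -(κ * ∑ i, (r i)⁻¹ * inner ℝ (c i) z) := by
  have h1 : ∑ i, r i • c i = J.expOne (∑ i, Real.log (r i) • c i) := by
    rw [h.expOne_sum]
    simp only [Real.exp_log (hr _)]
  have h2 : J.expOne (-∑ i, Real.log (r i) • c i) = ∑ i, (r i)⁻¹ • c i := by
    rw [← Finset.sum_neg_distrib]
    simp only [← neg_smul]
    rw [h.expOne_sum]
    simp only [Real.exp_neg, Real.exp_log (hr _)]
  rw [h1, fderiv_pot_expOne hκ, h2, sum_inner]
  simp only [real_inner_smul_left]

theorem eventually_line_pos {r : ι → ℝ} (hr : ∀ i, 0 < r i) (a : ι → ℝ) :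
    ∀ᶠ t : ℝ in 𝓝 0, ∀ i, 0 < r i + t * a i := by
  rw [Filter.eventually_all]
  intro i
  have h1 : ContinuousAt (fun t : ℝ => r i + t * a i) 0 := by fun_prop
  exact continuousAt_const.eventually_lt (f := fun _ => (0 : ℝ)) h1 (by simpa using hr i)

/-- Differentiates `-κ ∑ r_i⁻¹ c_i` along a line in the span. The vector `z` ranges over all of `V`,
which is what later shows that products stay in the span. -/
theorem IsFrame.hess_pot (h : J.IsFrame Finset.univ c) (hκ : J.IsTraceConst κ) {r : ι → ℝ}
    (hr : ∀ i, 0 < r i) (a : ι → ℝ) (z : V) :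
    fderiv ℝ (fderiv ℝ J.pot) (∑ i, r i • c i) (∑ i, a i • c i) z =
      κ * ∑ i, a i * (r i ^ 2)⁻¹ * inner ℝ (c i) z := by
  have hγ := hasDerivAt_line (c := c) r a
  have h0 : ∑ i, (r i + 0 * a i) • c i = ∑ i, r i • c i := by simp
  have h1 := hasFDerivAt_fderiv_pot_apply hκ (h.mem_cone hr) z
  rw [← h0] at h1
  have h2 := h1.comp_hasDerivAt (0 : ℝ) hγ
  have h3 : HasDerivAt (fun t : ℝ => -(κ * ∑ i, (r i + t * a i)⁻¹ * inner ℝ (c i) z))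
      (κ * ∑ i, a i * (r i ^ 2)⁻¹ * inner ℝ (c i) z) 0 := by
    have h4 : HasDerivAt (fun t : ℝ => ∑ i, (r i + t * a i)⁻¹ * inner ℝ (c i) z)
        (∑ i, -(a i * (r i ^ 2)⁻¹ * inner ℝ (c i) z)) 0 := by
      refine HasDerivAt.fun_sum fun i _ => ?_
      have h5 := ((((hasDerivAt_id (0 : ℝ)).mul_const (a i)).const_add (r i)).inv (by
        simpa using (hr i).ne')).mul_const (inner ℝ (c i) z)
      refine h5.congr_deriv ?_
      simp
      ring
    refine (h4.const_mul κ).neg.congr_deriv ?_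
    rw [Finset.sum_neg_distrib]
    ring
  have h4 := h3.congr_of_eventuallyEq
    (f₁ := (fun x => fderiv ℝ J.pot x z) ∘ fun t : ℝ => ∑ i, (r i + t * a i) • c i) (by
      filter_upwards [eventually_line_pos hr a] with t ht
      exact h.fderiv_pot hκ ht z)
  have h5 := h2.unique h4
  rw [h0] at h5
  exact h5

theorem IsFrame.third_pot (h : J.IsFrame Finset.univ c) (hκ : J.IsTraceConst κ) {r : ι → ℝ}
    (hr : ∀ i, 0 < r i) (a b : ι → ℝ) (z : V) :
    fderiv ℝ (fderiv ℝ (fderiv ℝ J.pot)) (∑ i, r i • c i) (∑ i, a i • c i) (∑ i, b i • c i) z =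
      κ * ∑ i, -2 * a i * b i * (r i ^ 3)⁻¹ * inner ℝ (c i) z := by
  have hγ := hasDerivAt_line (c := c) r a
  have h0 : ∑ i, (r i + 0 * a i) • c i = ∑ i, r i • c i := by simp
  have h1 := hasFDerivAt_hess_apply J.isOpen_cone (contDiffOn_pot hκ) (h.mem_cone hr)
    (∑ i, b i • c i) z
  rw [← h0] at h1
  have h2 := h1.comp_hasDerivAt (0 : ℝ) hγ
  have h3 : HasDerivAt (fun t : ℝ => κ * ∑ i, b i * ((r i + t * a i) ^ 2)⁻¹ * inner ℝ (c i) z)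
      (κ * ∑ i, -2 * a i * b i * (r i ^ 3)⁻¹ * inner ℝ (c i) z) 0 := by
    refine HasDerivAt.const_mul κ (HasDerivAt.fun_sum fun i _ => ?_)
    have hri := (hr i).ne'
    have h5 := ((((((hasDerivAt_id (0 : ℝ)).mul_const (a i)).const_add (r i)).pow 2).inv (by
      simpa using hri)).const_mul (b i)).mul_const (inner ℝ (c i) z)
    refine h5.congr_deriv ?_
    simp
    field_simp
  have h4 := h3.congr_of_eventuallyEq
    (f₁ := (fun x => fderiv ℝ (fderiv ℝ J.pot) x (∑ i, b i • c i) z) ∘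
      fun t : ℝ => ∑ i, (r i + t * a i) • c i) (by
      filter_upwards [eventually_line_pos hr a] with t ht
      exact h.hess_pot hκ ht b z)
  have h5 := h2.unique h4
  rw [h0] at h5
  exact h5

/-- Both sides have the same pairing with every `z` under the metric: `A` contributes `-2 a_i b_i /
r_i³` and `g` contributes `1 / r_i²`. -/
theorem IsFrame.mul_pot (h : J.IsFrame Finset.univ c) (hκ : J.IsTraceConst κ) {r : ι → ℝ}
    (hr : ∀ i, 0 < r i) (a b : ι → ℝ) :
    (hessianData J.pot).mul (∑ i, r i • c i) (∑ i, a i • c i) (∑ i, b i • c i) =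
      ∑ i, (-2 * a i * b i * (r i)⁻¹) • c i := by
  have hS := isPotentialPreFrobenius_pot hκ
  rw [← sub_eq_zero]
  refine hS.g_nondegenerate _ (h.mem_cone hr) _ fun z => ?_
  rw [map_sub, sub_apply, hS.g_mul_left _ (h.mem_cone hr), sub_eq_zero]
  refine (h.third_pot hκ hr a b z).trans ((h.hess_pot hκ hr _ z).trans ?_).symm
  congr 1
  refine Finset.sum_congr rfl fun i _ => ?_
  have := (hr i).ne'
  field_simp

theorem IsFrame.isFrobeniusLocus (h : J.IsFrame Finset.univ c) (hc : ∀ i, c i ≠ 0)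
    (hκ : J.IsTraceConst κ) : IsFrobeniusLocus J.cone (hessianData J.pot)
      ((fun X : V →L[ℝ] V => NormedSpace.exp X J.one) ''
        ((Submodule.span ℝ (Set.range c)).map (J.L : V →ₗ[ℝ] V →L[ℝ] V))) := by
  set W := Submodule.span ℝ (Set.range c) with hW
  set ψ : W → ℝ := fun w => J.pot w with hψ
  set U : Set W := W.subtypeL ⁻¹' J.cone with hU
  have hS := isPotentialPreFrobenius_pot hκ
  have hUo : IsOpen U := J.isOpen_cone.preimage W.subtypeL.continuous
  have hψs : ContDiffOn ℝ ∞ ψ U :=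
    (contDiffOn_pot hκ).comp W.subtypeL.contDiff.contDiffOn fun w hw => hw
  have hrep : ∀ w ∈ W, ∃ f : ι → ℝ, w = ∑ i, f i • c i := fun w hw => by
    obtain ⟨f, hf⟩ := (Submodule.mem_span_range_iff_exists_fun ℝ).1 hw
    exact ⟨f, hf.symm⟩
  have hmem : ∀ f : ι → ℝ, ∑ i, f i • c i ∈ W := fun f =>
    (Submodule.mem_span_range_iff_exists_fun ℝ).2 ⟨f, rfl⟩
  have hrepU : ∀ w ∈ U, ∃ f : ι → ℝ, (∀ i, 0 < f i) ∧ (w : V) = ∑ i, f i • c i := by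
    intro w hw
    obtain ⟨f, hf⟩ := hrep w w.2
    refine ⟨f, fun i => ?_, hf⟩
    have hw' : (w : V) ∈ J.cone := hw
    rw [hf] at hw'
    exact (h.sum_mem_cone_iff f).1 hw' i (Finset.mem_univ _) (hc i)
  -- Non-degeneracy need not pass to a subspace, but positive definiteness does.
  have hS' : IsPotentialPreFrobenius U (hessianData ψ) := by
    refine isPotentialPreFrobenius_hessianData hUo hψs fun w hw u hu => ?_
    by_contra hu0
    have h1 := hess_pot_pos hκ (x := (w : V)) hw (u := (u : V)) (by simpa using hu0)
    rw [← hess_comp_subtype J.isOpen_cone (contDiffOn_pot hκ) W hw, hu] at h1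
    exact lt_irrefl _ h1
  have hmulW : ∀ w ∈ U, ∀ u v : W, (hessianData J.pot).mul w u v ∈ W := by
    intro w hw u v
    obtain ⟨r, hr, hwr⟩ := hrepU w hw
    obtain ⟨a, ha⟩ := hrep u u.2
    obtain ⟨b, hb⟩ := hrep v v.2
    rw [hwr, ha, hb, h.mul_pot hκ hr]
    exact hmem _
  have hmul : ∀ w ∈ U, ∀ u v : W,
      ((hessianData ψ).mul w u v : V) = (hessianData J.pot).mul w u v := by
    intro w hw u v
    have h1 : (hessianData ψ).mul w u v - ⟨_, hmulW w hw u v⟩ = 0 := by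
      refine hS'.g_nondegenerate w hw _ fun z => ?_
      rw [map_sub, sub_apply, hS'.g_mul_left w hw, sub_eq_zero]
      refine (third_comp_subtype J.isOpen_cone (contDiffOn_pot hκ) W hw u v z).trans ?_
      refine Eq.trans ?_ (hess_comp_subtype J.isOpen_cone (contDiffOn_pot hκ) W hw _ z).symm
      exact (hS.g_mul_left w hw u v z).symm
    exact congrArg Subtype.val (sub_eq_zero.1 h1)
  -- The exponential acts on coordinates, so the locus is the open positive orthant of `W`, and the
  -- affine subspace passes through `0`.
  have hF : ((fun X : V →L[ℝ] V => NormedSpace.exp X J.one) ''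
      (W.map (J.L : V →ₗ[ℝ] V →L[ℝ] V))) = (fun w : W => (0 : V) + (w : V)) '' U := by
    ext x
    constructor
    · rintro ⟨_, ⟨w, hw, rfl⟩, rfl⟩
      obtain ⟨f, rfl⟩ := hrep w hw
      refine ⟨⟨∑ i, Real.exp (f i) • c i, hmem _⟩, h.mem_cone fun i => Real.exp_pos _, ?_⟩
      simp only [zero_add]
      exact (h.exp_apply f).symm
    · rintro ⟨w, hw, rfl⟩
      obtain ⟨f, hf, hwf⟩ := hrepU w hw
      refine ⟨_, ⟨∑ i, Real.log (f i) • c i, hmem _, rfl⟩, ?_⟩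
      simp only [zero_add]
      refine (h.exp_apply _).trans ?_
      simp only [hwf, Real.exp_log (hf _)]
  refine ⟨⟨_, _, zero_mem _, rfl⟩, ?_, 0, W, U, hessianData ψ, hF, ⟨hS', ?_⟩, ?_, ?_⟩
  · rw [hF]
    rintro _ ⟨w, hw, rfl⟩
    change (0 : V) + w ∈ J.cone
    rw [zero_add]
    exact hw
  · intro w hw u v z
    apply Subtype.ext
    rw [hmul w hw, hmul w hw, hmul w hw, hmul w hw]
    obtain ⟨r, hr, hwr⟩ := hrepU w hw
    obtain ⟨a, ha⟩ := hrep u u.2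
    obtain ⟨b, hb⟩ := hrep v v.2
    obtain ⟨d, hd⟩ := hrep z z.2
    simp only [hwr, ha, hb, hd, h.mul_pot hκ hr]
    refine Finset.sum_congr rfl fun i _ => ?_
    congr 1
    ring
  · intro w hw
    simp only [zero_add]
    exact ⟨rfl, fun u v => hess_comp_subtype J.isOpen_cone (contDiffOn_pot hκ) W hw u v,
      fun u v z => third_comp_subtype J.isOpen_cone (contDiffOn_pot hκ) W hw u v z, hmul w hw⟩
  · intro w hw u v k hk
    simp only [zero_add] at hk
    -- The three derivatives of `g` in the Koszul formula are values of the symmetric tensor `A`;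
    -- two of them cancel.
    have h1 : k = (1 / 2 : ℝ) • (hessianData J.pot).mul w u v := by
      rw [← sub_eq_zero]
      refine hS.g_nondegenerate w hw _ fun z => ?_
      have h2 : fderiv ℝ (hessianData J.pot).g w u v z = (hessianData J.pot).A w u v z := rfl
      have h3 : fderiv ℝ (hessianData J.pot).g w v u z = (hessianData J.pot).A w v u z := rfl
      have h4 : fderiv ℝ (hessianData J.pot).g w z u v = (hessianData J.pot).A w z u v := rfl
      have h5 := hk z
      have h6 := hS.A_symm w hw u v z
      have h7 := hS.A_symm w hw z u v
      have h8 := hS.A_symm w hw u z v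
      rw [h2, h3, h4] at h5
      rw [map_sub, map_smul, sub_apply, smul_apply, hS.g_mul_left w hw, smul_eq_mul]
      linarith
    rw [h1]
    exact W.smul_mem _ (hmulW w hw u v)

end Locus

/-- The main theorem for a Euclidean Jordan algebra with a frame whose span is a maximal abelian
subspace. -/
theorem exists_frobenius {V : Type*} [NormedAddCommGroup V] [InnerProductSpace ℝ V]
    [FiniteDimensional ℝ V] [Nontrivial V] (J : EuclideanJordan V) {κ : ℝ} (hκ : J.IsTraceConst κ)
    {ι : Type*} [Fintype ι] {c : ι → V} (h : J.IsFrame Finset.univ c) (hc : ∀ i, c i ≠ 0)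
    (hmax : ∀ y, (∀ i, J.L (c i) (J.L y (c i)) = J.L y (c i)) →
      y ∈ Submodule.span ℝ (Set.range c)) :
    ∃ (S : PreFrobeniusData V) (σ : coneAutZero J.cone ≃* coneAutZero J.cone),
      (IsRiemannianSymmetricSpace J.cone S.g ∧
        IsSymmetricPair (coneAutZero J.cone) σ J.cone S.g J.one ∧ ¬ IsCompact J.cone) ∧
      (IsPotentialPreFrobenius J.cone S ∧
        ∀ x ∈ J.cone, ∀ u v, S.g x u v = iteratedFDeriv ℝ 2 S.pot x ![u, v]) ∧
      ∃ 𝔞 : Submodule ℝ (V →L[ℝ] V),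
        (𝔞 : Set (V →L[ℝ] V)) ⊆ tangentPart (coneAutZero J.cone) σ ∧
        (∀ X ∈ 𝔞, ∀ Y ∈ 𝔞, ∀ Z ∈ 𝔞, ⁅⁅X, Y⁆, Z⁆ ∈ 𝔞) ∧
        (∀ X ∈ 𝔞, ∀ Y ∈ 𝔞, ⁅X, Y⁆ = 0) ∧
        (∀ Y ∈ tangentPart (coneAutZero J.cone) σ, (∀ X ∈ 𝔞, ⁅X, Y⁆ = 0) → Y ∈ 𝔞) ∧
        IsFrobeniusLocus J.cone S
          ((fun X : V →L[ℝ] V => NormedSpace.exp X J.one) '' 𝔞) := by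
  have hab : ∀ X ∈ (Submodule.span ℝ (Set.range c)).map (J.L : V →ₗ[ℝ] V →L[ℝ] V),
      ∀ Y ∈ (Submodule.span ℝ (Set.range c)).map (J.L : V →ₗ[ℝ] V →L[ℝ] V), ⁅X, Y⁆ = 0 := by
    rintro _ ⟨x, hx, rfl⟩ _ ⟨y, hy, rfl⟩
    obtain ⟨a, rfl⟩ := (Submodule.mem_span_range_iff_exists_fun ℝ).1 hx
    obtain ⟨b, rfl⟩ := (Submodule.mem_span_range_iff_exists_fun ℝ).1 hy
    exact h.lie_L a b
  refine ⟨hessianData J.pot, J.cartan, ⟨isRiemannianSymmetricSpace hκ, isSymmetricPair hκ,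
    not_isCompact_cone J⟩, ⟨isPotentialPreFrobenius_pot hκ, fun x _ u v => ?_⟩,
    (Submodule.span ℝ (Set.range c)).map (J.L : V →ₗ[ℝ] V →L[ℝ] V), ?_, ?_, hab, ?_,
    h.isFrobeniusLocus hc hκ⟩
  · rw [iteratedFDeriv_two_apply]
    rfl
  · rintro _ ⟨y, -, rfl⟩
    exact L_mem_tangentPart y
  · intro X hX Y hY Z _
    rw [hab X hX Y hY, Ring.lie_def, zero_mul, mul_zero, sub_zero]
    exact Submodule.zero_mem _
  · intro Y hY hcomm
    have h1 := eq_L_of_mem_tangentPart hY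
    refine ⟨Y J.one, hmax _ fun i => ?_, h1.symm⟩
    rw [← h1]
    -- Since `Y = L (Y e)`, commuting with `L (c i)` and evaluating at `c i` gives the hypothesis of
    -- `hmax`.
    have h2 := hcomm (J.L (c i)) ⟨c i, Submodule.subset_span ⟨i, rfl⟩, rfl⟩
    rw [Ring.lie_def, sub_eq_zero] at h2
    have h3 := congrArg (fun T : V →L[ℝ] V => T (c i)) h2
    simpa [h.mul_self i (Finset.mem_univ _)] using h3

end EuclideanJordan

/-! ### The Jordan algebra of self-adjoint matrices -/

namespace EuclideanJordan

variable {V : Type*} [NormedAddCommGroup V] [InnerProductSpace ℝ V] (J : EuclideanJordan V)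

/-- For an automorphism, `L (k x) = k (L x) k⁻¹`. -/
theorem trace_L_automorphism (k : V ≃ₗ[ℝ] V) (hk : ∀ x y, k (J.L x y) = J.L (k x) (k y)) (x : V) :
    LinearMap.trace ℝ V (J.L (k x) : V →ₗ[ℝ] V) = LinearMap.trace ℝ V (J.L x : V →ₗ[ℝ] V) := by
  rw [← LinearMap.trace_conj' (J.L x : V →ₗ[ℝ] V) k]
  congr 1
  ext y
  simp [LinearEquiv.conj_apply, hk]

/-- The Riesz vector of the trace form is fixed by isometric automorphisms. -/
theorem exists_trace_vector [FiniteDimensional ℝ V] : ∃ τ : V,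
    (∀ x, LinearMap.trace ℝ V (J.L x : V →ₗ[ℝ] V) = inner ℝ τ x) ∧
    ∀ k : V ≃ₗ[ℝ] V, (∀ x y, k (J.L x y) = J.L (k x) (k y)) →
      (∀ x y, inner ℝ (k x) (k y) = inner ℝ x y) → k τ = τ := by
  set φ : V →ₗ[ℝ] ℝ := LinearMap.trace ℝ V ∘ₗ
    (LinearMap.toContinuousLinearMap (𝕜 := ℝ) (E := V) (F' := V)).symm.toLinearMap ∘ₗ
    (J.L : V →ₗ[ℝ] V →L[ℝ] V) with hφ
  have h1 : ∀ x, LinearMap.trace ℝ V (J.L x : V →ₗ[ℝ] V) =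
      inner ℝ ((InnerProductSpace.toDual ℝ V).symm (LinearMap.toContinuousLinearMap φ)) x := by
    intro x
    rw [InnerProductSpace.toDual_symm_apply]
    rfl
  refine ⟨_, h1, fun k hk hi => ext_inner_right ℝ fun x => ?_⟩
  conv_lhs => rw [← k.apply_symm_apply x]
  rw [hi, ← h1, ← h1, ← J.trace_L_automorphism k hk, k.apply_symm_apply]

end EuclideanJordan

section Scalars

variable {K : Type} [NonAssocRing K] [StarRing K] [Module ℝ K] [HermitianScalars K]

instance HermitianScalars.smulCommClass : SMulCommClass ℝ K K where
  smul_comm r a b := by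
    change r • (a * b) = a * (r • b)
    -- The adjoint exchanges the two factors, so compatibility of scalars with the left factor gives
    -- it for the right one.
    apply star_injective
    rw [star_smul, star_mul, star_mul, star_smul, star_trivial, smul_mul_assoc]

end Scalars

namespace HermMat

noncomputable section

variable {K : Type} [NonAssocRing K] [StarRing K] [Module ℝ K] [HermitianScalars K] {n : ℕ}

theorem ext_val {x y : HermMat K n} (h : ∀ i j, x.val i j = y.val i j) : x = y :=
  val_injective (Matrix.ext h)

theorem star_val_apply (x : HermMat K n) (i j : Fin n) : star (x.val i j) = x.val j i :=
  congrFun (congrFun x.star_val j) i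

/-- The Jordan product `(x y + y x) / 2`. -/
def jmul (x y : HermMat K n) : HermMat K n := ⟨(1 / 2 : ℝ) • (x.val * y.val + y.val * x.val), by
  change star ((1 / 2 : ℝ) • (x.val * y.val + y.val * x.val)) = _
  rw [star_smul, star_add, star_mul, star_mul, star_val, star_val, add_comm, star_trivial]⟩

theorem val_jmul (x y : HermMat K n) :
    (jmul x y).val = (1 / 2 : ℝ) • (x.val * y.val + y.val * x.val) := rfl

theorem jmul_self (x : HermMat K n) : jmul x x = x.sq := by
  apply val_injective
  rw [val_jmul, ← two_smul ℝ, smul_smul]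
  norm_num
  rfl

theorem jmul_comm (x y : HermMat K n) : jmul x y = jmul y x := by
  apply val_injective
  rw [val_jmul, val_jmul, add_comm]

instance finiteDimensional [FiniteDimensional ℝ K] : FiniteDimensional ℝ (HermMat K n) :=
  FiniteDimensional.of_injective
    ({ toFun := val, map_add' := val_add, map_smul' := val_smul } :
      HermMat K n →ₗ[ℝ] Matrix (Fin n) (Fin n) K) val_injective

/-- The Jordan product as a bilinear map. -/
def jmulLin : HermMat K n →ₗ[ℝ] HermMat K n →ₗ[ℝ] HermMat K n :=
  LinearMap.mk₂ ℝ jmul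
    (fun x y z => by
      apply val_injective
      simp only [val_jmul, val_add, add_mul, mul_add]
      module)
    (fun r x y => by
      apply val_injective
      simp only [val_jmul, val_smul, smul_mul_assoc, mul_smul_comm]
      module)
    (fun x y z => by
      apply val_injective
      simp only [val_jmul, val_add, add_mul, mul_add]
      module)
    (fun r x y => by
      apply val_injective
      simp only [val_jmul, val_smul, smul_mul_assoc, mul_smul_comm]
      module)

theorem reTr_mul_assoc (hre : ∀ a b c : K, HermitianScalars.re (a * b * c) =
    HermitianScalars.re (a * (b * c))) (x y z : Matrix (Fin n) (Fin n) K) :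
    reTr (x * y * z) = reTr (x * (y * z)) := by
  rw [reTr_mul, reTr_mul]
  simp only [Matrix.mul_apply, Finset.sum_mul, Finset.mul_sum, map_sum, hre]
  refine Finset.sum_congr rfl fun i _ => ?_
  rw [Finset.sum_comm]

variable [FiniteDimensional ℝ K]

/-- The Euclidean Jordan algebra of self-adjoint matrices. -/
def euclideanJordan (hre : ∀ a b c : K, HermitianScalars.re (a * b * c) =
      HermitianScalars.re (a * (b * c)))
    (hjordan : ∀ x y : HermMat K n, jmul x (jmul (jmul x x) y) = jmul (jmul x x) (jmul x y)) :
    EuclideanJordan (HermMat K n) where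
  L := LinearMap.toContinuousLinearMap
    ((LinearMap.toContinuousLinearMap (𝕜 := ℝ) (E := HermMat K n)
      (F' := HermMat K n)).toLinearMap ∘ₗ jmulLin)
  one := 1
  comm x y := jmul_comm x y
  one_mul x := by
    change jmul 1 x = x
    apply val_injective
    rw [val_jmul, val_one, one_mul, mul_one, ← two_smul ℝ, smul_smul]
    norm_num
  inner_mul x y z := by
    change inner ℝ (jmul x y) z = inner ℝ y (jmul x z)
    rw [inner_eq, inner_eq, val_jmul, val_jmul, smul_mul_assoc, mul_smul_comm, map_smul, map_smul,
      add_mul, mul_add, map_add, map_add, reTr_mul_assoc hre, reTr_mul_assoc hre,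
      reTr_mul_comm x.val, reTr_mul_assoc hre, add_comm]
  jordan := hjordan

variable (hre : ∀ a b c : K, HermitianScalars.re (a * b * c) = HermitianScalars.re (a * (b * c)))
  (hjordan : ∀ x y : HermMat K n, jmul x (jmul (jmul x x) y) = jmul (jmul x x) (jmul x y))

theorem euclideanJordan_L (x y : HermMat K n) : (euclideanJordan hre hjordan).L x y = jmul x y :=
  rfl

theorem cone_euclideanJordan : (euclideanJordan hre hjordan).cone = posDefCone K n := by
  ext x
  change (∀ y : HermMat K n, y ≠ 0 → 0 < inner ℝ x (jmul y y)) ↔ ∀ y : HermMat K n, y ≠ 0 → _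
  simp only [jmul_self]

end

/-! ### The diagonal frame, symmetries and the trace form -/

noncomputable section

variable {K : Type} [NonAssocRing K] [StarRing K] [Module ℝ K] [HermitianScalars K] {n : ℕ}

/-- The diagonal matrix unit. -/
def unitDiag (K : Type) [NonAssocRing K] [StarRing K] [Module ℝ K] [HermitianScalars K] {n : ℕ}
    (i : Fin n) : HermMat K n := ⟨Matrix.single i i 1, by
  change star _ = _
  rw [Matrix.star_eq_conjTranspose, Matrix.conjTranspose_single, star_one]⟩

theorem val_unitDiag (i : Fin n) : (unitDiag K i).val = Matrix.single i i 1 := rfl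

theorem jmul_unitDiag_apply (y : HermMat K n) (i a b : Fin n) :
    (jmul y (unitDiag K i)).val a b =
      (1 / 2 : ℝ) • ((if b = i then y.val a b else 0) + if a = i then y.val a b else 0) := by
  rw [val_jmul, val_unitDiag, Matrix.smul_apply, Matrix.add_apply]
  congr 2
  · by_cases h : b = i
    · subst h; simp
    · simp [h]
  · by_cases h : a = i
    · subst h; simp
    · simp [h]

theorem val_sum {ι : Type*} (s : Finset ι) (f : ι → HermMat K n) :
    (∑ i ∈ s, f i).val = ∑ i ∈ s, (f i).val :=
  map_sum ({ toFun := val, map_add' := val_add, map_smul' := val_smul } :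
      HermMat K n →ₗ[ℝ] Matrix (Fin n) (Fin n) K) f s

theorem val_sum_unitDiag (r : Fin n → ℝ) :
    (∑ i, r i • unitDiag K i).val = Matrix.diagonal fun i => r i • (1 : K) := by
  rw [val_sum]
  ext a b
  rw [Matrix.sum_apply, Matrix.diagonal_apply, Finset.sum_eq_single a]
  · by_cases h : a = b <;> simp [val_smul, val_unitDiag, h]
  · intro i _ hi
    simp [val_smul, val_unitDiag, hi]
  · simp

theorem mem_span_unitDiag {y : HermMat K n} (h : ∀ i j, i ≠ j → y.val i j = 0) :
    y ∈ Submodule.span ℝ (Set.range (unitDiag K (n := n))) := by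
  refine (Submodule.mem_span_range_iff_exists_fun ℝ).2
    ⟨fun i => HermitianScalars.re (y.val i i), ext_val fun i j => ?_⟩
  rw [val_sum_unitDiag, Matrix.diagonal_apply]
  split_ifs with hij
  · subst hij
    exact (HermitianScalars.eq_re_smul_one _ (y.star_val_apply i i)).symm
  · exact (h i j hij).symm

/-- The automorphism of simultaneous permutation of rows and columns. -/
def permEquiv (π : Equiv.Perm (Fin n)) : HermMat K n ≃ₗ[ℝ] HermMat K n where
  toFun x := ⟨x.val.submatrix π π, by
    change star _ = _
    ext i j
    exact x.star_val_apply _ _⟩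
  invFun x := ⟨x.val.submatrix π.symm π.symm, by
    change star _ = _
    ext i j
    exact x.star_val_apply _ _⟩
  map_add' x y := rfl
  map_smul' r x := rfl
  left_inv x := ext_val fun i j => by
    change x.val (π (π.symm i)) (π (π.symm j)) = _
    simp
  right_inv x := ext_val fun i j => by
    change x.val (π.symm (π i)) (π.symm (π j)) = _
    simp

theorem val_permEquiv (π : Equiv.Perm (Fin n)) (x : HermMat K n) (i j : Fin n) :
    (permEquiv π x).val i j = x.val (π i) (π j) := rfl

theorem permEquiv_jmul (π : Equiv.Perm (Fin n)) (x y : HermMat K n) :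
    permEquiv π (jmul x y) = jmul (permEquiv π x) (permEquiv π y) := by
  refine ext_val fun i j => ?_
  rw [val_permEquiv, val_jmul, val_jmul]
  simp only [Matrix.smul_apply, Matrix.add_apply, Matrix.mul_apply, val_permEquiv]
  rw [← Equiv.sum_comp π, ← Equiv.sum_comp π (fun k => y.val (π i) k * x.val k (π j))]

theorem inner_permEquiv (π : Equiv.Perm (Fin n)) (x y : HermMat K n) :
    inner ℝ (permEquiv π x) (permEquiv π y) = inner ℝ x y := by
  rw [inner_eq, inner_eq, reTr_mul, reTr_mul,
    ← Equiv.sum_comp π (fun i => ∑ j, HermitianScalars.re (x.val i j * y.val j i))]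
  refine Finset.sum_congr rfl fun i _ => ?_
  rw [← Equiv.sum_comp π (fun j => HermitianScalars.re (x.val (π i) j * y.val j (π i)))]
  rfl

/-- Conjugation by a diagonal matrix of signs. -/
def signEquiv (s : Fin n → ℝ) (hs : ∀ i, s i * s i = 1) : HermMat K n ≃ₗ[ℝ] HermMat K n :=
  LinearEquiv.ofInvolutive
    { toFun := fun x => ⟨fun i j => (s i * s j) • x.val i j, by
        change star _ = _
        ext i j
        change star ((s j * s i) • x.val j i) = (s i * s j) • x.val i j
        rw [star_smul, star_trivial, x.star_val_apply, mul_comm]⟩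
      map_add' := fun x y => ext_val fun i j => smul_add _ _ _
      map_smul' := fun r x => ext_val fun i j => smul_comm _ _ _ }
    fun x => ext_val fun i j => by
      change (s i * s j) • (s i * s j) • x.val i j = _
      rw [smul_smul, mul_mul_mul_comm, hs, hs, one_mul, one_smul]

theorem val_signEquiv (s : Fin n → ℝ) (hs : ∀ i, s i * s i = 1) (x : HermMat K n) (i j : Fin n) :
    (signEquiv s hs x).val i j = (s i * s j) • x.val i j := rfl

theorem smul_mul_smul_sign {s : Fin n → ℝ} (hs : ∀ i, s i * s i = 1) (i k j : Fin n) (a b : K) :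
    ((s i * s k) • a) * ((s k * s j) • b) = (s i * s j) • (a * b) := by
  rw [smul_mul_assoc, mul_smul_comm, smul_smul]
  congr 1
  linear_combination (s i * s j) * hs k

theorem signEquiv_jmul (s : Fin n → ℝ) (hs : ∀ i, s i * s i = 1) (x y : HermMat K n) :
    signEquiv s hs (jmul x y) = jmul (signEquiv s hs x) (signEquiv s hs y) := by
  refine ext_val fun i j => ?_
  rw [val_signEquiv, val_jmul, val_jmul]
  simp only [Matrix.smul_apply, Matrix.add_apply, Matrix.mul_apply, val_signEquiv,
    smul_mul_smul_sign hs, ← Finset.smul_sum, ← smul_add]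
  rw [smul_comm]

theorem inner_signEquiv (s : Fin n → ℝ) (hs : ∀ i, s i * s i = 1) (x y : HermMat K n) :
    inner ℝ (signEquiv s hs x) (signEquiv s hs y) = inner ℝ x y := by
  rw [inner_eq, inner_eq, reTr_mul, reTr_mul]
  simp only [val_signEquiv, smul_mul_smul_sign hs, hs, one_smul]

variable [FiniteDimensional ℝ K]
  (hre : ∀ a b c : K, HermitianScalars.re (a * b * c) = HermitianScalars.re (a * (b * c)))
  (hjordan : ∀ x y : HermMat K n, jmul x (jmul (jmul x x) y) = jmul (jmul x x) (jmul x y))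

theorem isFrame_unitDiag :
    (euclideanJordan hre hjordan).IsFrame Finset.univ (unitDiag K (n := n)) where
  mul_self i _ := ext_val fun a b => by
    rw [euclideanJordan_L, jmul_unitDiag_apply, val_unitDiag]
    by_cases ha : a = i
    · by_cases hb : b = i
      · subst ha hb
        simp only [if_true, Matrix.single_apply_same]
        module
      · simp [ha, hb, Ne.symm hb]
    · simp [ha, Ne.symm ha]
  mul_of_ne i _ j _ hij := ext_val fun a b => by
    rw [euclideanJordan_L, jmul_unitDiag_apply, val_unitDiag]
    have h0 : (0 : HermMat K n).val a b = 0 := rfl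
    rw [h0]
    by_cases ha : i = a
    · subst ha
      by_cases hb : i = b
      · subst hb
        simp [hij]
      · simp [hb]
    · simp [ha]
  sum_one := by
    have h := val_sum_unitDiag (K := K) (n := n) fun _ => 1
    simp only [one_smul] at h
    apply val_injective
    rw [h]
    exact Matrix.diagonal_one

/-- The Riesz vector of the trace form is fixed by sign changes, which kill its off-diagonal
entries, and by permutations, which equalise the diagonal. So it is `κ e`, and evaluation at `e`
gives `κ ‖e‖² = dim V > 0`. -/
theorem exists_isTraceConst [Nontrivial (HermMat K n)] :
    ∃ κ, (euclideanJordan hre hjordan).IsTraceConst κ := by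
  obtain ⟨τ, hτ, hfix⟩ := (euclideanJordan hre hjordan).exists_trace_vector
  have hoff : ∀ i j, i ≠ j → τ.val i j = 0 := by
    intro i j hij
    have hs : ∀ k, (if k = i then (-1 : ℝ) else 1) * (if k = i then (-1 : ℝ) else 1) = 1 := by
      intro k
      split_ifs <;> norm_num
    have h1 := hfix (signEquiv _ hs) (signEquiv_jmul _ hs) (inner_signEquiv _ hs)
    have h2 := congrArg (fun x => x.val i j) h1
    simp only [val_signEquiv, if_true, if_neg hij.symm] at h2
    have h3 : (2 : ℝ) • τ.val i j = 0 := by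
      linear_combination (norm := module) -h2
    simpa using h3
  have hdiag : ∀ i j, τ.val i i = τ.val j j := by
    intro i j
    have h1 := hfix (permEquiv (Equiv.swap i j)) (permEquiv_jmul _) (inner_permEquiv _)
    have h2 := congrArg (fun x => x.val j j) h1
    simpa [val_permEquiv] using h2
  obtain ⟨κ, hκ⟩ : ∃ κ : ℝ, τ = κ • (1 : HermMat K n) := by
    rcases isEmpty_or_nonempty (Fin n) with hn | ⟨⟨i₀⟩⟩
    · exact ⟨0, ext_val fun i => hn.elim i⟩
    · refine ⟨HermitianScalars.re (τ.val i₀ i₀), ext_val fun i j => ?_⟩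
      rw [val_smul, val_one, Matrix.smul_apply, Matrix.one_apply]
      split_ifs with hij
      · subst hij
        rw [← hdiag i i₀]
        exact HermitianScalars.eq_re_smul_one _ (τ.star_val_apply i i)
      · rw [hoff i j hij, smul_zero]
  refine ⟨κ, ?_, fun y => ?_⟩
  · have h1 := hτ (euclideanJordan hre hjordan).one
    rw [(euclideanJordan hre hjordan).L_one, hκ, real_inner_smul_left] at h1
    have h2 : LinearMap.trace ℝ (HermMat K n)
        ((1 : HermMat K n →L[ℝ] HermMat K n) : HermMat K n →ₗ[ℝ] HermMat K n) =
        Module.finrank ℝ (HermMat K n) := LinearMap.trace_one ℝ _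
    rw [h2] at h1
    have h3 : (0 : ℝ) < Module.finrank ℝ (HermMat K n) := by
      exact_mod_cast Module.finrank_pos
    have h4 : (0 : ℝ) ≤ inner ℝ (1 : HermMat K n) (1 : HermMat K n) := real_inner_self_nonneg
    exact pos_of_mul_pos_left (h1 ▸ h3) h4
  · rw [hτ, hκ, real_inner_smul_left]
    rfl

end

end HermMat

/-! ### Associative scalars -/

section Assoc

variable {K : Type} [NonAssocRing K] [StarRing K] [Module ℝ K] [HermitianScalars K] {n : ℕ}

theorem HermMat.jordan_of_assoc (hassoc : ∀ a b c : K, a * b * c = a * (b * c))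
    (x y : HermMat K n) : HermMat.jmul x (HermMat.jmul (HermMat.jmul x x) y) =
      HermMat.jmul (HermMat.jmul x x) (HermMat.jmul x y) := by
  have hm : ∀ A B C : Matrix (Fin n) (Fin n) K, A * B * C = A * (B * C) := by
    intro A B C
    ext i j
    simp only [Matrix.mul_apply, Finset.sum_mul, Finset.mul_sum, hassoc]
    rw [Finset.sum_comm]
  apply HermMat.val_injective
  simp only [HermMat.val_jmul, mul_add, add_mul, smul_mul_assoc, mul_smul_comm, hm]
  module

end Assoc

/-! ### The Albert algebra -/

namespace Octonion

noncomputable section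

theorem reLm_mul_assoc (a b c : Octonion) : reLm (a * b * c) = reLm (a * (b * c)) := by
  simp only [reLm_apply, fst_mul, snd_mul, Quaternion.re_sub, Quaternion.re_mul,
    Quaternion.imI_sub, Quaternion.imJ_sub, Quaternion.imK_sub, Quaternion.imI_mul,
    Quaternion.imJ_mul, Quaternion.imK_mul, Quaternion.re_star, Quaternion.imI_star,
    Quaternion.imJ_star, Quaternion.imK_star, Quaternion.re_add, Quaternion.imI_add,
    Quaternion.imJ_add, Quaternion.imK_add, star_add, star_mul, star_star]
  ring

/-- The inner product `Re (a b̄)`. -/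
def dot : Octonion →ₗ[ℝ] Octonion →ₗ[ℝ] ℝ :=
  LinearMap.mk₂ ℝ (fun a b => reLm (a * star b))
    (fun a b c => by rw [add_mul, map_add])
    (fun r a b => by rw [smul_mul_assoc, map_smul])
    (fun a b c => by rw [star_add, mul_add, map_add])
    (fun r a b => by rw [star_smul, star_trivial, mul_smul_comm, map_smul])

theorem dot_eq (a b : Octonion) : dot a b = reLm (a * star b) := rfl

theorem dot_apply (a b : Octonion) : dot a b = a.fst.re * b.fst.re + a.fst.imI * b.fst.imI +
    a.fst.imJ * b.fst.imJ + a.fst.imK * b.fst.imK + a.snd.re * b.snd.re +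
    a.snd.imI * b.snd.imI + a.snd.imJ * b.snd.imJ + a.snd.imK * b.snd.imK := by
  simp only [dot_eq, reLm_apply, fst_mul, fst_star, snd_star, Quaternion.re_sub,
    Quaternion.re_mul, Quaternion.re_star, Quaternion.imI_star, Quaternion.imJ_star,
    Quaternion.imK_star, Quaternion.re_neg, Quaternion.imI_neg, Quaternion.imJ_neg,
    Quaternion.imK_neg, star_neg]
  ring

theorem dot_comm (a b : Octonion) : dot a b = dot b a := by
  rw [dot_apply, dot_apply]
  ring

theorem dot_star_star (a b : Octonion) : dot (star a) (star b) = dot a b := by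
  rw [dot_eq, dot_comm a b, dot_eq, star_star]
  exact HermitianScalars.re_mul_comm (K := Octonion) (star a) b

theorem dot_mul_left (a b c : Octonion) : dot (a * b) c = dot a (c * star b) := by
  rw [dot_eq, dot_eq, star_mul, star_star, reLm_mul_assoc]

theorem dot_mul_right (a b c : Octonion) : dot (a * b) c = dot b (star a * c) := by
  rw [← dot_star_star, star_mul, dot_mul_left, ← dot_star_star b, star_mul, star_star]

/-- The polarised alternative law. It is the only octonion product identity checked in coordinates
apart from `reLm_mul_assoc` and the formula for `dot`. -/
theorem mul_mul_star_add (a b v : Octonion) :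
    a * b * star v + a * v * star b = (2 * dot b v) • a := by
  rw [dot_apply]
  ext <;> simp <;> ring

theorem mul_star_mul_add (c w a : Octonion) :
    c * (star w * a) + w * (star c * a) = (2 * dot c w) • a := by
  apply star_injective
  have h := mul_mul_star_add (star a) w c
  simpa [dot_comm c w] using h

theorem mul_mul_star_self (a b : Octonion) : a * b * star b = dot b b • a := by
  have h := mul_mul_star_add a b b
  rw [← two_smul ℝ, mul_smul] at h
  exact smul_right_injective _ two_ne_zero h

theorem mul_star_mul_self (c a : Octonion) : c * (star c * a) = dot c c • a := by
  have h := mul_star_mul_add c c a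
  rw [← two_smul ℝ, mul_smul] at h
  exact smul_right_injective _ two_ne_zero h

theorem mul_mul_star_self_right (a b : Octonion) : a * star b * b = dot b b • a := by
  simpa [dot_star_star] using mul_mul_star_self a (star b)

theorem star_mul_mul_self (c a : Octonion) : star c * (c * a) = dot c c • a := by
  simpa [dot_star_star] using mul_star_mul_self (star c) a

/-- A form of the middle Moufang identity. -/
theorem mul_mul_mul_star (a c v : Octonion) : a * v * (star c * a) =
    (2 * dot (star a * c) v) • a - dot a a • (c * star v) := by
  -- The polarised law for `v` and `ā c`, whose conjugate is `c̄ a`; then `a (ā c) = |a|² c`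
  -- simplifies the second term.
  have h1 : (a * v) * (star c * a) + a * (star a * c) * star v = (2 * dot v (star a * c)) • a := by
    rw [← mul_mul_star_add, star_mul, star_star]
  rw [mul_star_mul_self, smul_mul_assoc, dot_comm v] at h1
  rw [← h1, add_sub_cancel_right]

/-- The linear equivalence with pairs of quaternions. -/
def toProdEquiv : Octonion ≃ₗ[ℝ] ℍ[ℝ] × ℍ[ℝ] where
  toFun := toProd
  invFun p := ⟨p.1, p.2⟩
  map_add' _ _ := rfl
  map_smul' _ _ := rfl
  left_inv _ := rfl
  right_inv _ := rfl

instance : FiniteDimensional ℝ Octonion := toProdEquiv.symm.finiteDimensional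

instance : Nontrivial Octonion :=
  ⟨1, 0, fun h => one_ne_zero (α := ℍ[ℝ]) (congrArg fst h)⟩

end

end Octonion

/-! ### The Jordan identity for octonionic `3 × 3` matrices -/

namespace HermMat

open Octonion

theorem sum_fin_three_of_ne {M : Type*} [AddCommMonoid M] (f : Fin 3 → M) {i j k : Fin 3}
    (hij : i ≠ j) (hik : i ≠ k) (hjk : j ≠ k) : ∑ l, f l = f i + f j + f k := by
  have h : (Finset.univ : Finset (Fin 3)) = {i, j, k} := by
    revert i j k
    decide
  rw [h, Finset.sum_insert (by simp [hij, hik]), Finset.sum_pair hjk, add_assoc]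

/-- The diagonal entries as real numbers. -/
noncomputable def diagRe (x : HermMat Octonion 3) (i : Fin 3) : ℝ := reLm (x.val i i)

theorem val_diag (x : HermMat Octonion 3) (i : Fin 3) : x.val i i = x.diagRe i • 1 :=
  HermitianScalars.eq_re_smul_one _ (x.star_val_apply i i)

theorem reLm_one : reLm 1 = 1 := rfl

section Entries

variable {i j k : Fin 3} (hij : i ≠ j) (hik : i ≠ k) (hjk : j ≠ k)
include hij hik hjk

theorem val_jmul_of_ne (x y : HermMat Octonion 3) : (jmul x y).val i j =
    (1 / 2 : ℝ) • ((x.diagRe i + x.diagRe j) • y.val i j + (y.diagRe i + y.diagRe j) • x.val i j +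
      x.val i k * y.val k j + y.val i k * x.val k j) := by
  rw [val_jmul, Matrix.smul_apply, Matrix.add_apply, Matrix.mul_apply, Matrix.mul_apply,
    sum_fin_three_of_ne _ hij hik hjk, sum_fin_three_of_ne _ hij hik hjk, x.val_diag, x.val_diag,
    y.val_diag, y.val_diag]
  simp only [smul_mul_assoc, mul_smul_comm, one_mul, mul_one]
  module

theorem diagRe_jmul (x y : HermMat Octonion 3) : (jmul x y).diagRe i =
    x.diagRe i * y.diagRe i + dot (x.val i j) (y.val i j) + dot (x.val i k) (y.val i k) := by
  rw [diagRe, val_jmul, Matrix.smul_apply, Matrix.add_apply, Matrix.mul_apply, Matrix.mul_apply,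
    sum_fin_three_of_ne _ hij hik hjk, sum_fin_three_of_ne _ hij hik hjk, x.val_diag,
    y.val_diag, ← x.star_val_apply i j, ← x.star_val_apply i k, ← y.star_val_apply i j,
    ← y.star_val_apply i k]
  simp only [smul_mul_assoc, mul_smul_comm, one_mul, map_add, map_smul, ← dot_eq, reLm_one,
    smul_eq_mul]
  rw [dot_comm (y.val i j), dot_comm (y.val i k)]
  ring

/-- With `i, j, k` distinct, both sides are expressed through the real diagonals and the entries at
`ij`, `ik`, `jk`. The products whose bracketing matters are then compared by alternativity and the
Moufang identity. -/
theorem jordan_val_of_ne (x y : HermMat Octonion 3) :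
    (jmul x (jmul (jmul x x) y)).val i j = (jmul (jmul x x) (jmul x y)).val i j := by
  have e1 := fun x y => val_jmul_of_ne hij hik hjk x y
  have e2 := fun x y => val_jmul_of_ne hik hij hjk.symm x y
  have e3 := fun x y => val_jmul_of_ne hjk hij.symm hik.symm x y
  have d1 := fun x y => diagRe_jmul hij hik hjk x y
  have d2 := fun x y => diagRe_jmul hij.symm hjk hik x y
  have d3 := fun x y => diagRe_jmul hik.symm hjk.symm hij x y
  have s1 : ∀ x : HermMat Octonion 3, x.val j i = star (x.val i j) := fun x =>
    (x.star_val_apply i j).symm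
  have s2 : ∀ x : HermMat Octonion 3, x.val k i = star (x.val i k) := fun x =>
    (x.star_val_apply i k).symm
  have s3 : ∀ x : HermMat Octonion 3, x.val k j = star (x.val j k) := fun x =>
    (x.star_val_apply j k).symm
  simp only [d1, d2, d3, s1, s2, s3, e1, e2, e3, dot_star_star]
  generalize x.diagRe i = di, x.diagRe j = dj, x.diagRe k = dk, y.diagRe i = ei,
    y.diagRe j = ej, y.diagRe k = ek, x.val i j = a, x.val i k = c, x.val j k = b,
    y.val i j = u, y.val i k = w, y.val j k = v
  have p1 := mul_mul_mul_star a c b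
  have p2 := mul_mul_mul_star u c b
  have p3 := mul_mul_mul_star (a + u) c b
  have p4 := mul_mul_mul_star a c v
  have p5 := mul_mul_mul_star a w b
  have l1 := mul_star_mul_add c (a * b) u
  have l2 := mul_star_mul_add c w a
  have l3 := mul_star_mul_add c w (c * star b)
  have r1 := mul_mul_star_add u b (star a * c)
  have r2 := mul_mul_star_add a b v
  have r3 := mul_mul_star_add (c * star b) b v
  have h1 : dot (star u * c) b = dot (c * star b) u := by
    rw [dot_mul_right, star_star, dot_comm, dot_mul_left, dot_comm]
  have h2 : dot c (a * b) = dot (star a * c) b := by rw [dot_mul_right, star_star]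
  have h3 : dot (star a * w) b = dot (a * b) w := by rw [dot_mul_right, star_star, dot_comm]
  simp only [map_add, map_smul, LinearMap.add_apply, LinearMap.smul_apply, smul_eq_mul, star_add,
    star_smul, star_mul, star_star, star_trivial, mul_add, add_mul, smul_mul_assoc, mul_smul_comm,
    smul_add, smul_smul, mul_mul_star_self, mul_star_mul_self, mul_mul_star_self_right,
    star_mul_mul_self, dot_comm u a, dot_comm b (star a * c), h1, h2, h3]
    at p1 p2 p3 p4 p5 l1 l2 l3 r1 r2 r3 ⊢
  linear_combination (norm := module) (-1 / 2 : ℝ) • p3 + (1 / 2 : ℝ) • p1 + (1 / 2 : ℝ) • p2 +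
    (1 / 4 : ℝ) • l1 + (1 / 4 : ℝ) • r1 + (1 / 4 * (di - dk)) • r2 - (1 / 4 : ℝ) • p4 +
    (1 / 4 : ℝ) • r3 + (1 / 4 * (dj - dk)) • l2 - (1 / 4 : ℝ) • p5 + (1 / 4 : ℝ) • l3

/-- Diagonal entries are real, so both sides are polynomials in values of `dot`; the adjunction
rules for multiplication bring these to a common form. -/
theorem jordan_diagRe (x y : HermMat Octonion 3) :
    (jmul x (jmul (jmul x x) y)).diagRe i = (jmul (jmul x x) (jmul x y)).diagRe i := by
  have e1 := fun x y => val_jmul_of_ne hij hik hjk x y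
  have e2 := fun x y => val_jmul_of_ne hik hij hjk.symm x y
  have e3 := fun x y => val_jmul_of_ne hjk hij.symm hik.symm x y
  have d1 := fun x y => diagRe_jmul hij hik hjk x y
  have d2 := fun x y => diagRe_jmul hij.symm hjk hik x y
  have d3 := fun x y => diagRe_jmul hik.symm hjk.symm hij x y
  have s1 : ∀ x : HermMat Octonion 3, x.val j i = star (x.val i j) := fun x =>
    (x.star_val_apply i j).symm
  have s2 : ∀ x : HermMat Octonion 3, x.val k i = star (x.val i k) := fun x =>
    (x.star_val_apply i k).symm
  have s3 : ∀ x : HermMat Octonion 3, x.val k j = star (x.val j k) := fun x =>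
    (x.star_val_apply j k).symm
  simp only [d1, d2, d3, s1, s2, s3, e1, e2, e3, dot_star_star]
  generalize x.diagRe i = di, x.diagRe j = dj, x.diagRe k = dk, y.diagRe i = ei,
    y.diagRe j = ej, y.diagRe k = ek, x.val i j = a, x.val i k = c, x.val j k = b,
    y.val i j = u, y.val i k = w, y.val j k = v
  have h1 : dot c (a * v) = dot a (c * star v) := by rw [dot_comm, dot_mul_left]
  have h2 : dot c (u * b) = dot (c * star b) u := by
    rw [dot_comm, dot_mul_left, dot_comm]
  have h3 : dot a (w * star b) = dot (a * b) w := by rw [dot_mul_left]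
  have h4 : dot c (a * b) = dot a (c * star b) := by rw [dot_comm, dot_mul_left]
  have h5 : dot (a * b) c = dot a (c * star b) := dot_mul_left _ _ _
  have h6 : dot (c * star b) (w * star b) = dot b b * dot c w := by
    rw [dot_mul_left, star_star, mul_mul_star_self_right, map_smul, smul_eq_mul]
  have h7 : dot (a * b) (u * b) = dot b b * dot a u := by
    rw [dot_mul_left, mul_mul_star_self, map_smul, smul_eq_mul]
  have h8 : dot a (w * (star c * a)) = dot a a * dot c w := by
    rw [dot_comm, dot_mul_left, star_mul, star_star, mul_star_mul_self, map_smul, smul_eq_mul,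
      dot_comm w]
  have h9 : dot c (u * (star a * c)) = dot c c * dot a u := by
    rw [dot_comm, dot_mul_left, star_mul, star_star, mul_star_mul_self, map_smul, smul_eq_mul,
      dot_comm u]
  have h10 : dot a (a * b * star v) = dot (a * b) (a * v) := by
    rw [dot_comm (a * b), dot_mul_left]
  have h11 : dot c (c * star b * v) = dot (c * star b) (c * star v) := by
    rw [dot_comm (c * star b), dot_mul_left, star_star]
  simp only [map_add, map_smul, LinearMap.add_apply, LinearMap.smul_apply, smul_eq_mul, star_add,
    star_smul, star_mul, star_star, star_trivial, mul_add, add_mul, smul_mul_assoc, mul_smul_comm,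
    smul_add, smul_smul, dot_comm (c * star b) a, h1, h2, h3, h4, h5, h6, h7, h8, h9, h10, h11]
  ring

end Entries

theorem octonion_jordan (x y : HermMat Octonion 3) :
    jmul x (jmul (jmul x x) y) = jmul (jmul x x) (jmul x y) := by
  refine ext_val fun i j => ?_
  by_cases hij : i = j
  · subst hij
    obtain ⟨j, k, hij, hik, hjk⟩ : ∃ j k : Fin 3, i ≠ j ∧ i ≠ k ∧ j ≠ k := by
      revert i
      decide
    rw [val_diag, val_diag, jordan_diagRe hij hik hjk]
  · obtain ⟨k, hik, hjk⟩ : ∃ k : Fin 3, i ≠ k ∧ j ≠ k := by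
      revert i j
      decide
    exact jordan_val_of_ne hij hik hjk x y

end HermMat

/-! ### The theorem -/

namespace HermMat

variable {K : Type} [NonAssocRing K] [StarRing K] [Module ℝ K] [HermitianScalars K] {n : ℕ}

theorem unitDiag_ne_zero [Nontrivial K] (i : Fin n) : unitDiag K i ≠ 0 := by
  intro h
  have h1 := congrArg (fun x => x.val i i) h
  simp only [val_unitDiag, Matrix.single_apply_same] at h1
  exact one_ne_zero h1

/-- An entry in row `i` off the diagonal belongs to the Peirce `1/2`-space of the `i`-th unit, so
the hypothesis says that a quarter of it equals a half of it. -/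
theorem mem_span_unitDiag_of_jmul (y : HermMat K n)
    (hy : ∀ i, jmul (unitDiag K i) (jmul y (unitDiag K i)) = jmul y (unitDiag K i)) :
    y ∈ Submodule.span ℝ (Set.range (unitDiag K (n := n))) := by
  refine mem_span_unitDiag fun i j hij => ?_
  have h := congrArg (fun x => x.val i j) (hy i)
  simp only [jmul_comm (unitDiag K i), jmul_unitDiag_apply, if_true, if_neg hij.symm,
    zero_add] at h
  have h4 : (1 / 4 : ℝ) • y.val i j = 0 := by
    linear_combination (norm := module) -h
  simpa using h4

end HermMat

theorem exists_frobenius_posDefCone (K : Type) [NonAssocRing K] [StarRing K] [Module ℝ K]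
    [HermitianScalars K] [FiniteDimensional ℝ K] [Nontrivial K] (n : ℕ) (hn : 1 ≤ n)
    (hre : ∀ a b c : K, HermitianScalars.re (a * b * c) = HermitianScalars.re (a * (b * c)))
    (hjordan : ∀ x y : HermMat K n, x.jmul ((x.jmul x).jmul y) = (x.jmul x).jmul (x.jmul y)) :
    ∃ (S : PreFrobeniusData (HermMat K n))
      (σ : coneAutZero (posDefCone K n) ≃* coneAutZero (posDefCone K n)),
      (IsRiemannianSymmetricSpace (posDefCone K n) S.g ∧
        IsSymmetricPair (coneAutZero (posDefCone K n)) σ (posDefCone K n) S.g 1 ∧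
        ¬ IsCompact (posDefCone K n)) ∧
      (IsPotentialPreFrobenius (posDefCone K n) S ∧
        ∀ x ∈ posDefCone K n, ∀ u v, S.g x u v = iteratedFDeriv ℝ 2 S.pot x ![u, v]) ∧
      ∃ 𝔞 : Submodule ℝ (HermMat K n →L[ℝ] HermMat K n),
        (𝔞 : Set (HermMat K n →L[ℝ] HermMat K n)) ⊆
          tangentPart (coneAutZero (posDefCone K n)) σ ∧
        (∀ X ∈ 𝔞, ∀ Y ∈ 𝔞, ∀ Z ∈ 𝔞, ⁅⁅X, Y⁆, Z⁆ ∈ 𝔞) ∧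
        (∀ X ∈ 𝔞, ∀ Y ∈ 𝔞, ⁅X, Y⁆ = 0) ∧
        (∀ Y ∈ tangentPart (coneAutZero (posDefCone K n)) σ, (∀ X ∈ 𝔞, ⁅X, Y⁆ = 0) → Y ∈ 𝔞) ∧
        IsFrobeniusLocus (posDefCone K n) S
          ((fun X : HermMat K n →L[ℝ] HermMat K n => NormedSpace.exp X 1) '' 𝔞) := by
  have : Nontrivial (HermMat K n) := ⟨_, _, HermMat.unitDiag_ne_zero (⟨0, hn⟩ : Fin n)⟩
  obtain ⟨κ, hκ⟩ := HermMat.exists_isTraceConst hre hjordan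
  have h := (HermMat.euclideanJordan hre hjordan).exists_frobenius hκ
    (HermMat.isFrame_unitDiag hre hjordan) HermMat.unitDiag_ne_zero
    HermMat.mem_span_unitDiag_of_jmul
  rw [HermMat.cone_euclideanJordan] at h
  exact h

theorem mainTheorem5 (K : Type) [NonAssocRing K] [StarRing K] [Module ℝ K] [HermitianScalars K]
    (n : ℕ) (hcase : IsConeCase K n) :
    ∃ (S : PreFrobeniusData (HermMat K n))
      (σ : coneAutZero (posDefCone K n) ≃* coneAutZero (posDefCone K n)),
      -- 1) a non-compact symmetric space
      (IsRiemannianSymmetricSpace (posDefCone K n) S.g ∧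
        IsSymmetricPair (coneAutZero (posDefCone K n)) σ (posDefCone K n) S.g 1 ∧
        ¬ IsCompact (posDefCone K n)) ∧
      -- 2) a pre-Frobenius structure, whose metric is the Hessian of its potential
      (IsPotentialPreFrobenius (posDefCone K n) S ∧
        ∀ x ∈ posDefCone K n, ∀ u v, S.g x u v = iteratedFDeriv ℝ 2 S.pot x ![u, v]) ∧
      -- 3) a Frobenius locus `exp 𝔞`, with `𝔞 ⊆ 𝔱` a Lie triple system (a maximal abelian one)
      ∃ 𝔞 : Submodule ℝ (HermMat K n →L[ℝ] HermMat K n),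
        (𝔞 : Set (HermMat K n →L[ℝ] HermMat K n)) ⊆
          tangentPart (coneAutZero (posDefCone K n)) σ ∧
        (∀ X ∈ 𝔞, ∀ Y ∈ 𝔞, ∀ Z ∈ 𝔞, ⁅⁅X, Y⁆, Z⁆ ∈ 𝔞) ∧
        (∀ X ∈ 𝔞, ∀ Y ∈ 𝔞, ⁅X, Y⁆ = 0) ∧
        (∀ Y ∈ tangentPart (coneAutZero (posDefCone K n)) σ, (∀ X ∈ 𝔞, ⁅X, Y⁆ = 0) → Y ∈ 𝔞) ∧
        IsFrobeniusLocus (posDefCone K n) S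
          ((fun X : HermMat K n →L[ℝ] HermMat K n => NormedSpace.exp X 1) '' 𝔞) := by
  cases hcase with
  | real _ hn =>
    exact exists_frobenius_posDefCone ℝ n hn (fun a b c => by rw [mul_assoc])
      (HermMat.jordan_of_assoc mul_assoc)
  | complex _ hn =>
    exact exists_frobenius_posDefCone ℂ n hn (fun a b c => by rw [mul_assoc])
      (HermMat.jordan_of_assoc mul_assoc)
  | quaternion _ hn =>
    exact exists_frobenius_posDefCone ℍ[ℝ] n hn (fun a b c => by rw [mul_assoc])
      (HermMat.jordan_of_assoc mul_assoc)
  | octonion =>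
    exact exists_frobenius_posDefCone Octonion 3 (by norm_num) Octonion.reLm_mul_assoc
      HermMat.octonion_jordan
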